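/- \textbf{Setting.} Let $\mu\in(0,1)$, $q^E=(\mu,0)$, $q^M=(-(1-\mu),0)$ and $$H(q,p)=\tfrac12|p|^2-\frac{1-\mu}{|q-q^E|}-\frac{\mu}{|q-q^M|}+q_1p_2-q_2p_1 ,\qquad (q,p)\in(\mathbb R^2\setminus\{q^E,q^M\})\times\mathbb R^2,$$ and let $c\in\mathbb R$ be smaller than the first (smallest) critical value of $H$. Let $P\in\{E,M\}$ be one of the two primaries, with mass $m_E=1-\mu$ resp. $m_M=\mu$. Let $\Sigma_c^P\subset H^{-1}(c)$ be the set of $(q,p)$ for which $q$ lies in the component of the Hill's region (the projection of $H^{-1}(c)$ to the $q$-plane) whose closure contains $q^P$. On $T^*S^2=\{(\xi,\eta)\in\mathbb R^3\times\mathbb R^3: |\xi|=1,\ \xi\cdot\eta=0\}$, with the symplectic form $\omega$ induced by $\sum_{i=0}^{2} d\xi_i\wedge d\eta_i$, the substitution $$q=q^P+\big(\eta_1(1-\xi_0)+\xi_1\eta_0,\ \eta_2(1-\xi_0)+\xi_2\eta_0\big),\qquad p=-\Big(\frac{\xi_1}{1-\xi_0},\frac{\xi_2}{1-\xi_0}\Big)$$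 gives the regularized Hamiltonian $Q=\tfrac12\big(|q-q^P|(H(q,p)-c)+m_P\big)^2$, which extends smoothly over the collision points with $\xi_0=1$. Let $\Sigma\subset Q^{-1}(m_P^2/2)$ consist of the points of $T^*S^2$ with $\xi_0\ne1$ which correspond to points of $\Sigma^P_c$ and of the points with $\xi_0=1$, $|\eta|=m_P$. Let $X_Q$ be given by $\omega(X_Q,\cdot)=dQ$, and let $\mathcal R(\xi_0,\xi_1,\xi_2,\eta_0,\eta_1,\eta_2)=(\xi_0,-\xi_1,\xi_2,-\eta_0,\eta_1,-\eta_2)$. A \emph{chord} $(x,T)$, $T>0$, is a solution of $x:[0,T]\to\Sigma$, $\dot x=X_Q(x)$, with $x(0),x(T)\in\mathrm{Fix}\,\mathcal R\subset T^*S^2$. \textbf{Index of a chord.} Let $n=(n_\xi,n_\eta)$ be normal to $\Sigma$, $e=\xi\times\eta/|\xi\times\eta|$, and $$X_1=\Big(e-\frac{e\cdot n_\eta}{\eta\cdot n_\eta}\,\eta\Big)\partial_\eta,\qquad X_2=e\,\partial_\xi-\frac{e\cdot n_\xi}{\eta\cdot n_\eta}\,\eta\,\partial_\eta ,$$ a frame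 of the contact structure $\ker\lambda\cap T\Sigma$, $\lambda=\eta\cdot d\xi$, with $\omega(X_2,X_1)=1$. Let $\Phi(\zeta):T_\zeta\Sigma\to\mathbb R^2$ be the linear map with $\Phi(X_Q)=0$, $\Phi(X_2)=(1,0)$, $\Phi(X_1)=(0,1)$, i.e. the projection to $\ker\lambda$ along $X_Q$ followed by the symplectic trivialization in which the vertical direction is $0\times\mathbb R$; it conjugates the action of $T\mathcal R$ on $\ker\lambda$ to the reflection with fixed locus $V=\mathbb R\times0$. With the linearized flow $T\phi^t_Q$ put $$\Psi_x(t)=\Phi(x(t))\circ T\phi_Q^t(x(0))\circ\big(\Phi(x(0))|_{\ker\lambda}\big)^{-1},\qquad \mu_{RS}(x,T):=\mu_{RS}(\Psi_x(t)V,V),\quad t\in[0,T].$$ Here, for a $C^1$ path $\Lambda$ of Lagrangian subspaces of $(\mathbb R^2,dx\wedge dy)$ all of whose crossings with $V$ are regular, $\mu_{RS}(\Lambda,V)=\frac12\,\mathrm{sign}\,\Gamma(\Lambda,V,0)+\sum_{0<t<T}\mathrm{sign}\,\Gamma(\Lambda,V,t)+\frac12\,\mathrm{sign}\,\Gamma(\Lambda,V,T)$,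 with the crossing form $\Gamma(\Lambda,V,t)(v)=\frac{d}{d\epsilon}\big|_{\epsilon=0}(dx\wedge dy)(v,w(\epsilon))$ for $v\in\Lambda(t)\cap V$, where $w(\epsilon)$ lies in a fixed Lagrangian complement of $\Lambda(t)$ and $v+w(\epsilon)\in\Lambda(t+\epsilon)$; for a general continuous path of Lagrangian subspaces it is the index of a regular path homotopic to it with fixed end points. \textbf{Lemma.} Let $(x,T)$ be a chord and $x_{\mathcal R}(t):=\mathcal R\,x(T-t)$. Then $(x_{\mathcal R},T)$ is a chord, the indices $\mu_{RS}(x,T)$ and $\mu_{RS}(x_{\mathcal R},T)$ are well defined, and $$\mu_{RS}(x,T)=\mu_{RS}(x_{\mathcal R},T).$$ -/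

import Mathlib

open Set Filter Topology
open scoped RealInnerProductSpace Matrix

noncomputable section

/-! ## The Robbin-Salamon index of a path of Lagrangian subspaces -/

namespace LagrangianPath

variable {E : Type*} [NormedAddCommGroup E] [NormedSpace ℝ E]

/-- `L` is a Lagrangian subspace: it equals its own symplectic complement. -/
def IsLagrangian (ω : LinearMap.BilinForm ℝ E) (L : Submodule ℝ E) : Prop :=
  ∀ v, v ∈ L ↔ ∀ u ∈ L, ω u v = 0

/-- A family of subspaces over `S` given by a continuous frame. Over the contractible parameter
spaces used below (intervals and rectangles) this is continuity into the Grassmannian. -/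
def IsContinuousFamily {X : Type*} [TopologicalSpace X] (S : Set X) (Λ : X → Submodule ℝ E) :
    Prop :=
  ∃ (k : ℕ) (Z : X → Fin k → E), ContinuousOn Z S ∧
    ∀ t ∈ S, LinearIndependent ℝ (Z t) ∧ Submodule.span ℝ (range (Z t)) = Λ t

/-- A continuously differentiable family of subspaces over `[0, T]`. -/
def IsC1Family (T : ℝ) (Λ : ℝ → Submodule ℝ E) : Prop :=
  ∃ (k : ℕ) (Z : ℝ → Fin k → E), ContDiffOn ℝ 1 Z (Icc 0 T) ∧
    ∀ t ∈ Icc 0 T, LinearIndependent ℝ (Z t) ∧ Submodule.span ℝ (range (Z t)) = Λ t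

/-- `q` is the crossing form of the path `Λ : [0, T] → Lagrangians` with respect to `V` at time
`t`: for `v ∈ Λ t ∩ V` and small `ε`, let `w ε ∈ W` be the vector with `v + w ε ∈ Λ (t + ε)`, where
`W` is a Lagrangian complement of `Λ t`; then `q v` is the derivative of `ω v (w ε)` at `ε = 0`
(one-sided if `t` is an end point of `[0, T]`). -/
def IsCrossingForm (ω : LinearMap.BilinForm ℝ E) (T : ℝ) (Λ : ℝ → Submodule ℝ E)
    (V : Submodule ℝ E) (t : ℝ) (q : E → ℝ) : Prop :=
  ∃ W : Submodule ℝ E, IsLagrangian ω W ∧ IsCompl (Λ t) W ∧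
    ∀ v ∈ Λ t ⊓ V, ∃ w : ℝ → E,
      (∀ᶠ ε in 𝓝[{ε | t + ε ∈ Icc 0 T}] (0 : ℝ), w ε ∈ W ∧ v + w ε ∈ Λ (t + ε)) ∧
      HasDerivWithinAt (fun ε => ω v (w ε)) (q v) {ε | t + ε ∈ Icc 0 T} 0

/-- The largest dimension of a subspace of `U` on which `q` is positive definite. -/
def positiveIndex (U : Submodule ℝ E) (q : E → ℝ) : ℕ :=
  sSup {k | ∃ P : Submodule ℝ E, P ≤ U ∧ Module.finrank ℝ P = k ∧ ∀ v ∈ P, v ≠ 0 → 0 < q v}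

/-- The signature of the quadratic form `q` on `U`. -/
def signature (U : Submodule ℝ E) (q : E → ℝ) : ℤ :=
  (positiveIndex U q : ℤ) - (positiveIndex U (fun v => -q v) : ℤ)

/-- The quadratic form `q` is nondegenerate on `U` (in terms of its polar form). -/
def IsNondegenerateOn (U : Submodule ℝ E) (q : E → ℝ) : Prop :=
  ∀ u ∈ U, (∀ v ∈ U, q (u + v) - q u - q v = 0) → u = 0

/-- `Λ` is a `C¹` path of Lagrangian subspaces on `[0, T]` which has only regular crossings with
`V` (hence finitely many), and `m` is the sum of the signatures of its crossing forms, where the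
end points count one half. -/
def IsRegularIndex (ω : LinearMap.BilinForm ℝ E) (T : ℝ) (Λ : ℝ → Submodule ℝ E)
    (V : Submodule ℝ E) (m : ℝ) : Prop :=
  IsC1Family T Λ ∧ (∀ t ∈ Icc 0 T, IsLagrangian ω (Λ t)) ∧
  {t ∈ Icc 0 T | Λ t ⊓ V ≠ ⊥}.Finite ∧
  ∃ q : ℝ → E → ℝ,
    (∀ t ∈ Icc 0 T, IsCrossingForm ω T Λ V t (q t) ∧ IsNondegenerateOn (Λ t ⊓ V) (q t)) ∧
    m = (1 / 2) * (signature (Λ 0 ⊓ V) (q 0) : ℝ)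
      + ∑ᶠ t ∈ Ioo 0 T, (signature (Λ t ⊓ V) (q t) : ℝ)
      + (1 / 2) * (signature (Λ T ⊓ V) (q T) : ℝ)

/-- The Lagrangian paths `Λ₀` and `Λ₁` on `[0, T]` are homotopic with fixed end points through
Lagrangian paths. -/
def IsHomotopic (ω : LinearMap.BilinForm ℝ E) (T : ℝ) (Λ₀ Λ₁ : ℝ → Submodule ℝ E) : Prop :=
  ∃ H : ℝ × ℝ → Submodule ℝ E,
    IsContinuousFamily (Icc 0 1 ×ˢ Icc 0 T) H ∧
    (∀ p ∈ Icc (0 : ℝ) 1 ×ˢ Icc 0 T, IsLagrangian ω (H p)) ∧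
    (∀ t ∈ Icc 0 T, H (0, t) = Λ₀ t ∧ H (1, t) = Λ₁ t) ∧
    ∀ s ∈ Icc (0 : ℝ) 1, H (s, 0) = Λ₀ 0 ∧ H (s, T) = Λ₀ T

/-- `m` is the Robbin-Salamon index `μ_RS(Λ, V)` of the (not necessarily regular) continuous
Lagrangian path `Λ` on `[0, T]`: it is the index of a regular path which is homotopic to `Λ` with
fixed end points. -/
def IsRobbinSalamonIndex (ω : LinearMap.BilinForm ℝ E) (T : ℝ) (Λ : ℝ → Submodule ℝ E)
    (V : Submodule ℝ E) (m : ℝ) : Prop :=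
  ∃ Λ' : ℝ → Submodule ℝ E, IsHomotopic ω T Λ Λ' ∧ IsRegularIndex ω T Λ' V m

end LagrangianPath

/-! ## The planar circular restricted three-body problem and its Moser regularization -/

namespace ThreeBody

/-- The plane with its Euclidean norm. -/
abbrev R2 := EuclideanSpace ℝ (Fin 2)

/-- Three-space with its Euclidean norm. -/
abbrev R3 := EuclideanSpace ℝ (Fin 3)

/-- The two massive primaries. -/
inductive Primary
  | earth
  | moon

namespace Primary

/-- The other primary. -/
def other : Primary → Primary
  | earth => moon
  | moon => earth

/-- The normalized mass; `μ` is that of the moon. -/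
def mass (μ : ℝ) : Primary → ℝ
  | earth => 1 - μ
  | moon => μ

/-- The position in the rotating frame. -/
def pos (μ : ℝ) : Primary → R2
  | earth => !₂[μ, 0]
  | moon => !₂[-(1 - μ), 0]

end Primary

/-- The Hamiltonian of the restricted problem in rotating coordinates `z = (q, p)`. -/
def hamiltonian (μ : ℝ) (z : R2 × R2) : ℝ :=
  (1 / 2) * ‖z.2‖ ^ 2 - (1 - μ) / ‖z.1 - Primary.earth.pos μ‖ - μ / ‖z.1 - Primary.moon.pos μ‖
    + (z.1 0 * z.2 1 - z.1 1 * z.2 0)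

/-- The configuration space: the plane without the two primaries. -/
def configSpace (μ : ℝ) : Set R2 := {q | ∀ P : Primary, q ≠ P.pos μ}

/-- `c` lies below the first (i.e. smallest) critical value of the Hamiltonian. -/
def IsBelowFirstCriticalValue (μ c : ℝ) : Prop :=
  ∀ z : R2 × R2, z.1 ∈ configSpace μ →
    HasFDerivAt (hamiltonian μ) (0 : R2 × R2 →L[ℝ] ℝ) z → c < hamiltonian μ z

/-- The energy hypersurface `H⁻¹(c)`. -/
def energySurface (μ c : ℝ) : Set (R2 × R2) :=
  {z | z.1 ∈ configSpace μ ∧ hamiltonian μ z = c}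

/-- The Hill's region of energy `c`: the projection of `H⁻¹(c)` to the configuration space. -/
def hillRegion (μ c : ℝ) : Set R2 := Prod.fst '' energySurface μ c

/-- The connected component of the Hill's region which has the primary `P` in its closure. -/
def hillComponent (μ c : ℝ) (P : Primary) : Set R2 :=
  {q ∈ hillRegion μ c | P.pos μ ∈ closure (connectedComponentIn (hillRegion μ c) q)}

/-- The cotangent bundle `T*S²` embedded in `ℝ³ × ℝ³`. -/
def cotSphere : Set (R3 × R3) := {z | ‖z.1‖ = 1 ∧ ⟪z.1, z.2⟫ = 0}

/-- The tangent space of `T*S²` at `z`. -/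
def cotSphereTangent (z : R3 × R3) : Set (R3 × R3) :=
  {v | ⟪z.1, v.1⟫ = 0 ∧ ⟪v.1, z.2⟫ + ⟪z.1, v.2⟫ = 0}

/-- The component `y` of the stereographic projection `T*S² → T*ℝ²`, `(ξ, η) ↦ (x, y)`. -/
def stereoY (z : R3 × R3) : R2 :=
  !₂[z.2 1 * (1 - z.1 0) + z.1 1 * z.2 0, z.2 2 * (1 - z.1 0) + z.1 2 * z.2 0]

/-- The component `x` of the stereographic projection. -/
def stereoX (z : R3 × R3) : R2 := !₂[z.1 1 / (1 - z.1 0), z.1 2 / (1 - z.1 0)]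

/-- The point `(q, p)` of `T*ℝ²` which corresponds to `(ξ, η)` under the regularization at the
primary `P`: `q - q^P = y` and `p = -x`. -/
def unregularize (μ : ℝ) (P : Primary) (z : R3 × R3) : R2 × R2 :=
  (stereoY z + P.pos μ, -stereoX z)

/-- The function `f` with `|q - q^P| (H(q,p) - c) + m_P = |η| f(ξ, η)` (see
`regFactor_spec`), written such that it extends smoothly over the fibre `ξ₀ = 1` of collisions. -/
def regFactor (μ c : ℝ) (P : Primary) (z : R3 × R3) : ℝ :=
  (1 + z.1 0) / 2
    - (1 - z.1 0) * (c + P.other.mass μ / ‖stereoY z + P.pos μ - P.other.pos μ‖)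
    + ((stereoY z + P.pos μ) 1 * z.1 1 - (stereoY z + P.pos μ) 0 * z.1 2)

/-- The regularized Hamiltonian `Q = ½ |η|² f² = ½ (|q - q^P| (H(q,p) - c) + m_P)²`. -/
def regHamiltonian (μ c : ℝ) (P : Primary) (z : R3 × R3) : ℝ :=
  (1 / 2) * ‖z.2‖ ^ 2 * regFactor μ c P z ^ 2

/-- The regularized energy hypersurface `Σ`: the bounded component of `H⁻¹(c)` near the primary `P`,
transferred to `T*S²` and compactified by the circle of collisions in the fibre over `ξ₀ = 1`. -/
def regSurface (μ c : ℝ) (P : Primary) : Set (R3 × R3) :=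
  {z ∈ cotSphere |
    (z.1 0 ≠ 1 ∧ unregularize μ P z ∈ energySurface μ c ∧
      (unregularize μ P z).1 ∈ hillComponent μ c P) ∨
    (z.1 0 = 1 ∧ ‖z.2‖ = P.mass μ)}

lemma norm_stereoY {z : R3 × R3} (hz : z ∈ cotSphere) (h : z.1 0 ≠ 1) :
    ‖stereoY z‖ = ‖z.2‖ * (1 - z.1 0) := by
  obtain ⟨h1, h2⟩ := hz
  have e1 : z.1 0 ^ 2 + z.1 1 ^ 2 + z.1 2 ^ 2 = 1 := by
    have := EuclideanSpace.real_norm_sq_eq z.1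
    rw [h1, Fin.sum_univ_three] at this
    linarith
  have e2 : z.1 0 * z.2 0 + z.1 1 * z.2 1 + z.1 2 * z.2 2 = 0 := by
    have := h2
    simp only [PiLp.inner_apply, Fin.sum_univ_three, RCLike.inner_apply, conj_trivial] at this
    linarith
  have hle : 0 ≤ 1 - z.1 0 := by nlinarith [sq_nonneg (z.1 1), sq_nonneg (z.1 2)]
  have e3 := EuclideanSpace.real_norm_sq_eq z.2
  rw [Fin.sum_univ_three] at e3
  rw [← sq_eq_sq₀ (norm_nonneg _) (by positivity), mul_pow, e3, EuclideanSpace.real_norm_sq_eq,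
    Fin.sum_univ_two]
  simp only [stereoY, Matrix.cons_val_zero, Matrix.cons_val_one]
  linear_combination (z.2 0 ^ 2) * e1 + 2 * (1 - z.1 0) * (z.2 0) * e2

/-- The defining property of `f`: in the original coordinates,
`|η| f(ξ, η) = |q - q^P| (H(q, p) - c) + m_P`. -/
lemma regFactor_spec (μ c : ℝ) (P : Primary) {z : R3 × R3} (hz : z ∈ cotSphere)
    (h : z.1 0 ≠ 1) (hη : z.2 ≠ 0) :
    ‖z.2‖ * regFactor μ c P z =
      ‖(unregularize μ P z).1 - P.pos μ‖ * (hamiltonian μ (unregularize μ P z) - c)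
        + P.mass μ := by
  have hy := norm_stereoY hz h
  obtain ⟨h1, h2⟩ := hz
  have e1 : z.1 0 ^ 2 + z.1 1 ^ 2 + z.1 2 ^ 2 = 1 := by
    have := EuclideanSpace.real_norm_sq_eq z.1
    rw [h1, Fin.sum_univ_three] at this
    linarith
  have h0 : 1 - z.1 0 ≠ 0 := sub_ne_zero.2 (Ne.symm h)
  have hη' : ‖z.2‖ ≠ 0 := norm_ne_zero_iff.2 hη
  have hx : ‖stereoX z‖ ^ 2 * (1 - z.1 0) = 1 + z.1 0 := by
    rw [EuclideanSpace.real_norm_sq_eq, Fin.sum_univ_two]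
    simp only [stereoX, Matrix.cons_val_zero, Matrix.cons_val_one]
    field_simp
    linear_combination e1
  have hx0 : stereoX z 0 * (1 - z.1 0) = z.1 1 := by
    simp only [stereoX, Matrix.cons_val_zero]
    field_simp
  have hx1 : stereoX z 1 * (1 - z.1 0) = z.1 2 := by
    exact div_mul_cancel₀ _ h0
  have key : hamiltonian μ (unregularize μ P z) =
      (1 / 2) * ‖stereoX z‖ ^ 2 - P.mass μ / ‖stereoY z‖
        - P.other.mass μ / ‖stereoY z + P.pos μ - P.other.pos μ‖
        + (-(stereoY z + P.pos μ) 0 * stereoX z 1 + (stereoY z + P.pos μ) 1 * stereoX z 0) := by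
    cases P <;> simp [hamiltonian, unregularize, Primary.mass, Primary.other] <;> ring
  rw [key]
  have : (unregularize μ P z).1 - P.pos μ = stereoY z := by simp [unregularize]
  rw [this, hy, regFactor]
  have hm : ‖z.2‖ * (1 - z.1 0) * (P.mass μ / (‖z.2‖ * (1 - z.1 0))) = P.mass μ := by
    field_simp
  linear_combination (-‖z.2‖ / 2) * hx + hm + ‖z.2‖ * (stereoY z + P.pos μ) 0 * hx1
    - ‖z.2‖ * (stereoY z + P.pos μ) 1 * hx0

/-- `Σ` lies in the level set `Q⁻¹(m_P² / 2)`. -/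
lemma regHamiltonian_of_mem_regSurface (μ c : ℝ) (P : Primary) {z : R3 × R3}
    (hz : z ∈ regSurface μ c P) : regHamiltonian μ c P z = P.mass μ ^ 2 / 2 := by
  obtain ⟨hT, ⟨h0, ⟨hq, hc⟩, -⟩ | ⟨h0, hη⟩⟩ := hz
  · have hη : z.2 ≠ 0 := by
      intro h
      apply hq P
      have := norm_stereoY hT h0
      rw [h, norm_zero, zero_mul, norm_eq_zero] at this
      simp [unregularize, this]
    have := regFactor_spec μ c P hT h0 hη
    rw [hc, sub_self, mul_zero, zero_add] at this
    rw [regHamiltonian, ← this]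
    ring
  · have e1 : z.1 0 ^ 2 + z.1 1 ^ 2 + z.1 2 ^ 2 = 1 := by
      have := EuclideanSpace.real_norm_sq_eq z.1
      rw [hT.1, Fin.sum_univ_three] at this
      linarith
    have a1 : z.1 1 = 0 := by
      rw [h0] at e1
      nlinarith [sq_nonneg (z.1 1), sq_nonneg (z.1 2)]
    have a2 : z.1 2 = 0 := by
      rw [h0] at e1
      nlinarith [sq_nonneg (z.1 1), sq_nonneg (z.1 2)]
    simp [regHamiltonian, regFactor, h0, a1, a2, hη]
    ring

/-! ### Hamiltonian dynamics on `T*S²` -/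

/-- The symplectic form `dξ ∧ dη` on `ℝ³ × ℝ³`, restricted to `T*S²` where it is used. -/
def cotForm : LinearMap.BilinForm ℝ (R3 × R3) :=
  (innerₗ R3).compl₁₂ (LinearMap.fst ℝ R3 R3) (LinearMap.snd ℝ R3 R3)
    - (innerₗ R3).compl₁₂ (LinearMap.snd ℝ R3 R3) (LinearMap.fst ℝ R3 R3)

lemma cotForm_apply (u v : R3 × R3) : cotForm u v = ⟪u.1, v.2⟫ - ⟪u.2, v.1⟫ := rfl

lemma cotForm_self (u : R3 × R3) : cotForm u u = 0 := by
  rw [cotForm_apply, real_inner_comm, sub_self]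

lemma cotForm_swap (u v : R3 × R3) : cotForm u v = -cotForm v u := by
  rw [cotForm_apply, cotForm_apply, real_inner_comm v.2, real_inner_comm v.1]
  ring

/-- Partial gradient in `ξ`. -/
def gradBase (Q : R3 × R3 → ℝ) (z : R3 × R3) : R3 := gradient (fun ξ => Q (ξ, z.2)) z.1

/-- Partial gradient in `η`. -/
def gradFibre (Q : R3 × R3 → ℝ) (z : R3 × R3) : R3 := gradient (fun η => Q (z.1, η)) z.2

/-- The Hamiltonian vector field on `T*S²` of the restriction of `Q`, i.e. the field tangent to
`T*S²` with `ω(X_Q, ·) = dQ` on `T*S²` (see `hamField_mem_tangent` and `cotForm_hamField`). -/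
def hamField (Q : R3 × R3 → ℝ) (z : R3 × R3) : R3 × R3 :=
  (gradFibre Q z - ⟪z.1, gradFibre Q z⟫ • z.1,
    -gradBase Q z + (⟪z.1, gradBase Q z⟫ - ⟪z.2, gradFibre Q z⟫) • z.1
      + ⟪z.1, gradFibre Q z⟫ • z.2)

lemma inner_gradBase {Q : R3 × R3 → ℝ} {z : R3 × R3} (hQ : DifferentiableAt ℝ Q z) (u : R3) :
    ⟪gradBase Q z, u⟫ = fderiv ℝ Q z (u, 0) := by
  have h : HasFDerivAt (fun ξ => Q (ξ, z.2))
      ((fderiv ℝ Q z).comp ((ContinuousLinearMap.id ℝ R3).prod 0)) z.1 :=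
    HasFDerivAt.comp (g := Q) z.1 (by exact hQ.hasFDerivAt)
      ((hasFDerivAt_id z.1).prodMk (hasFDerivAt_const z.2 z.1))
  rw [gradBase, inner_gradient_left, h.fderiv]
  simp

lemma inner_gradFibre {Q : R3 × R3 → ℝ} {z : R3 × R3} (hQ : DifferentiableAt ℝ Q z) (u : R3) :
    ⟪gradFibre Q z, u⟫ = fderiv ℝ Q z (0, u) := by
  have h : HasFDerivAt (fun η => Q (z.1, η))
      ((fderiv ℝ Q z).comp ((0 : R3 →L[ℝ] R3).prod (ContinuousLinearMap.id ℝ R3))) z.2 :=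
    HasFDerivAt.comp (g := Q) z.2 (by exact hQ.hasFDerivAt)
      ((hasFDerivAt_const z.1 z.2).prodMk (hasFDerivAt_id z.2))
  rw [gradFibre, inner_gradient_left, h.fderiv]
  simp

lemma hamField_mem_tangent (Q : R3 × R3 → ℝ) {z : R3 × R3} (hz : z ∈ cotSphere) :
    hamField Q z ∈ cotSphereTangent z := by
  obtain ⟨h1, h2⟩ := hz
  have h3 : ⟪z.1, z.1⟫ = 1 := by rw [real_inner_self_eq_norm_sq, h1]; norm_num
  constructor
  · simp only [hamField, inner_sub_right, inner_smul_right, h3]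
    ring
  · simp only [hamField, inner_sub_left, inner_smul_left, inner_add_right, inner_neg_right,
      inner_smul_right, h2, h3, conj_trivial, real_inner_comm z.2 (gradFibre Q z)]
    ring

lemma cotForm_hamField {Q : R3 × R3 → ℝ} {z : R3 × R3} (hQ : DifferentiableAt ℝ Q z)
    {v : R3 × R3} (hv : v ∈ cotSphereTangent z) :
    cotForm (hamField Q z) v = fderiv ℝ Q z v := by
  have hsplit : fderiv ℝ Q z v = ⟪gradBase Q z, v.1⟫ + ⟪gradFibre Q z, v.2⟫ := by
    rw [inner_gradBase hQ, inner_gradFibre hQ, ← map_add]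
    simp
  obtain ⟨h1, h2⟩ := hv
  rw [hsplit, cotForm_apply]
  simp only [hamField, inner_sub_left, inner_add_left, inner_neg_left, inner_smul_left,
    conj_trivial, h1]
  rw [real_inner_comm] at h2
  linear_combination (-⟪z.1, gradFibre Q z⟫) * h2

/-- `(x, T)` is an integral curve on `[0, T]` of the vector field `X`. -/
def IsIntegralCurve (X : R3 × R3 → R3 × R3) (T : ℝ) (x : ℝ → R3 × R3) : Prop :=
  ∀ t ∈ Icc 0 T, HasDerivWithinAt x (X (x t)) (Icc 0 T) t

/-- `A t` is the linearization at `x 0` of the time `t` flow of `X`, for `t ∈ [0, T]`: the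
fundamental solution of the linearized (variational) equation along the integral curve `x`. -/
def IsLinearizedFlow (X : R3 × R3 → R3 × R3) (T : ℝ) (x : ℝ → R3 × R3)
    (A : ℝ → (R3 × R3 →L[ℝ] R3 × R3)) : Prop :=
  A 0 = ContinuousLinearMap.id ℝ (R3 × R3) ∧
  ∀ t ∈ Icc 0 T, HasDerivWithinAt A ((fderiv ℝ X (x t)).comp (A t)) (Icc 0 T) t

/-- The reflection `ρ(ξ₀, ξ₁, ξ₂) = (ξ₀, -ξ₁, ξ₂)`. -/
def reflect (ξ : R3) : R3 := !₂[ξ 0, -ξ 1, ξ 2]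

/-- The anti-symplectic involution `𝓡(ξ, η) = (ρ ξ, -ρ η)`. -/
def involution (z : R3 × R3) : R3 × R3 := (reflect z.1, -reflect z.2)

/-- The fixed locus of `𝓡` in `T*S²`. -/
def fixLocus : Set (R3 × R3) := {z ∈ cotSphere | involution z = z}

/-- `(x, T)` is a chord: an integral curve of `X_Q` on `Σ` with both end points in `Fix 𝓡`. -/
def IsChord (μ c : ℝ) (P : Primary) (T : ℝ) (x : ℝ → R3 × R3) : Prop :=
  (∀ t ∈ Icc 0 T, x t ∈ regSurface μ c P) ∧
  IsIntegralCurve (hamField (regHamiltonian μ c P)) T x ∧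
  x 0 ∈ fixLocus ∧ x T ∈ fixLocus

/-- The reflected chord `x_𝓡(t) = 𝓡 (x (T - t))`. -/
def reflectedChord (T : ℝ) (x : ℝ → R3 × R3) : ℝ → R3 × R3 := fun t => involution (x (T - t))

/-! ### The trivialization of the contact structure and the index of a chord -/

/-- The unit vector `ξ × η / |ξ × η|`. -/
def crossUnit (z : R3 × R3) : R3 :=
  ‖(WithLp.toLp 2 (z.1.ofLp ⨯₃ z.2.ofLp) : R3)‖⁻¹ • (WithLp.toLp 2 (z.1.ofLp ⨯₃ z.2.ofLp) : R3)

/-- The vertical section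
`X₁ = (e - (e · n_η) / (η · n_η) η) ∂_η` of the contact structure `ker λ ∩ TΣ`, where
`e = ξ × η / |ξ × η|` and where `n = (n_ξ, n_η)` is normal to `Σ`. Since `X₁` does not change when
`n` is rescaled, `n` is taken to be the gradient of `Q`. -/
def frameVert (Q : R3 × R3 → ℝ) (z : R3 × R3) : R3 × R3 :=
  (0, crossUnit z - (⟪crossUnit z, gradFibre Q z⟫ / ⟪z.2, gradFibre Q z⟫) • z.2)

/-- The section `X₂ = e ∂_ξ - (e · n_ξ) / (η · n_η) η ∂_η` of the contact structure. -/
def frameHor (Q : R3 × R3 → ℝ) (z : R3 × R3) : R3 × R3 :=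
  (crossUnit z, -(⟪crossUnit z, gradBase Q z⟫ / ⟪z.2, gradFibre Q z⟫) • z.2)

/-- The symplectic trivialization `Φ(z)`, as a map on `TΣ` with values in `ℝ²`: it kills `X_Q`, that
is, it projects to the contact structure along the flow direction, and there `Φ(b X₂ + a X₁) =
(b, a)`; so the vertical direction `X₁` goes to `0 × ℝ` and `X₂` to `ℝ × 0`
(see `triv_frameVert`, `triv_frameHor`, `triv_hamField`). -/
def triv (Q : R3 × R3 → ℝ) (z : R3 × R3) : R3 × R3 →ₗ[ℝ] ℝ × ℝ :=
  (cotForm.flip (frameVert Q z)).prod (cotForm (frameHor Q z))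

/-- The inverse `ℝ² → ker λ` of the trivialization, `(b, a) ↦ b X₂ + a X₁`. -/
def trivInv (Q : R3 × R3 → ℝ) (z : R3 × R3) : ℝ × ℝ →ₗ[ℝ] R3 × R3 :=
  (LinearMap.fst ℝ ℝ ℝ).smulRight (frameHor Q z) + (LinearMap.snd ℝ ℝ ℝ).smulRight (frameVert Q z)

lemma inner_crossUnit_left (z : R3 × R3) : ⟪z.1, crossUnit z⟫ = 0 := by
  simp only [crossUnit, inner_smul_right, PiLp.inner_apply, Fin.sum_univ_three, RCLike.inner_apply,
    conj_trivial, cross_apply, Matrix.cons_val_zero, Matrix.cons_val_one, Matrix.cons_val]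
  ring

lemma inner_crossUnit_right (z : R3 × R3) : ⟪crossUnit z, z.2⟫ = 0 := by
  simp only [crossUnit, inner_smul_left, PiLp.inner_apply, Fin.sum_univ_three, RCLike.inner_apply,
    conj_trivial, cross_apply, Matrix.cons_val_zero, Matrix.cons_val_one, Matrix.cons_val]
  ring

lemma inner_crossUnit_self {z : R3 × R3} (hz : z ∈ cotSphere) (hη : z.2 ≠ 0) :
    ⟪crossUnit z, crossUnit z⟫ = 1 := by
  obtain ⟨h1, h2⟩ := hz
  have key : ‖(WithLp.toLp 2 (z.1.ofLp ⨯₃ z.2.ofLp) : R3)‖ ^ 2 = ‖z.2‖ ^ 2 := by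
    have e1 : z.1 0 ^ 2 + z.1 1 ^ 2 + z.1 2 ^ 2 = 1 := by
      have := EuclideanSpace.real_norm_sq_eq z.1
      rw [h1, Fin.sum_univ_three] at this
      linarith
    have e2 : z.1 0 * z.2 0 + z.1 1 * z.2 1 + z.1 2 * z.2 2 = 0 := by
      have := h2
      simp only [PiLp.inner_apply, Fin.sum_univ_three, RCLike.inner_apply, conj_trivial] at this
      linarith
    rw [EuclideanSpace.real_norm_sq_eq, EuclideanSpace.real_norm_sq_eq, Fin.sum_univ_three,
      Fin.sum_univ_three]
    simp only [cross_apply, Matrix.cons_val_zero, Matrix.cons_val_one, Matrix.cons_val]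
    linear_combination (z.2 0 ^ 2 + z.2 1 ^ 2 + z.2 2 ^ 2) * e1
      - (z.1 0 * z.2 0 + z.1 1 * z.2 1 + z.1 2 * z.2 2) * e2
  have hn : ‖z.2‖ ≠ 0 := norm_ne_zero_iff.2 hη
  have hpos : ‖(WithLp.toLp 2 (z.1.ofLp ⨯₃ z.2.ofLp) : R3)‖ ≠ 0 := by
    intro h
    rw [h] at key
    apply hn
    nlinarith
  rw [real_inner_self_eq_norm_sq, crossUnit, norm_smul, norm_inv, norm_norm, inv_mul_cancel₀ hpos]
  norm_num

/-- `X₁` and `X₂` are tangent to `T*S²`. -/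
lemma frame_mem_tangent (Q : R3 × R3 → ℝ) {z : R3 × R3} (hz : z ∈ cotSphere) :
    frameVert Q z ∈ cotSphereTangent z ∧ frameHor Q z ∈ cotSphereTangent z := by
  have h2 : ⟪z.1, z.2⟫ = 0 := hz.2
  refine ⟨⟨?_, ?_⟩, ⟨?_, ?_⟩⟩ <;>
    simp [frameVert, frameHor, inner_sub_right, inner_smul_right, inner_crossUnit_left,
      inner_crossUnit_right, h2]

/-- `X₁` and `X₂` are tangent to the level sets of `Q`. -/
lemma fderiv_frame {Q : R3 × R3 → ℝ} {z : R3 × R3} (hQ : DifferentiableAt ℝ Q z)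
    (hs : ⟪z.2, gradFibre Q z⟫ ≠ 0) :
    fderiv ℝ Q z (frameVert Q z) = 0 ∧ fderiv ℝ Q z (frameHor Q z) = 0 := by
  have hsplit : ∀ v : R3 × R3,
      fderiv ℝ Q z v = ⟪gradBase Q z, v.1⟫ + ⟪gradFibre Q z, v.2⟫ := by
    intro v
    rw [inner_gradBase hQ, inner_gradFibre hQ, ← map_add]
    simp
  rw [real_inner_comm] at hs
  constructor
  · rw [hsplit]
    simp only [frameVert, inner_sub_right, inner_smul_right, inner_zero_right, zero_add]
    rw [real_inner_comm (crossUnit z) (gradFibre Q z), real_inner_comm z.2 (gradFibre Q z)] at *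
    field_simp
    ring
  · rw [hsplit]
    simp only [frameHor, inner_smul_right]
    rw [real_inner_comm (crossUnit z) (gradBase Q z), real_inner_comm z.2 (gradFibre Q z)] at *
    field_simp
    ring

lemma cotForm_frame (Q : R3 × R3 → ℝ) {z : R3 × R3} (hz : z ∈ cotSphere) (hη : z.2 ≠ 0) :
    cotForm (frameHor Q z) (frameVert Q z) = 1 := by
  rw [cotForm_apply]
  simp only [frameVert, frameHor, inner_sub_right, inner_smul_right, inner_crossUnit_right,
    inner_crossUnit_self hz hη, inner_zero_right, mul_zero, sub_zero]

lemma triv_apply (Q : R3 × R3 → ℝ) (z v : R3 × R3) :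
    triv Q z v = (cotForm v (frameVert Q z), cotForm (frameHor Q z) v) := rfl

lemma triv_frameVert (Q : R3 × R3 → ℝ) {z : R3 × R3} (hz : z ∈ cotSphere) (hη : z.2 ≠ 0) :
    triv Q z (frameVert Q z) = (0, 1) := by
  rw [triv_apply, cotForm_self, cotForm_frame Q hz hη]

lemma triv_frameHor (Q : R3 × R3 → ℝ) {z : R3 × R3} (hz : z ∈ cotSphere) (hη : z.2 ≠ 0) :
    triv Q z (frameHor Q z) = (1, 0) := by
  rw [triv_apply, cotForm_self, cotForm_frame Q hz hη]

lemma triv_hamField {Q : R3 × R3 → ℝ} {z : R3 × R3} (hQ : DifferentiableAt ℝ Q z)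
    (hz : z ∈ cotSphere) (hs : ⟪z.2, gradFibre Q z⟫ ≠ 0) :
    triv Q z (hamField Q z) = (0, 0) := by
  obtain ⟨hv, hh⟩ := frame_mem_tangent Q hz
  obtain ⟨fv, fh⟩ := fderiv_frame hQ hs
  rw [triv_apply, cotForm_hamField hQ hv, fv, cotForm_swap, cotForm_hamField hQ hh, fh, neg_zero]

/-- The standard symplectic form `ω₀ = dx ∧ dy` on `ℝ²`. -/
def planeForm : LinearMap.BilinForm ℝ (ℝ × ℝ) :=
  LinearMap.mk₂ ℝ (fun u v => u.1 * v.2 - u.2 * v.1)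
    (fun _ _ _ => by simp only [Prod.fst_add, Prod.snd_add]; ring)
    (fun _ _ _ => by simp only [Prod.smul_fst, Prod.smul_snd, smul_eq_mul]; ring)
    (fun _ _ _ => by simp only [Prod.fst_add, Prod.snd_add]; ring)
    (fun _ _ _ => by simp only [Prod.smul_fst, Prod.smul_snd, smul_eq_mul]; ring)

/-- The Lagrangian `V = ℝ × 0` of `ℝ²`, the fixed locus of the reflection by which `T𝓡` acts. -/
def planeV : Submodule ℝ (ℝ × ℝ) := Submodule.prod ⊤ ⊥

/-- The transverse linearized flow `Ψ_x(t) = Φ(x(t)) ∘ A(t) ∘ Φ(x(0))⁻¹` along `x`, where `A(t)` is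
the linearized flow. -/
def transversePath (Q : R3 × R3 → ℝ) (x : ℝ → R3 × R3) (A : ℝ → (R3 × R3 →L[ℝ] R3 × R3))
    (t : ℝ) : ℝ × ℝ →ₗ[ℝ] ℝ × ℝ :=
  triv Q (x t) ∘ₗ (A t : R3 × R3 →ₗ[ℝ] R3 × R3) ∘ₗ trivInv Q (x 0)

/-- `m` is the index `μ_RS(Ψ_x(t) V, V)` of the chord `(x, T)`. -/
def IsChordIndex (μ c : ℝ) (P : Primary) (T : ℝ) (x : ℝ → R3 × R3) (m : ℝ) : Prop :=
  ∃ A, IsLinearizedFlow (hamField (regHamiltonian μ c P)) T x A ∧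
    LagrangianPath.IsRobbinSalamonIndex planeForm T
      (fun t => planeV.map (transversePath (regHamiltonian μ c P) x A t)) planeV m

/-- The Robbin-Salamon index `μ_RS(x, T)` of a chord. -/
def robbinSalamonIndex (μ c : ℝ) (P : Primary) (T : ℝ) (x : ℝ → R3 × R3) : ℝ :=
  Classical.epsilon (IsChordIndex μ c P T x)

end ThreeBody

end

/-! A Lagrangian subspace of the plane is a line, so the path Ψ_x(t)V has a continuous angle θ. Its
index is h(θ(T)) - h(θ(0)), where h = `halfIndex` takes the value k at kπ and k + 1/2 between kπ and
(k+1)π (`isRobbinSalamonIndex_iff`). In particular the index exists and is unique.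

The involution 𝓡 preserves Q and reverses X_Q. Hence a solution of the variational equation along
x_𝓡 becomes, after applying 𝓡 and reversing time, a solution along x. Since the trivialization turns
𝓡 into the reflection in V, the path of lines of x_𝓡 is the time-reversed mirror image of a path
ℝv(t), where v comes from the solution along x that ends in X₂; the path of x is ℝu(t), where u
comes from the solution that starts in X₂. Reversal and reflection each change the sign of the
index, so together they preserve it, and it remains to compare ℝu with ℝv. Being images of two fixed
vectors under the same isomorphisms, u and v are either always parallel or never. If always, the two
paths are equal. If never, the difference φ - θ of their angles stays strictly between kπ and
(k+1)π; since θ(0) and φ(T) are multiples of π, both indices come out as the same number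
(`halfIndex_sub_eq`).

The construction rests on η · n_η ≠ 0 along Σ (`inner_gradFibre_pos`). On Σ the fibrewise radial
derivative of Q is, away from collisions, a positive multiple of the derivative of H along the ray
from the primary. The squared velocity is 2(c - U) with U the effective potential, so by
Cauchy-Schwarz it suffices that ∂_r U > 0 and (∂_r U)² > 2(c - U) (`effForce_pos_and_sq_gt`). Now
(∂_r U)² + 2U decreases up to the circle through the saddle, because ∂_r²U ≤ -1 there
(`effForce_deriv_le`), and on that circle U exceeds c.

Given this transversality, `triv` vanishes on the tangent space of Σ only along X_Q
(`exists_smul_hamField`). The variational equation preserves tangency to Σ and has X_Q along x as a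
solution, so it acts injectively on the quotient by X_Q. -/

noncomputable section

/-! ## Paths of lines in the plane -/

namespace LagrangianPath
open ThreeBody

/-- The unit vector of angle `θ`. -/
def unitVec (θ : ℝ) : ℝ × ℝ := (Real.cos θ, Real.sin θ)

/-- The line of angle `θ`. -/
def line (θ : ℝ) : Submodule ℝ (ℝ × ℝ) := Submodule.span ℝ {unitVec θ}

lemma planeForm_apply (u v : ℝ × ℝ) : planeForm u v = u.1 * v.2 - u.2 * v.1 := rfl

lemma continuous_unitVec : Continuous unitVec := by unfold unitVec; fun_prop

lemma unitVec_ne_zero (θ : ℝ) : unitVec θ ≠ 0 := by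
  intro h
  have h1 : Real.cos θ = 0 := congrArg Prod.fst h
  have h2 : Real.sin θ = 0 := congrArg Prod.snd h
  have := Real.sin_sq_add_cos_sq θ
  rw [h1, h2] at this
  norm_num at this

lemma mem_span_of_planeForm_eq_zero {v w : ℝ × ℝ} (hv : v ≠ 0) (h : planeForm v w = 0) :
    w ∈ Submodule.span ℝ {v} := by
  rw [planeForm_apply] at h
  rw [Submodule.mem_span_singleton]
  have hv' : v.1 ^ 2 + v.2 ^ 2 ≠ 0 := by
    intro h0
    apply hv
    have h1 : v.1 = 0 := by nlinarith [sq_nonneg v.1, sq_nonneg v.2]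
    have h2 : v.2 = 0 := by nlinarith [sq_nonneg v.1, sq_nonneg v.2]
    exact Prod.ext h1 h2
  refine ⟨(v.1 * w.1 + v.2 * w.2) / (v.1 ^ 2 + v.2 ^ 2), ?_⟩
  ext
  · simp only [Prod.smul_fst, smul_eq_mul]
    field_simp
    linear_combination v.2 * h
  · simp only [Prod.smul_snd, smul_eq_mul]
    field_simp
    linear_combination (-v.1) * h

lemma mem_span_singleton_iff_planeForm {v w : ℝ × ℝ} (hv : v ≠ 0) :
    w ∈ Submodule.span ℝ {v} ↔ planeForm v w = 0 := by
  refine ⟨fun h => ?_, mem_span_of_planeForm_eq_zero hv⟩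
  obtain ⟨a, rfl⟩ := Submodule.mem_span_singleton.1 h
  simp only [planeForm_apply, Prod.smul_fst, Prod.smul_snd, smul_eq_mul]
  ring

lemma isLagrangian_span {v : ℝ × ℝ} (hv : v ≠ 0) :
    IsLagrangian planeForm (Submodule.span ℝ {v}) := by
  intro w
  rw [mem_span_singleton_iff_planeForm hv]
  constructor
  · intro h u hu
    obtain ⟨a, rfl⟩ := Submodule.mem_span_singleton.1 hu
    simp [h]
  · intro h
    exact h v (Submodule.mem_span_singleton_self v)

lemma isLagrangian_line (θ : ℝ) : IsLagrangian planeForm (line θ) :=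
  isLagrangian_span (unitVec_ne_zero θ)

/-- The zero subspace is excluded because its complement is the whole plane. Once L contains v ≠ 0,
every vector of L pairs to zero with v and is therefore parallel to it. -/
lemma IsLagrangian.exists_span {L : Submodule ℝ (ℝ × ℝ)} (hL : IsLagrangian planeForm L) :
    ∃ v, v ≠ 0 ∧ L = Submodule.span ℝ {v} := by
  have hne : ∃ v ∈ L, v ≠ 0 := by
    by_contra! h
    have h1 : ((1, 0) : ℝ × ℝ) ∈ L := (hL _).2 fun u hu => by simp [h u hu]
    simpa using h _ h1
  obtain ⟨v, hv, hv0⟩ := hne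
  refine ⟨v, hv0, le_antisymm (fun w hw => ?_) ?_⟩
  · exact mem_span_of_planeForm_eq_zero hv0 ((hL w).1 hw v hv)
  · simpa [Submodule.span_le] using hv

lemma line_eq_of_smul {v : ℝ × ℝ} {r θ : ℝ} (hr : r ≠ 0) (h : v = r • unitVec θ) :
    Submodule.span ℝ {v} = line θ := by
  rw [h, line, Submodule.span_singleton_smul_eq (IsUnit.mk0 r hr)]

/-- `planeForm` of the unit vectors of angles a and b is sin (b - a), and it vanishes exactly when
they are parallel. -/
lemma line_eq_line_iff {a b : ℝ} : line a = line b ↔ ∃ k : ℤ, k * Real.pi = b - a := by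
  rw [← Real.sin_eq_zero_iff]
  constructor
  · intro h
    have : unitVec b ∈ line a := h ▸ Submodule.mem_span_singleton_self _
    rw [line, mem_span_singleton_iff_planeForm (unitVec_ne_zero a), planeForm_apply] at this
    simp only [unitVec] at this
    rw [Real.sin_sub]
    linarith
  · intro h
    have hb : unitVec b = Real.cos (b - a) • unitVec a := by
      have e : b = (b - a) + a := by ring
      simp only [unitVec, Prod.smul_mk, smul_eq_mul]
      conv_lhs => rw [e]
      rw [Real.cos_add, Real.sin_add, h]
      simp
    have hc : Real.cos (b - a) ≠ 0 := by
      intro hc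
      rw [hc, zero_smul] at hb
      exact unitVec_ne_zero b hb
    exact (line_eq_of_smul hc hb).symm

lemma planeV_eq_line : planeV = line 0 := by
  have h0 : unitVec 0 = (1, 0) := by simp [unitVec]
  ext v
  rw [line, mem_span_singleton_iff_planeForm (unitVec_ne_zero 0), h0]
  simp [planeV, planeForm_apply, Submodule.mem_prod]

lemma line_eq_planeV_iff {a : ℝ} : line a = planeV ↔ Real.sin a = 0 := by
  rw [planeV_eq_line, line_eq_line_iff, zero_sub, ← Real.sin_eq_zero_iff, Real.sin_neg, neg_eq_zero]

lemma line_inf_planeV {a : ℝ} : line a ⊓ planeV = if Real.sin a = 0 then planeV else ⊥ := by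
  split_ifs with h
  · rw [line_eq_planeV_iff.2 h, inf_idem]
  · rw [eq_bot_iff]
    intro v hv
    obtain ⟨h1, h2⟩ := Submodule.mem_inf.1 hv
    obtain ⟨r, rfl⟩ := Submodule.mem_span_singleton.1 h1
    simp only [planeV, unitVec, Prod.smul_mk, smul_eq_mul, Submodule.mem_prod, Submodule.mem_bot,
      mul_eq_zero, h, or_false] at h2
    simp [h2.2]

/-- A nonvanishing planar map on a simply connected space has a continuous polar angle. -/
lemma exists_polar {A : Type*} [TopologicalSpace A] [SimplyConnectedSpace A]
    [LocallyPathConnectedSpace A] {f : A → ℝ × ℝ} (hf : Continuous f) (h0 : ∀ a, f a ≠ 0) :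
    ∃ θ : A → ℝ, Continuous θ ∧ ∀ a, ∃ r : ℝ, 0 < r ∧ f a = r • unitVec (θ a) := by
  have hne : ∀ a, Complex.equivRealProd.symm (f a) ≠ 0 := fun a h => h0 a (by
    simpa [Complex.ext_iff, Prod.ext_iff] using h)
  let g : C(A, {z : ℂ // z ≠ 0}) := ⟨fun a => ⟨Complex.equivRealProdCLM.symm (f a), hne a⟩, by
    fun_prop⟩
  obtain ⟨a₀⟩ : Nonempty A := inferInstance
  -- Lift through the covering exp : ℂ → ℂ \ {0}. The imaginary part of the lift is the angle, the
  -- exponential of its real part the radius.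
  obtain ⟨F, ⟨-, hF⟩, -⟩ := Complex.isCoveringMap_exp.existsUnique_continuousMap_lifts (A := A) g
    a₀ (Complex.log (g a₀)) (Subtype.ext (Complex.exp_log (g a₀).2))
  refine ⟨fun a => (F a).im, by fun_prop, fun a => ⟨Real.exp (F a).re, Real.exp_pos _, ?_⟩⟩
  have h1 : Complex.exp (F a) = Complex.equivRealProd.symm (f a) :=
    congrArg Subtype.val (congrFun hF a)
  have h2 : f a = ((Complex.exp (F a)).re, (Complex.exp (F a)).im) := by
    rw [h1]; simp
  rw [h2, Complex.exp_re, Complex.exp_im]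
  simp [unitVec]

/-- A nonvanishing planar path has a continuous polar angle. -/
lemma exists_polar_Icc {T : ℝ} (hT : 0 ≤ T) {f : ℝ → ℝ × ℝ} (hf : ContinuousOn f (Icc 0 T))
    (h0 : ∀ t ∈ Icc 0 T, f t ≠ 0) :
    ∃ θ : ℝ → ℝ, Continuous θ ∧ ∀ t ∈ Icc 0 T, ∃ r : ℝ, 0 < r ∧ f t = r • unitVec (θ t) := by
  -- Composing with `projIcc` extends the path constantly to ℝ, which is simply connected.
  obtain ⟨θ, hθ, h⟩ := exists_polar (f := fun t => f (projIcc 0 T hT t))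
    (hf.comp_continuous (by fun_prop) fun t => (projIcc 0 T hT t).2) fun t => h0 _ (projIcc 0 T hT t).2
  refine ⟨θ, hθ, fun t ht => ?_⟩
  have := h t
  rwa [projIcc_of_mem hT ht] at this

/-! ### Continuous angles of paths of lines and their behaviour under homotopy. -/

lemma exists_frame {X : Type*} [TopologicalSpace X] {S : Set X} {Λ : X → Submodule ℝ (ℝ × ℝ)}
    (hΛ : IsContinuousFamily S Λ) (hL : ∀ t ∈ S, IsLagrangian planeForm (Λ t)) :
    ∃ z : X → ℝ × ℝ, ContinuousOn z S ∧ ∀ t ∈ S, z t ≠ 0 ∧ Λ t = Submodule.span ℝ {z t} := by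
  obtain ⟨k, Z, hZ, h⟩ := hΛ
  rcases S.eq_empty_or_nonempty with rfl | ⟨t₀, ht₀⟩
  · exact ⟨0, by simp, by simp⟩
  have hk : k = 1 := by
    obtain ⟨v, hv, hv'⟩ := (hL t₀ ht₀).exists_span
    have := finrank_span_eq_card (h t₀ ht₀).1
    rwa [(h t₀ ht₀).2, hv', finrank_span_singleton hv, Fintype.card_fin, eq_comm] at this
  subst hk
  refine ⟨fun t => Z t 0, ?_, fun t ht => ⟨(h t ht).1.ne_zero 0, ?_⟩⟩
  · exact (continuous_apply 0).comp_continuousOn hZ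
  · rw [← (h t ht).2]
    congr 1
    ext v
    simp [Fin.exists_fin_one, eq_comm]

/-- `θ` is a continuous choice of angles for the path of lines `Λ` on `[0, T]`. -/
def IsAngle (T : ℝ) (Λ : ℝ → Submodule ℝ (ℝ × ℝ)) (θ : ℝ → ℝ) : Prop :=
  ContinuousOn θ (Icc 0 T) ∧ ∀ t ∈ Icc 0 T, Λ t = line (θ t)

lemma exists_isAngle {T : ℝ} (hT : 0 ≤ T) {Λ : ℝ → Submodule ℝ (ℝ × ℝ)}
    (hΛ : IsContinuousFamily (Icc 0 T) Λ) (hL : ∀ t ∈ Icc 0 T, IsLagrangian planeForm (Λ t)) :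
    ∃ θ, IsAngle T Λ θ := by
  obtain ⟨z, hz, h⟩ := exists_frame hΛ hL
  obtain ⟨θ, hθ, h'⟩ := exists_polar_Icc hT hz fun t ht => (h t ht).1
  refine ⟨θ, hθ.continuousOn, fun t ht => ?_⟩
  obtain ⟨r, hr, e⟩ := h' t ht
  rw [(h t ht).2, line_eq_of_smul hr.ne' e]

/-- A continuous function with values in `π ℤ` is constant on an interval. -/
lemma eq_of_mem_int_mul_pi {a b : ℝ} {f : ℝ → ℝ} (hf : ContinuousOn f (Icc a b))
    (h : ∀ t ∈ Icc a b, ∃ k : ℤ, k * Real.pi = f t) {s t : ℝ} (hs : s ∈ Icc a b)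
    (ht : t ∈ Icc a b) : f s = f t := by
  have h1 : ContinuousOn (fun t => f t / Real.pi) (Icc a b) := hf.div_const _
  have h2 : MapsTo (fun t => f t / Real.pi) (Icc a b) (range ((↑) : ℤ → ℝ)) := by
    intro t ht
    obtain ⟨k, hk⟩ := h t ht
    exact ⟨k, by simp only [← hk]; field_simp⟩
  have := isPreconnected_Icc.constant_of_mapsTo
    (Int.isClosedEmbedding_coe_real.isEmbedding.isDiscrete_range) h1 h2 hs ht
  have hpi := Real.pi_ne_zero
  field_simp at this
  exact this

/-- Two angles of one line differ by a multiple of π, and a continuous difference of this kind is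
constant. -/
lemma angle_sub_eq {T : ℝ} {Λ : ℝ → Submodule ℝ (ℝ × ℝ)} {θ φ : ℝ → ℝ}
    (hθ : IsAngle T Λ θ) (hφ : IsAngle T Λ φ) {s t : ℝ} (hs : s ∈ Icc 0 T) (ht : t ∈ Icc 0 T) :
    φ s - θ s = φ t - θ t := by
  refine eq_of_mem_int_mul_pi (f := fun t => φ t - θ t) (hφ.1.sub hθ.1) (fun t ht => ?_) hs ht
  rw [← line_eq_line_iff, ← hθ.2 t ht, hφ.2 t ht]

/-- The total variation of the angle of a path is invariant under homotopies with fixed ends. -/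
lemma angle_sub_eq_of_isHomotopic {T : ℝ} (hT : 0 ≤ T) {Λ Λ' : ℝ → Submodule ℝ (ℝ × ℝ)}
    (h : IsHomotopic planeForm T Λ Λ') {θ θ' : ℝ → ℝ} (hθ : IsAngle T Λ θ)
    (hθ' : IsAngle T Λ' θ') : θ' T - θ' 0 = θ T - θ 0 := by
  obtain ⟨H, hc, hL, h01, hend⟩ := h
  obtain ⟨z, hz, hzH⟩ := exists_frame hc hL
  have h01' : (0 : ℝ) ≤ 1 := zero_le_one
  -- `pr` retracts the plane onto the parameter rectangle, so that one polar angle Θ serves for the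
  -- whole homotopy.
  let pr : ℝ × ℝ → ℝ × ℝ := fun p => (projIcc 0 1 h01' p.1, projIcc 0 T hT p.2)
  have hpr : Continuous pr := by fun_prop
  have hmem : ∀ p, pr p ∈ Icc (0 : ℝ) 1 ×ˢ Icc 0 T := fun p =>
    ⟨(projIcc 0 1 h01' p.1).2, (projIcc 0 T hT p.2).2⟩
  have hid : ∀ p ∈ Icc (0 : ℝ) 1 ×ˢ Icc 0 T, pr p = p := by
    rintro ⟨s, t⟩ ⟨hs, ht⟩
    simp only [pr, projIcc_of_mem h01' hs, projIcc_of_mem hT ht]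
  obtain ⟨Θ, hΘ, hr⟩ := exists_polar (f := fun p => z (pr p)) (hz.comp_continuous hpr hmem)
    fun p => (hzH _ (hmem p)).1
  have hHΘ : ∀ s ∈ Icc (0 : ℝ) 1, ∀ t ∈ Icc 0 T, H (s, t) = line (Θ (s, t)) := by
    intro s hs t ht
    obtain ⟨r, hr0, e⟩ := hr (s, t)
    rw [hid (s, t) ⟨hs, ht⟩] at e
    rw [(hzH (s, t) ⟨hs, ht⟩).2, line_eq_of_smul hr0.ne' e]
  have i0 : (0 : ℝ) ∈ Icc (0 : ℝ) 1 := by simp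
  have i1 : (1 : ℝ) ∈ Icc (0 : ℝ) 1 := by simp
  have j0 : (0 : ℝ) ∈ Icc 0 T := by simp [hT]
  have j1 : T ∈ Icc 0 T := by simp [hT]
  have a0 : IsAngle T Λ fun t => Θ (0, t) :=
    ⟨by fun_prop, fun t ht => by rw [← (h01 t ht).1, hHΘ 0 i0 t ht]⟩
  have a1 : IsAngle T Λ' fun t => Θ (1, t) :=
    ⟨by fun_prop, fun t ht => by rw [← (h01 t ht).2, hHΘ 1 i1 t ht]⟩
  -- On the sides t = 0 and t = T the line does not move with s, so there Θ can be compared with a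
  -- constant angle and is itself constant.
  have e0 : IsAngle 1 (fun _ => Λ 0) fun s => Θ (s, 0) :=
    ⟨by fun_prop, fun s hs => by rw [← (hend s hs).1, hHΘ s hs 0 j0]⟩
  have e0' : IsAngle 1 (fun _ => Λ 0) fun _ => Θ (0, 0) :=
    ⟨by fun_prop, fun s hs => by rw [← (hend 0 i0).1, hHΘ 0 i0 0 j0]⟩
  have e1 : IsAngle 1 (fun _ => Λ T) fun s => Θ (s, T) :=
    ⟨by fun_prop, fun s hs => by rw [← (hend s hs).2, hHΘ s hs T j1]⟩
  have e1' : IsAngle 1 (fun _ => Λ T) fun _ => Θ (0, T) :=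
    ⟨by fun_prop, fun s hs => by rw [← (hend 0 i0).2, hHΘ 0 i0 T j1]⟩
  have q0 := angle_sub_eq hθ a0 j0 j1
  have q1 := angle_sub_eq hθ' a1 j0 j1
  have q2 := angle_sub_eq e0' e0 i0 i1
  have q3 := angle_sub_eq e1' e1 i0 i1
  linarith

/-- Linear interpolation of angles is a homotopy of paths of lines. -/
lemma isHomotopic_of_angle {T : ℝ} {Λ Λ' : ℝ → Submodule ℝ (ℝ × ℝ)}
    {θ θ' : ℝ → ℝ} (hθ : IsAngle T Λ θ) (hθ' : IsAngle T Λ' θ') (hT : 0 ≤ T) (h0 : θ' 0 = θ 0)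
    (h1 : θ' T = θ T) : IsHomotopic planeForm T Λ Λ' := by
  have j0 : (0 : ℝ) ∈ Icc 0 T := by simp [hT]
  have j1 : T ∈ Icc 0 T := by simp [hT]
  have hc : ∀ {φ : ℝ → ℝ}, ContinuousOn φ (Icc 0 T) →
      ContinuousOn (fun p : ℝ × ℝ => φ p.2) (Icc (0 : ℝ) 1 ×ˢ Icc 0 T) := fun h =>
    h.comp continuousOn_snd fun p hp => hp.2
  refine ⟨fun p => line ((1 - p.1) * θ p.2 + p.1 * θ' p.2), ⟨1, fun p _ =>
    unitVec ((1 - p.1) * θ p.2 + p.1 * θ' p.2), ?_, fun t _ => ⟨?_, ?_⟩⟩,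
    fun p _ => isLagrangian_line _, fun t ht => ⟨?_, ?_⟩, fun s _ => ⟨?_, ?_⟩⟩
  · refine continuousOn_pi.2 fun _ => continuous_unitVec.comp_continuousOn ?_
    exact ((continuousOn_const.sub continuousOn_fst).mul (hc hθ.1)).add
      (continuousOn_fst.mul (hc hθ'.1))
  · exact LinearIndependent.of_subsingleton 0 (unitVec_ne_zero _)
  · exact congrArg _ range_const
  · simp [hθ.2 t ht]
  · simp [hθ'.2 t ht]
  · simp only [hθ.2 0 j0, h0]; congr 1; ring
  · simp only [hθ.2 T j1, h1]; congr 1; ring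

/-- The number of multiples of `π` below the angle `θ`, where `θ` itself counts one half. -/
def halfIndex (θ : ℝ) : ℝ := ((⌊θ / Real.pi⌋ : ℝ) + ⌈θ / Real.pi⌉) / 2

lemma halfIndex_int_mul_pi (k : ℤ) : halfIndex (k * Real.pi) = k := by
  rw [halfIndex, mul_div_cancel_right₀ _ Real.pi_ne_zero, Int.floor_intCast, Int.ceil_intCast]
  ring

lemma halfIndex_of_mem_Ioo {θ : ℝ} {k : ℤ} (h : θ ∈ Ioo (k * Real.pi) ((k + 1) * Real.pi)) :
    halfIndex θ = k + 1 / 2 := by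
  have hpi := Real.pi_pos
  have h1 : (k : ℝ) < θ / Real.pi := (lt_div_iff₀ hpi).2 h.1
  have h2 : θ / Real.pi < k + 1 := (div_lt_iff₀ hpi).2 h.2
  have e1 : ⌊θ / Real.pi⌋ = k := Int.floor_eq_iff.2 ⟨h1.le, h2⟩
  have e2 : ⌈θ / Real.pi⌉ = k + 1 := Int.ceil_eq_iff.2 ⟨by push_cast; linarith, by push_cast; linarith⟩
  rw [halfIndex, e1, e2]
  push_cast
  ring

lemma halfIndex_neg (θ : ℝ) : halfIndex (-θ) = -halfIndex θ := by
  rw [halfIndex, halfIndex, neg_div, Int.floor_neg, Int.ceil_neg]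
  push_cast
  ring

lemma halfIndex_of_sub {θ φ : ℝ} {k : ℤ} (h : k * Real.pi = φ - θ) :
    halfIndex φ = halfIndex θ + k := by
  have : φ / Real.pi = θ / Real.pi + k := by
    have := Real.pi_ne_zero
    field_simp
    linarith
  rw [halfIndex, halfIndex, this, Int.floor_add_intCast, Int.ceil_add_intCast]
  push_cast
  ring

lemma exists_mem_Ioo_of_sin_ne_zero {θ : ℝ} (h : Real.sin θ ≠ 0) :
    ∃ k : ℤ, θ ∈ Ioo (k * Real.pi) ((k + 1) * Real.pi) := by
  have hpi := Real.pi_pos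
  refine ⟨⌊θ / Real.pi⌋, lt_of_le_of_ne ((le_div_iff₀ hpi).1 (Int.floor_le _)) ?_,
    (div_lt_iff₀ hpi).1 (Int.lt_floor_add_one _)⟩
  intro h'
  exact h (Real.sin_eq_zero_iff.2 ⟨_, h'⟩)

lemma halfIndex_eventuallyEq {θ : ℝ} (h : Real.sin θ ≠ 0) :
    ∀ᶠ φ in 𝓝 θ, halfIndex φ = halfIndex θ := by
  obtain ⟨k, hk⟩ := exists_mem_Ioo_of_sin_ne_zero h
  filter_upwards [Ioo_mem_nhds hk.1 hk.2] with φ hφ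
  rw [halfIndex_of_mem_Ioo hk, halfIndex_of_mem_Ioo hφ]

/-- The jump of `halfIndex` at a multiple of `π`. -/
lemma halfIndex_eventuallyEq_of_sin_eq_zero {θ : ℝ} (h : Real.sin θ = 0) :
    ∀ᶠ φ in 𝓝 θ, halfIndex φ = halfIndex θ + Real.sign (Real.tan φ) / 2 := by
  obtain ⟨k, rfl⟩ := Real.sin_eq_zero_iff.1 h
  have hpi := Real.pi_pos
  rw [halfIndex_int_mul_pi]
  -- Within π/2 of kπ the sign of the tangent tells on which side of kπ the angle lies.
  filter_upwards [Ioo_mem_nhds (show k * Real.pi - Real.pi / 2 < k * Real.pi by linarith)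
    (show k * Real.pi < k * Real.pi + Real.pi / 2 by linarith)] with φ hφ
  have ht : Real.tan φ = Real.tan (φ - k * Real.pi) := (Real.tan_sub_int_mul_pi φ k).symm
  rcases lt_trichotomy φ (k * Real.pi) with hlt | rfl | hlt
  · have : Real.tan φ < 0 := by
      rw [ht]; exact Real.tan_neg_of_neg_of_pi_div_two_lt (by linarith) (by linarith [hφ.1])
    rw [Real.sign_of_neg this, halfIndex_of_mem_Ioo (k := k - 1)
      ⟨by push_cast; linarith [hφ.1], by push_cast; linarith⟩]
    push_cast
    ring
  · rw [ht, sub_self, Real.tan_zero, Real.sign_zero, halfIndex_int_mul_pi]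
    ring
  · have : 0 < Real.tan φ := by
      rw [ht]; exact Real.tan_pos_of_pos_of_lt_pi_div_two (by linarith) (by linarith [hφ.2])
    rw [Real.sign_of_pos this, halfIndex_of_mem_Ioo (k := k)
      ⟨by linarith, by linarith [hφ.2]⟩]

/-! ### Signatures on `planeV` and crossing forms in terms of the angle. -/

lemma mem_planeV {v : ℝ × ℝ} : v ∈ planeV ↔ v.2 = 0 := by
  simp [planeV, Submodule.mem_prod]

lemma positiveIndex_bot (q : ℝ × ℝ → ℝ) : positiveIndex (⊥ : Submodule ℝ (ℝ × ℝ)) q = 0 := by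
  refine IsGreatest.csSup_eq ⟨⟨⊥, le_rfl, by simp, fun v hv h => absurd hv (by simpa using h)⟩, ?_⟩
  rintro k ⟨P, hP, rfl, -⟩
  rw [le_bot_iff.1 hP]
  simp

lemma finrank_planeV : Module.finrank ℝ planeV = 1 := by
  rw [planeV_eq_line, line, finrank_span_singleton (unitVec_ne_zero 0)]

lemma positiveIndex_planeV {q : ℝ × ℝ → ℝ} {D : ℝ} (hq : ∀ a, q (a, 0) = a ^ 2 * D) :
    positiveIndex planeV q = if 0 < D then 1 else 0 := by
  split_ifs with h
  · refine IsGreatest.csSup_eq ⟨⟨planeV, le_rfl, finrank_planeV, fun v hv hv0 => ?_⟩, ?_⟩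
    · obtain ⟨a, b⟩ := v
      obtain rfl : b = 0 := mem_planeV.1 hv
      have : a ≠ 0 := fun h => hv0 (by rw [h]; rfl)
      rw [hq]
      positivity
    · rintro k ⟨P, hP, rfl, -⟩
      rw [← finrank_planeV]
      exact Submodule.finrank_mono hP
  · refine IsGreatest.csSup_eq ⟨⟨⊥, bot_le, by simp, fun v hv h => absurd hv (by simpa using h)⟩, ?_⟩
    rintro k ⟨P, hP, rfl, hpos⟩
    have : P = ⊥ := by
      rw [eq_bot_iff]
      intro v hv
      by_contra hv0
      have h1 := hpos v hv (by simpa using hv0)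
      obtain ⟨a, b⟩ := v
      obtain rfl : b = 0 := mem_planeV.1 (hP hv)
      rw [hq] at h1
      nlinarith [sq_nonneg a]
    simp [this]

lemma signature_bot (q : ℝ × ℝ → ℝ) : signature (⊥ : Submodule ℝ (ℝ × ℝ)) q = 0 := by
  simp [signature, positiveIndex_bot]

lemma signature_planeV {q : ℝ × ℝ → ℝ} {D : ℝ} (hq : ∀ a, q (a, 0) = a ^ 2 * D) :
    (signature planeV q : ℝ) = Real.sign D := by
  rw [signature, positiveIndex_planeV hq,
    positiveIndex_planeV (q := fun v => -q v) (D := -D) fun a => by rw [hq]; ring]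
  rcases lt_trichotomy D 0 with h | rfl | h
  · simp [Real.sign_of_neg h, h, h.le]
  · simp
  · simp [Real.sign_of_pos h, h, h.le]

/-- This is where T > 0 matters: one-sided derivatives at the end points are unique, so a crossing
form is determined by the path. -/
lemma uniqueDiffWithinAt_shift {T t : ℝ} (hT : 0 < T) (ht : t ∈ Icc 0 T) :
    UniqueDiffWithinAt ℝ {ε | t + ε ∈ Icc 0 T} 0 := by
  have : {ε | t + ε ∈ Icc 0 T} = Icc (-t) (T - t) := by
    ext ε
    simp only [mem_ofPred_eq, mem_Icc]
    constructor <;> rintro ⟨h1, h2⟩ <;> constructor <;> linarith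
  rw [this]
  exact uniqueDiffOn_Icc (by linarith) 0 ⟨by linarith [ht.1], by linarith [ht.2]⟩

lemma tendsto_shift {T t : ℝ} :
    Tendsto (fun ε => t + ε) (𝓝[{ε | t + ε ∈ Icc 0 T}] 0) (𝓝[Icc 0 T] t) := by
  refine tendsto_nhdsWithin_iff.2 ⟨?_, eventually_mem_nhdsWithin⟩
  have : Tendsto (fun ε : ℝ => t + ε) (𝓝 0) (𝓝 (t + 0)) := by
    exact (continuous_const.add continuous_id).tendsto 0
  rw [add_zero] at this
  exact this.mono_left nhdsWithin_le_nhds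

/-- The quotient g(ε)/ε tends to D ≠ 0 and eventually has its sign; at ε = 0 both sides are zero. -/
lemma sign_eventuallyEq_of_hasDerivWithinAt {g : ℝ → ℝ} {D : ℝ} {S : Set ℝ}
    (hg : HasDerivWithinAt g D S 0) (h0 : g 0 = 0) (hD : D ≠ 0) :
    ∀ᶠ ε in 𝓝[S] 0, Real.sign (g ε) = Real.sign D * Real.sign ε := by
  rw [hasDerivWithinAt_iff_tendsto_slope] at hg
  have hD' : 0 < D * D := mul_self_pos.2 hD
  have h1 : ∀ᶠ ε in 𝓝[S \ {0}] 0, 0 < slope g 0 ε * D :=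
    (hg.mul_const D).eventually (lt_mem_nhds hD')
  rw [eventually_nhdsWithin_iff] at h1 ⊢
  filter_upwards [h1] with ε hε hεS
  rcases eq_or_ne ε 0 with rfl | hne
  · simp [h0]
  have h2 := hε ⟨hεS, hne⟩
  rw [slope_def_field, h0, sub_zero, sub_zero] at h2
  rcases lt_or_gt_of_ne hD with hD | hD <;> rcases lt_or_gt_of_ne hne with hne | hne
  · have : 0 < g ε := by
      by_contra! hc
      have := div_nonneg_of_nonpos hc hne.le
      nlinarith
    rw [Real.sign_of_pos this, Real.sign_of_neg hD, Real.sign_of_neg hne]; norm_num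
  · have : g ε < 0 := by
      by_contra! hc
      have := div_nonneg hc hne.le
      nlinarith
    rw [Real.sign_of_neg this, Real.sign_of_neg hD, Real.sign_of_pos hne]; norm_num
  · have : g ε < 0 := by
      by_contra! hc
      have := div_nonpos_of_nonneg_of_nonpos hc hne.le
      nlinarith
    rw [Real.sign_of_neg this, Real.sign_of_pos hD, Real.sign_of_neg hne]; norm_num
  · have : 0 < g ε := by
      by_contra! hc
      have := div_nonpos_of_nonpos_of_nonneg hc hne.le
      nlinarith
    rw [Real.sign_of_pos this, Real.sign_of_pos hD, Real.sign_of_pos hne]; norm_num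

/-- At a regular crossing the angle moves in the direction of the sign of the crossing form. -/
lemma IsCrossingForm.sign_tan {T t : ℝ} (hT : 0 < T) (ht : t ∈ Icc 0 T)
    {Λ : ℝ → Submodule ℝ (ℝ × ℝ)} {θ : ℝ → ℝ} (hθ : IsAngle T Λ θ) (h0 : Real.sin (θ t) = 0)
    {q : ℝ × ℝ → ℝ} (hq : IsCrossingForm planeForm T Λ planeV t q)
    (hn : IsNondegenerateOn (Λ t ⊓ planeV) q) :
    ∀ᶠ ε in 𝓝[{ε | t + ε ∈ Icc 0 T}] 0,
      Real.sign (Real.tan (θ (t + ε))) = signature (Λ t ⊓ planeV) q * Real.sign ε := by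
  obtain ⟨W, hW, hc, hw⟩ := hq
  have hΛ : Λ t = planeV := by rw [hθ.2 t ht, line_eq_planeV_iff.2 h0]
  rw [hΛ, inf_idem] at hn hw ⊢
  rw [hΛ] at hc
  obtain ⟨⟨x, y⟩, hxy, rfl⟩ := hW.exists_span
  have hy : y ≠ 0 := by
    rintro rfl
    apply hxy
    exact (Submodule.disjoint_def.1 hc.disjoint) _ (mem_planeV.2 rfl)
      (Submodule.mem_span_singleton_self _)
  have hcont : Tendsto (fun ε => θ (t + ε)) (𝓝[{ε | t + ε ∈ Icc 0 T}] 0) (𝓝 (θ t)) :=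
    (hθ.1 t ht).tendsto.comp tendsto_shift
  have hcos : Real.cos (θ t) ≠ 0 := by
    intro h
    have := Real.sin_sq_add_cos_sq (θ t)
    rw [h, h0] at this
    norm_num at this
  have htan0 : Real.tan (θ t) = 0 := by rw [Real.tan_eq_sin_div_cos, h0, zero_div]
  have htan : Tendsto (fun ε => Real.tan (θ (t + ε))) (𝓝[{ε | t + ε ∈ Icc 0 T}] 0) (𝓝 0) := by
    have := (Real.continuousAt_tan.2 hcos).tendsto.comp hcont
    rwa [htan0] at this
  have hden : ∀ᶠ ε in 𝓝[{ε | t + ε ∈ Icc 0 T}] 0, 0 < 1 - x / y * Real.tan (θ (t + ε)) := by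
    have : Tendsto (fun ε => 1 - x / y * Real.tan (θ (t + ε))) (𝓝[{ε | t + ε ∈ Icc 0 T}] 0)
        (𝓝 (1 - x / y * 0)) := tendsto_const_nhds.sub (htan.const_mul _)
    exact this.eventually (lt_mem_nhds (by norm_num))
  have hcos' : ∀ᶠ ε in 𝓝[{ε | t + ε ∈ Icc 0 T}] 0, Real.cos (θ (t + ε)) ≠ 0 :=
    (Real.continuous_cos.continuousAt.tendsto.comp hcont).eventually_ne hcos
  -- With W spanned by (x, y), the condition (a, 0) + κ(x, y) ∈ line θ gives κ y = a tan θ / (1 -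
  -- (x/y) tan θ). Hence ω(v, w) = a² g(ε), and g has the sign of tan θ near the crossing.
  set g : ℝ → ℝ := fun ε => Real.tan (θ (t + ε)) / (1 - x / y * Real.tan (θ (t + ε))) with hg
  have hself : (0 : ℝ) ∈ {ε | t + ε ∈ Icc 0 T} := by simpa using ht
  have hder : ∀ a : ℝ, HasDerivWithinAt (fun ε => a ^ 2 * g ε) (q (a, 0))
      {ε | t + ε ∈ Icc 0 T} 0 := by
    intro a
    obtain ⟨w, hw1, hw2⟩ := hw (a, 0) (mem_planeV.2 rfl)
    have key : ∀ᶠ ε in 𝓝[{ε | t + ε ∈ Icc 0 T}] 0, a ^ 2 * g ε = planeForm (a, 0) (w ε) := by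
      filter_upwards [hw1, hden, hcos', eventually_mem_nhdsWithin] with ε ⟨hε1, hε2⟩ hε3 hε4 hε5
      obtain ⟨κ, hκ⟩ := Submodule.mem_span_singleton.1 hε1
      rw [hθ.2 _ hε5, line, mem_span_singleton_iff_planeForm (unitVec_ne_zero _), ← hκ,
        planeForm_apply] at hε2
      rw [← hκ, planeForm_apply]
      simp only [unitVec, Prod.smul_mk, smul_eq_mul, Prod.mk_add_mk, zero_add, zero_mul, sub_zero,
        hg] at hε2 ⊢
      rw [Real.tan_eq_sin_div_cos] at hε3 ⊢
      rw [mul_div_assoc', div_eq_iff hε3.ne']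
      field_simp
      linear_combination (-a) * hε2
    exact hw2.congr_of_eventuallyEq key (key.self_of_nhdsWithin hself)
  have hD : HasDerivWithinAt g (q (1, 0)) {ε | t + ε ∈ Icc 0 T} 0 := by
    simpa using hder 1
  -- A crossing form is given only as a function; that it is quadratic on V follows from uniqueness
  -- of the derivative.
  have hquad : ∀ a : ℝ, q (a, 0) = a ^ 2 * q (1, 0) := fun a =>
    (uniqueDiffWithinAt_shift hT ht).eq_deriv _ (hder a) (hD.const_mul (a ^ 2))
  have hD0 : q (1, 0) ≠ 0 := by
    intro h
    have := hn (1, 0) (mem_planeV.2 rfl) (by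
      rintro ⟨a, b⟩ hv
      obtain rfl : b = 0 := mem_planeV.1 hv
      simp only [Prod.mk_add_mk, add_zero, hquad (1 + a), hquad a, h]
      ring)
    simp at this
  have hg0 : g 0 = 0 := by simp [hg, htan0]
  rw [signature_planeV hquad]
  filter_upwards [sign_eventuallyEq_of_hasDerivWithinAt hD hg0 hD0, hden] with ε hε1 hε2
  rw [← hε1, hg]
  rcases lt_trichotomy (Real.tan (θ (t + ε))) 0 with h | h | h
  · rw [Real.sign_of_neg h, Real.sign_of_neg (div_neg_of_neg_of_pos h hε2)]
  · simp [h]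
  · rw [Real.sign_of_pos h, Real.sign_of_pos (div_pos h hε2)]

/-- A locally constant function on an interval has derivative zero within it, end points included.
-/
lemma eq_of_eventuallyEq_const {T : ℝ} (hT : 0 < T) {f : ℝ → ℝ}
    (h : ∀ t ∈ Icc 0 T, ∀ᶠ s in 𝓝[Icc 0 T] t, f s = f t) : f T = f 0 := by
  have hd : ∀ t ∈ Icc 0 T, HasDerivWithinAt f 0 (Icc 0 T) t := fun t ht =>
    (hasDerivWithinAt_const t (Icc 0 T) (f t)).congr_of_eventuallyEq (h t ht) rfl
  refine (convex_Icc 0 T).is_const_of_fderivWithin_eq_zero (𝕜 := ℝ)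
    (fun t ht => (hd t ht).differentiableWithinAt) (fun t ht => ?_) (right_mem_Icc.2 hT.le)
    (left_mem_Icc.2 hT.le)
  rw [(hd t ht).hasFDerivWithinAt.fderivWithin (uniqueDiffOn_Icc hT t ht)]
  ext
  simp

/-- The index of a regular path of lines in terms of its angle. -/
lemma IsRegularIndex.eq_halfIndex {T m : ℝ} (hT : 0 < T) {Λ : ℝ → Submodule ℝ (ℝ × ℝ)}
    {θ : ℝ → ℝ} (hθ : IsAngle T Λ θ) (h : IsRegularIndex planeForm T Λ planeV m) :
    m = halfIndex (θ T) - halfIndex (θ 0) := by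
  obtain ⟨-, -, hfin, q, hq, hm⟩ := h
  set s : ℝ → ℝ := fun t => (signature (Λ t ⊓ planeV) (q t) : ℝ) with hs
  set C := hfin.toFinset with hC
  have hcross : ∀ t ∈ Icc 0 T, (t ∉ C ↔ Real.sin (θ t) ≠ 0) := by
    intro t ht
    rw [hC, Finite.mem_toFinset, mem_ofPred_eq, hθ.2 t ht, line_inf_planeV]
    split_ifs with h
    · simp only [ht, true_and, h]
      have : planeV ≠ ⊥ := by
        rw [planeV_eq_line, line, Ne, Submodule.span_singleton_eq_bot]
        exact unitVec_ne_zero 0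
      simp [this]
    · simp [h]
  have hs0 : ∀ t ∈ Icc 0 T, t ∉ C → s t = 0 := by
    intro t ht h
    have h1 := (hcross t ht).1 h
    simp only [hs, hθ.2 t ht, line_inf_planeV, if_neg h1, signature_bot, Int.cast_zero]
  have hCsub : ∀ t ∈ C, t ∈ Icc 0 T := fun t ht => ((Finite.mem_toFinset _).1 ht).1
  -- At a crossing t, both `halfIndex ∘ θ` and s t * sign(τ - t) / 2 move by s t / 2 on reaching t
  -- and by s t / 2 on leaving it. Their difference is therefore locally constant.
  have hconst := eq_of_eventuallyEq_const hT
    (f := fun τ => halfIndex (θ τ) - (∑ t ∈ C, s t * Real.sign (τ - t)) / 2) (by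
    intro τ hτ
    have hθτ : Tendsto θ (𝓝[Icc 0 T] τ) (𝓝 (θ τ)) := hθ.1 τ hτ
    have hne : ∀ᶠ σ in 𝓝[Icc 0 T] τ, ∀ t ∈ C.erase τ, Real.sign (σ - t) = Real.sign (τ - t) := by
      refine (eventually_all_finset _).2 fun t ht => nhdsWithin_le_nhds ?_
      rcases lt_or_gt_of_ne (Finset.ne_of_mem_erase ht) with h | h
      · filter_upwards [lt_mem_nhds h] with σ hσ
        rw [Real.sign_of_pos (sub_pos.2 h), Real.sign_of_pos (sub_pos.2 hσ)]
      · filter_upwards [gt_mem_nhds h] with σ hσ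
        rw [Real.sign_of_neg (sub_neg.2 h), Real.sign_of_neg (sub_neg.2 hσ)]
    by_cases hτC : τ ∈ C
    · have h0 : Real.sin (θ τ) = 0 := by
        by_contra h0
        exact (hcross τ hτ).2 h0 hτC
      have h1 := (hq τ hτ).1.sign_tan hT hτ hθ h0 (hq τ hτ).2
      have h2 : ∀ᶠ σ in 𝓝[Icc 0 T] τ,
          Real.sign (Real.tan (θ σ)) = s τ * Real.sign (σ - τ) := by
        have ht : Tendsto (fun σ => σ - τ) (𝓝[Icc 0 T] τ) (𝓝[{ε | τ + ε ∈ Icc 0 T}] 0) := by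
          refine tendsto_nhdsWithin_iff.2 ⟨?_, ?_⟩
          · have : Tendsto (fun σ : ℝ => σ - τ) (𝓝 τ) (𝓝 (τ - τ)) :=
              (continuous_id.sub continuous_const).tendsto τ
            rw [sub_self] at this
            exact this.mono_left nhdsWithin_le_nhds
          · filter_upwards [eventually_mem_nhdsWithin] with σ hσ
            simpa using hσ
        filter_upwards [ht.eventually h1] with σ hσ
        simpa using hσ
      filter_upwards [hne, h2, hθτ.eventually (halfIndex_eventuallyEq_of_sin_eq_zero h0)]
        with σ h3 h4 h5
      rw [← Finset.add_sum_erase C _ hτC, ← Finset.add_sum_erase C _ hτC, h5, h4, sub_self,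
        Real.sign_zero, Finset.sum_congr rfl fun t ht => by rw [h3 t ht]]
      ring
    · rw [Finset.erase_eq_of_notMem hτC] at hne
      filter_upwards [hne, hθτ.eventually (halfIndex_eventuallyEq ((hcross τ hτ).1 hτC))]
        with σ h3 h4
      rw [h4, Finset.sum_congr rfl fun t ht => by rw [h3 t ht]])
  have hsum : ∑ᶠ t ∈ Ioo 0 T, s t = ∑ t ∈ C, if t ∈ Ioo 0 T then s t else 0 := by
    rw [← Finset.sum_filter]
    refine finsum_mem_eq_sum_of_inter_support_eq _ ?_
    ext t
    simp only [mem_inter_iff, Function.mem_support, Finset.coe_filter, mem_ofPred_eq]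
    constructor
    · rintro ⟨h1, h2⟩
      exact ⟨⟨by_contra fun h => h2 (hs0 t (Ioo_subset_Icc_self h1) h), h1⟩, h2⟩
    · rintro ⟨⟨-, h1⟩, h2⟩
      exact ⟨h1, h2⟩
  have hend : ∀ a ∈ Icc 0 T, s a = ∑ t ∈ C, if t = a then s t else 0 := by
    intro a ha
    rw [Finset.sum_ite_eq']
    split_ifs with h
    · rfl
    · exact hs0 a ha h
  have hm' : m = 1 / 2 * s 0 + (∑ᶠ t ∈ Ioo 0 T, s t) + 1 / 2 * s T := hm
  -- For t in [0, T] the quantity (sign(T - t) - sign(0 - t)) / 2 equals 1 at interior points and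
  -- 1/2 at the two ends, which are the weights in the index.
  have hfinal : m = (∑ t ∈ C, s t * Real.sign (T - t)) / 2
      - (∑ t ∈ C, s t * Real.sign (0 - t)) / 2 := by
    rw [hm', hsum, hend 0 (left_mem_Icc.2 hT.le), hend T (right_mem_Icc.2 hT.le), Finset.mul_sum,
      Finset.mul_sum, ← Finset.sum_add_distrib, ← Finset.sum_add_distrib, Finset.sum_div,
      Finset.sum_div, ← Finset.sum_sub_distrib]
    refine Finset.sum_congr rfl fun t ht => ?_
    obtain ⟨h1, h2⟩ := hCsub t ht
    rcases h1.eq_or_lt with rfl | h1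
    · have : (0 : ℝ) ≠ T := hT.ne
      simp [this, Real.sign_of_pos hT]
      ring
    · rcases h2.eq_or_lt with rfl | h2
      · simp [hT.ne', Real.sign_of_neg (neg_lt_zero.2 hT)]
        ring
      · rw [if_neg h1.ne', if_pos ⟨h1, h2⟩, if_neg h2.ne, Real.sign_of_pos (sub_pos.2 h2),
          Real.sign_of_neg (by linarith : 0 - t < 0)]
        ring
  linarith

/-! ### Existence of regular paths with prescribed end angles. -/

lemma isCompl_line {a b : ℝ} (h : Real.sin (b - a) ≠ 0) : IsCompl (line a) (line b) := by
  rw [Real.sin_sub] at h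
  refine ⟨Submodule.disjoint_def.2 fun v h1 h2 => ?_, codisjoint_iff.2 (eq_top_iff.2 fun v _ => ?_)⟩
  · obtain ⟨r, rfl⟩ := Submodule.mem_span_singleton.1 h1
    rw [line, mem_span_singleton_iff_planeForm (unitVec_ne_zero b), planeForm_apply] at h2
    simp only [unitVec, Prod.smul_mk, smul_eq_mul] at h2
    have : r = 0 := by
      refine (mul_eq_zero.1 (?_ : r * (Real.sin b * Real.cos a - Real.cos b * Real.sin a) = 0)).resolve_right h
      linear_combination -h2
    rw [this, zero_smul]
  -- The coefficients are those of Cramer's rule with determinant sin (b - a).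
  · refine Submodule.mem_sup.2
      ⟨((v.1 * Real.sin b - v.2 * Real.cos b) / (Real.sin b * Real.cos a - Real.cos b * Real.sin a))
        • unitVec a, Submodule.smul_mem _ _ (Submodule.mem_span_singleton_self _),
      ((v.2 * Real.cos a - v.1 * Real.sin a) / (Real.sin b * Real.cos a - Real.cos b * Real.sin a))
        • unitVec b, Submodule.smul_mem _ _ (Submodule.mem_span_singleton_self _), ?_⟩
    ext <;> simp only [unitVec, Prod.smul_mk, smul_eq_mul, Prod.mk_add_mk] <;> field_simp <;> ring

lemma mem_line {θ : ℝ} {v : ℝ × ℝ} :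
    v ∈ line θ ↔ Real.cos θ * v.2 - Real.sin θ * v.1 = 0 :=
  mem_span_singleton_iff_planeForm (unitVec_ne_zero θ)

/-- A smooth path of lines whose angle moves with nonzero speed at the crossings is regular. -/
lemma exists_isRegularIndex {T : ℝ} {φ φ' : ℝ → ℝ} (hφ : ∀ t, HasDerivAt φ (φ' t) t)
    (hC : ContDiff ℝ 1 φ) (hcr : ∀ t ∈ Icc 0 T, Real.sin (φ t) = 0 → φ' t ≠ 0)
    (hfin : {t ∈ Icc 0 T | Real.sin (φ t) = 0}.Finite) :
    ∃ m, IsRegularIndex planeForm T (fun t => line (φ t)) planeV m := by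
  refine ⟨_, ⟨1, fun t _ => unitVec (φ t), ?_, fun t _ => ⟨?_, ?_⟩⟩, fun t _ => isLagrangian_line _,
    hfin.subset ?_, fun t v => v.1 ^ 2 * φ' t, fun t ht => ⟨⟨line (φ t + Real.pi / 2),
      isLagrangian_line _, isCompl_line (by simp), ?_⟩, ?_⟩, rfl⟩
  · refine (contDiff_pi.2 fun _ => ?_).contDiffOn
    exact (Real.contDiff_cos.comp hC).prodMk (Real.contDiff_sin.comp hC)
  · exact LinearIndependent.of_subsingleton 0 (unitVec_ne_zero _)
  · exact congrArg _ range_const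
  · rintro t ⟨h1, h2⟩
    refine ⟨h1, by_contra fun h => h2 ?_⟩
    rw [line_inf_planeV, if_neg h]
  · intro v hv
    rw [line_inf_planeV] at hv
    split_ifs at hv with h0
    · obtain ⟨a, b⟩ := v
      obtain rfl : b = 0 := mem_planeV.1 hv
      have hcos : Real.cos (φ t) ≠ 0 := by
        intro h
        have := Real.sin_sq_add_cos_sq (φ t)
        rw [h, h0] at this
        norm_num at this
      have hcos2 : Real.cos (φ t) ^ 2 = 1 := by
        have := Real.sin_sq_add_cos_sq (φ t)
        rw [h0] at this
        linarith
      -- At a crossing the complement of angle φ t + π/2 is the vertical axis, so w is read off from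
      -- the slope tan φ. Its derivative is φ' since cos² = 1 there.
      refine ⟨fun ε => (0, a * Real.tan (φ (t + ε))), ?_, ?_⟩
      · have hc : Tendsto (fun ε => Real.cos (φ (t + ε))) (𝓝 0) (𝓝 (Real.cos (φ (t + 0)))) :=
          (Real.continuous_cos.comp (hC.continuous.comp (continuous_const.add continuous_id))).tendsto 0
        rw [add_zero] at hc
        filter_upwards [nhdsWithin_le_nhds (hc.eventually_ne hcos)] with ε hε
        refine ⟨mem_line.2 ?_, mem_line.2 ?_⟩
        · rw [Real.cos_add_pi_div_two, h0]
          ring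
        · simp only [Prod.mk_add_mk, add_zero, zero_add, Real.tan_eq_sin_div_cos]
          field_simp
          ring
      · have h1 : HasDerivAt (fun ε => φ (t + ε)) (φ' t) 0 := by
          have := hφ (t + 0)
          have := this.comp_const_add t 0
          rwa [add_zero] at this
        have h2 : HasDerivAt (fun ε => Real.tan (φ (t + ε)))
            (1 / Real.cos (φ (t + 0)) ^ 2 * φ' t) 0 :=
          HasDerivAt.comp (h₂ := Real.tan) 0 (Real.hasDerivAt_tan (by rwa [add_zero])) h1
        rw [add_zero, hcos2] at h2
        have h3 := (h2.const_mul (a * a)).hasDerivWithinAt (s := {ε | t + ε ∈ Icc 0 T})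
        have e1 : (fun ε => planeForm (a, 0) (0, a * Real.tan (φ (t + ε)))) =
            fun ε => a * a * Real.tan (φ (t + ε)) := by
          ext ε
          rw [planeForm_apply]
          ring
        have e2 : a ^ 2 * φ' t = a * a * (1 / 1 * φ' t) := by ring
        simp only [e1, e2]
        exact h3
    · obtain rfl : v = 0 := by simpa using hv
      refine ⟨fun _ => 0, by simp, ?_⟩
      simpa using hasDerivWithinAt_const (0 : ℝ) _ (0 : ℝ)
  · intro u hu h
    rw [line_inf_planeV] at hu h
    split_ifs at hu h with h0
    · obtain ⟨a, b⟩ := u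
      obtain rfl : b = 0 := mem_planeV.1 hu
      have h1 := h (a, 0) hu
      simp only [Prod.mk_add_mk] at h1
      have h2 : a ^ 2 * φ' t = 0 := by linear_combination h1 / 2
      have h3 := (mul_eq_zero.1 h2).resolve_right (hcr t ht h0)
      rw [pow_eq_zero_iff two_ne_zero] at h3
      rw [h3]
      rfl
    · simpa using hu

lemma finite_int_mul_pi_mem_Icc (a b : ℝ) : {x ∈ Icc a b | Real.sin x = 0}.Finite := by
  refine ((Set.finite_Icc ⌊a / Real.pi⌋ ⌈b / Real.pi⌉).image fun k : ℤ => (k : ℝ) * Real.pi).subset ?_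
  rintro x ⟨⟨h1, h2⟩, h3⟩
  obtain ⟨k, rfl⟩ := Real.sin_eq_zero_iff.1 h3
  refine ⟨k, ⟨?_, ?_⟩, rfl⟩
  · have : a / Real.pi ≤ k := (div_le_iff₀ Real.pi_pos).2 h1
    exact_mod_cast (Int.floor_le _).trans this
  · have : (k : ℝ) ≤ b / Real.pi := (le_div_iff₀ Real.pi_pos).2 h2
    exact_mod_cast this.trans (Int.le_ceil _)

/-- Every path of lines is homotopic with fixed ends to a regular one. -/
lemma exists_regular_angle {T : ℝ} (hT : 0 < T) (a b : ℝ) :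
    ∃ (φ : ℝ → ℝ) (m : ℝ), Continuous φ ∧ φ 0 = a ∧ φ T = b ∧
      IsRegularIndex planeForm T (fun t => line (φ t)) planeV m := by
  by_cases hab : a = b
  · subst hab
    -- A constant path at a multiple of π has a degenerate crossing, so the angle makes the
    -- excursion a + 4A t(T - t)/T² instead. It is stationary only at T/2, with value a + A, which
    -- must not be a multiple of π. One of A = 1, 2 works, because a + 1 and a + 2 are closer than
    -- π.
    have hA : ∃ A : ℝ, A ≠ 0 ∧ Real.sin (a + A) ≠ 0 := by
      by_contra! h
      have h1 := h 1 (by norm_num)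
      have h2 := h 2 (by norm_num)
      obtain ⟨k, hk⟩ := Real.sin_eq_zero_iff.1 h1
      obtain ⟨l, hl⟩ := Real.sin_eq_zero_iff.1 h2
      have h3 : ((l - k : ℤ) : ℝ) * Real.pi = 1 := by push_cast; linarith
      have hpi := Real.pi_gt_three
      have hpos : 0 < ((l - k : ℤ) : ℝ) := by
        by_contra! hc
        nlinarith
      have : (1 : ℝ) ≤ ((l - k : ℤ) : ℝ) := by exact_mod_cast Int.cast_pos.1 hpos
      nlinarith
    obtain ⟨A, hA0, hA⟩ := hA
    have hd : ∀ t, HasDerivAt (fun t => a + 4 * A / T ^ 2 * (t * (T - t)))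
        (4 * A / T ^ 2 * (T - 2 * t)) t := by
      intro t
      have h1 : HasDerivAt (fun t => t * (T - t)) (1 * (T - t) + t * (-1)) t :=
        (hasDerivAt_id t).mul ((hasDerivAt_id t).const_sub T)
      refine ((h1.const_mul (4 * A / T ^ 2)).const_add a).congr_deriv ?_
      ring
    have h4 : 4 * A / T ^ 2 ≠ 0 := by positivity
    obtain ⟨m, hm⟩ := exists_isRegularIndex (T := T) hd (by fun_prop) (fun t _ h0 h1 => by
      have : t = T / 2 := by
        have := (mul_eq_zero.1 h1).resolve_left h4
        linarith
      apply hA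
      rw [← h0, this]
      congr 1
      field_simp
      ring) (by
      have hfin : ∀ x : ℝ, {t | a + 4 * A / T ^ 2 * (t * (T - t)) = x}.Finite := by
        intro x
        by_cases hne : ∃ t₀, a + 4 * A / T ^ 2 * (t₀ * (T - t₀)) = x
        · obtain ⟨t₀, ht₀⟩ := hne
          refine (Set.toFinite {t₀, T - t₀}).subset fun t ht => ?_
          have ht : a + 4 * A / T ^ 2 * (t * (T - t)) = x := ht
          -- The parabola takes each value at most twice, at times symmetric about T/2; this makes
          -- the crossings finite in number.
          have : 4 * A / T ^ 2 * ((t - t₀) * (t - (T - t₀))) = 0 := by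
            linear_combination ht₀ - ht
          rcases mul_eq_zero.1 ((mul_eq_zero.1 this).resolve_left h4) with h | h
          · left; linarith
          · right; simp only [mem_singleton_iff]; linarith
        · push Not at hne
          convert Set.finite_empty
          ext t
          simpa using hne t
      have hcpt : IsCompact ((fun t => a + 4 * A / T ^ 2 * (t * (T - t))) '' Icc 0 T) :=
        isCompact_Icc.image (by fun_prop)
      obtain ⟨lo, hlo⟩ := hcpt.bddBelow
      obtain ⟨hi, hhi⟩ := hcpt.bddAbove
      refine ((finite_int_mul_pi_mem_Icc lo hi).biUnion fun x _ => hfin x).subset ?_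
      rintro t ⟨ht, h0⟩
      refine mem_iUnion₂.2 ⟨_, ⟨⟨hlo ⟨t, ht, rfl⟩, hhi ⟨t, ht, rfl⟩⟩, h0⟩, rfl⟩)
    exact ⟨_, m, by fun_prop, by simp, by simp, hm⟩
  · have hba : (b - a) / T ≠ 0 := div_ne_zero (sub_ne_zero.2 (Ne.symm hab)) hT.ne'
    have hd : ∀ t, HasDerivAt (fun t => a + (b - a) / T * t) ((b - a) / T) t := by
      intro t
      simpa using ((hasDerivAt_id t).const_mul ((b - a) / T)).const_add a
    obtain ⟨m, hm⟩ := exists_isRegularIndex (T := T) hd (by fun_prop) (fun t _ _ => hba) (by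
      have hcpt : IsCompact ((fun t => a + (b - a) / T * t) '' Icc 0 T) :=
        isCompact_Icc.image (by fun_prop)
      obtain ⟨lo, hlo⟩ := hcpt.bddBelow
      obtain ⟨hi, hhi⟩ := hcpt.bddAbove
      refine Set.Finite.of_finite_image ((finite_int_mul_pi_mem_Icc lo hi).subset ?_)
        (f := fun t => a + (b - a) / T * t) ?_
      · rintro _ ⟨t, ⟨ht, h0⟩, rfl⟩
        exact ⟨⟨hlo ⟨t, ht, rfl⟩, hhi ⟨t, ht, rfl⟩⟩, h0⟩
      · intro s _ t _ hst
        exact mul_left_cancel₀ hba (add_left_cancel hst))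
    refine ⟨_, m, by fun_prop, by simp, ?_, hm⟩
    field_simp
    ring

/-- The Robbin-Salamon index of a path of lines in terms of its angle. -/
theorem isRobbinSalamonIndex_iff {T m : ℝ} (hT : 0 < T) {Λ : ℝ → Submodule ℝ (ℝ × ℝ)}
    {θ : ℝ → ℝ} (hθ : IsAngle T Λ θ) :
    IsRobbinSalamonIndex planeForm T Λ planeV m ↔ m = halfIndex (θ T) - halfIndex (θ 0) := by
  have j0 : (0 : ℝ) ∈ Icc 0 T := left_mem_Icc.2 hT.le
  constructor
  · rintro ⟨Λ', hH, hR⟩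
    have hH' := hH
    obtain ⟨H, ⟨k, Z, hZ, hZ'⟩, hL, h01, hend⟩ := hH'
    have i1 : (1 : ℝ) ∈ Icc (0 : ℝ) 1 := by simp
    obtain ⟨θ', hθ'⟩ := exists_isAngle (Λ := Λ') hT.le ⟨k, fun t => Z (1, t),
      hZ.comp (by fun_prop) fun t ht => ⟨i1, ht⟩, fun t ht => by
        rw [← (h01 t ht).2]; exact hZ' (1, t) ⟨i1, ht⟩⟩
      fun t ht => (h01 t ht).2 ▸ hL (1, t) ⟨i1, ht⟩
    rw [hR.eq_halfIndex hT hθ']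
    have e := angle_sub_eq_of_isHomotopic hT.le hH hθ hθ'
    -- The angle of the regular path may be shifted by a multiple of π. The shift is the same at
    -- both ends and cancels in the difference of half indices.
    have e0 : line (θ 0) = line (θ' 0) := by
      rw [← hθ.2 0 j0, ← hθ'.2 0 j0, ← (h01 0 j0).2, (hend 1 i1).1]
    obtain ⟨k, hk⟩ := line_eq_line_iff.1 e0
    have hk' : k * Real.pi = θ' T - θ T := by linarith
    rw [halfIndex_of_sub hk, halfIndex_of_sub hk']
    ring
  · rintro rfl
    obtain ⟨φ, m, hφ, h0, hφT, hm⟩ := exists_regular_angle hT (θ 0) (θ T)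
    have hφ' : IsAngle T (fun t => line (φ t)) φ := ⟨hφ.continuousOn, fun t _ => rfl⟩
    rw [← h0, ← hφT, ← hm.eq_halfIndex hT hφ']
    exact ⟨_, isHomotopic_of_angle hθ hφ' hT.le h0 hφT, hm⟩

/-! ### Comparison of two paths of lines moved by the same isomorphisms. -/

lemma exists_isAngle_span {T : ℝ} (hT : 0 ≤ T) {u : ℝ → ℝ × ℝ} (hu : ContinuousOn u (Icc 0 T))
    (h0 : ∀ t ∈ Icc 0 T, u t ≠ 0) :
    ∃ θ : ℝ → ℝ, IsAngle T (fun t => Submodule.span ℝ {u t}) θ := by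
  obtain ⟨θ, hθ, h⟩ := exists_polar_Icc hT hu h0
  refine ⟨θ, hθ.continuousOn, fun t ht => ?_⟩
  obtain ⟨r, hr, e⟩ := h t ht
  exact line_eq_of_smul hr.ne' e

/-- Reversing time and reflecting the plane in `planeV` does not change the index. -/
lemma IsAngle.reflect {T : ℝ} {v : ℝ → ℝ × ℝ} {θ : ℝ → ℝ}
    (hθ : IsAngle T (fun t => Submodule.span ℝ {v t}) θ) :
    IsAngle T (fun t => Submodule.span ℝ {((v (T - t)).1, -(v (T - t)).2)})
      (fun t => -θ (T - t)) := by
  have hm : MapsTo (fun t => T - t) (Icc 0 T) (Icc 0 T) := fun t ht =>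
    ⟨by linarith [ht.2], by linarith [ht.1]⟩
  refine ⟨(hθ.1.comp (by fun_prop) hm).neg, fun t ht => ?_⟩
  have h := hθ.2 (T - t) (hm ht)
  let S : ℝ × ℝ →ₗ[ℝ] ℝ × ℝ := (LinearMap.fst ℝ ℝ ℝ).prod (-LinearMap.snd ℝ ℝ ℝ)
  have h2 := congrArg (Submodule.map S) h
  simp only [line, Submodule.map_span, image_singleton] at h2 ⊢
  convert h2 using 3
  · simp [S]
  · simp [S, unitVec]

/-- Since u and v are never parallel, φ - θ stays in one interval (kπ, (k+1)π). With θ(0) = aπ and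
φ(T) = bπ this puts φ(0) in ((a+k)π, (a+k+1)π) and θ(T) in ((b-k-1)π, (b-k)π). Both differences of
half indices are then b - a - k - 1/2. -/
lemma halfIndex_sub_eq {T : ℝ} (hT : 0 < T) {u v : ℝ → ℝ × ℝ} {θ φ : ℝ → ℝ}
    (hθ : IsAngle T (fun t => Submodule.span ℝ {u t}) θ)
    (hφ : IsAngle T (fun t => Submodule.span ℝ {v t}) φ)
    (hu : u 0 ∈ planeV) (hu0 : ∀ t ∈ Icc 0 T, u t ≠ 0) (hv : v T ∈ planeV)
    (hv0 : ∀ t ∈ Icc 0 T, v t ≠ 0) (h : ∀ t ∈ Icc 0 T, planeForm (u t) (v t) ≠ 0) :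
    halfIndex (θ T) - halfIndex (θ 0) = halfIndex (φ T) - halfIndex (φ 0) := by
  have j0 : (0 : ℝ) ∈ Icc 0 T := left_mem_Icc.2 hT.le
  have j1 : T ∈ Icc 0 T := right_mem_Icc.2 hT.le
  have hsin : ∀ t ∈ Icc 0 T, Real.sin (φ t - θ t) ≠ 0 := by
    intro t ht hs
    have e : line (θ t) = line (φ t) := line_eq_line_iff.2 (Real.sin_eq_zero_iff.1 hs)
    rw [← hθ.2 t ht, ← hφ.2 t ht] at e
    apply h t ht
    rw [← mem_span_singleton_iff_planeForm (hu0 t ht)]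
    simp only at e
    rw [e]
    exact Submodule.mem_span_singleton_self _
  have hzero : ∀ {w : ℝ × ℝ} {a : ℝ}, w ∈ planeV → w ≠ 0 → Submodule.span ℝ {w} = line a →
      ∃ k : ℤ, k * Real.pi = a := by
    intro w a hw hw0 e
    rw [← Real.sin_eq_zero_iff]
    have h1 : w ∈ line a := e ▸ Submodule.mem_span_singleton_self _
    by_contra hs
    have h2 : w ∈ line a ⊓ planeV := ⟨h1, hw⟩
    rw [line_inf_planeV, if_neg hs] at h2
    exact hw0 (by simpa using h2)
  obtain ⟨a, ha⟩ := hzero hu (hu0 0 j0) (hθ.2 0 j0)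
  obtain ⟨b, hb⟩ := hzero hv (hv0 T j1) (hφ.2 T j1)
  have hconst := eq_of_eventuallyEq_const hT (f := fun t => halfIndex (φ t - θ t)) fun t ht =>
    ((hφ.1.sub hθ.1) t ht).tendsto.eventually (halfIndex_eventuallyEq (hsin t ht))
  obtain ⟨k, hk⟩ := exists_mem_Ioo_of_sin_ne_zero (hsin 0 j0)
  obtain ⟨l, hl⟩ := exists_mem_Ioo_of_sin_ne_zero (hsin T j1)
  have hkl : (l : ℝ) = k := by
    simp only [halfIndex_of_mem_Ioo hk, halfIndex_of_mem_Ioo hl] at hconst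
    linarith
  rw [hkl] at hl
  rw [← ha] at hk
  rw [← hb] at hl
  rw [← ha, ← hb, halfIndex_int_mul_pi, halfIndex_int_mul_pi,
    halfIndex_of_mem_Ioo (k := a + k) (θ := φ 0)
      ⟨by push_cast; linarith [hk.1], by push_cast; linarith [hk.2]⟩,
    halfIndex_of_mem_Ioo (k := b - k - 1) (θ := θ T)
      ⟨by push_cast; linarith [hl.2], by push_cast; linarith [hl.1]⟩]
  push_cast
  ring

/-- The index of the path `ℝ u` which starts in `planeV` agrees with that of the reversed
reflected path `ℝ v` which ends in `planeV`, if `u` and `v` are images of two fixed vectors under a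
path of linear isomorphisms. -/
theorem exists_robbinSalamonIndex_eq {T : ℝ} (hT : 0 < T) {u v : ℝ → ℝ × ℝ}
    (hcu : ContinuousOn u (Icc 0 T)) (hcv : ContinuousOn v (Icc 0 T))
    (hu : u 0 ∈ planeV) (hu0 : ∀ t ∈ Icc 0 T, u t ≠ 0) (hv : v T ∈ planeV)
    (hv0 : ∀ t ∈ Icc 0 T, v t ≠ 0)
    (h : (∀ t ∈ Icc 0 T, planeForm (u t) (v t) ≠ 0) ∨ ∀ t ∈ Icc 0 T, planeForm (u t) (v t) = 0) :
    ∃ m₀ : ℝ,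
      (∀ m, IsRobbinSalamonIndex planeForm T (fun t => Submodule.span ℝ {u t}) planeV m ↔ m = m₀) ∧
      ∀ m, IsRobbinSalamonIndex planeForm T
        (fun t => Submodule.span ℝ {((v (T - t)).1, -(v (T - t)).2)}) planeV m ↔ m = m₀ := by
  obtain ⟨θ, hθ⟩ := exists_isAngle_span hT.le hcu hu0
  obtain ⟨φ, hφ⟩ := exists_isAngle_span hT.le hcv hv0
  refine ⟨_, fun m => isRobbinSalamonIndex_iff hT hθ, fun m => ?_⟩
  have key : halfIndex (θ T) - halfIndex (θ 0) = halfIndex (φ T) - halfIndex (φ 0) := by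
    rcases h with h | h
    · exact halfIndex_sub_eq hT hθ hφ hu hu0 hv hv0 h
    -- If u and v are parallel throughout, they span the same path of lines, and φ is also an angle
    -- of it.
    · have hφ' : IsAngle T (fun t => Submodule.span ℝ {u t}) φ := by
        refine ⟨hφ.1, fun t ht => ?_⟩
        rw [← hφ.2 t ht]
        have h1 := mem_span_of_planeForm_eq_zero (hu0 t ht) (h t ht)
        have h2 : planeForm (v t) (u t) = 0 := by
          have := h t ht
          rw [planeForm_apply] at this ⊢
          linarith
        have h2 := mem_span_of_planeForm_eq_zero (hv0 t ht) h2
        exact le_antisymm ((Submodule.span_singleton_le_iff_mem _ _).2 h2)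
          ((Submodule.span_singleton_le_iff_mem _ _).2 h1)
      have e1 := (isRobbinSalamonIndex_iff (m := halfIndex (θ T) - halfIndex (θ 0)) hT hθ).2 rfl
      exact (isRobbinSalamonIndex_iff hT hφ').1 e1
  rw [isRobbinSalamonIndex_iff hT hφ.reflect, key, sub_self, sub_zero, halfIndex_neg, halfIndex_neg]
  constructor <;> intro h <;> linarith

end LagrangianPath

/-! ## Linear differential equations -/

namespace LinearODE

variable {E : Type*} [NormedAddCommGroup E] [NormedSpace ℝ E]

/-- `y` solves `y' = L(t) y` on `[a, b]`. -/
def IsSolution (L : ℝ → E →L[ℝ] E) (a b : ℝ) (y : ℝ → E) : Prop :=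
  ∀ t ∈ Icc a b, HasDerivWithinAt y (L t (y t)) (Icc a b) t

lemma IsSolution.continuousOn {L : ℝ → E →L[ℝ] E} {a b : ℝ} {y : ℝ → E}
    (h : IsSolution L a b y) : ContinuousOn y (Icc a b) := fun t ht => (h t ht).continuousWithinAt

lemma exists_bound {L : ℝ → E →L[ℝ] E} {a b : ℝ} (hL : ContinuousOn L (Icc a b)) :
    ∃ K : NNReal, ∀ t ∈ Icc a b, ‖L t‖ ≤ K := by
  obtain ⟨C, hC⟩ := isCompact_Icc.exists_bound_of_continuousOn hL
  exact ⟨C.toNNReal, fun t ht => (hC t ht).trans (Real.le_coe_toNNReal C)⟩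

/-- Solutions of a linear equation which agree at one time agree at all times. -/
lemma IsSolution.eqOn {L : ℝ → E →L[ℝ] E} {a b : ℝ} (hL : ContinuousOn L (Icc a b)) {y z : ℝ → E}
    (hy : IsSolution L a b y) (hz : IsSolution L a b z) {s : ℝ} (hs : s ∈ Icc a b)
    (h : y s = z s) : EqOn y z (Icc a b) := by
  obtain ⟨K, hK⟩ := exists_bound hL
  have hlip : ∀ t ∈ Icc a b, LipschitzOnWith K (fun x => L t x) univ := fun t ht =>
    (((L t).lipschitz.weaken (hK t ht))).lipschitzOnWith
  have h1 : Icc a s ⊆ Icc a b := Icc_subset_Icc_right hs.2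
  have h2 : Icc s b ⊆ Icc a b := Icc_subset_Icc_left hs.1
  have hl : ∀ {w : ℝ → E}, IsSolution L a b w →
      ∀ t ∈ Ioc a s, HasDerivWithinAt w (L t (w t)) (Iic t) t := fun hw t ht =>
    ((hw t (h1 (Ioc_subset_Icc_self ht))).mono (Icc_subset_Icc_right (ht.2.trans hs.2))).mono_of_mem_nhdsWithin
      (Icc_mem_nhdsLE ht.1)
  have hr : ∀ {w : ℝ → E}, IsSolution L a b w →
      ∀ t ∈ Ico s b, HasDerivWithinAt w (L t (w t)) (Ici t) t := fun hw t ht =>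
    ((hw t (h2 (Ico_subset_Icc_self ht))).mono (Icc_subset_Icc_left (hs.1.trans ht.1))).mono_of_mem_nhdsWithin
      (Icc_mem_nhdsGE ht.2)
  rw [← Icc_union_Icc_eq_Icc hs.1 hs.2]
  refine EqOn.union ?_ ?_
  · exact ODE_solution_unique_of_mem_Icc_left (v := fun t x => L t x) (s := fun _ => univ)
      (fun t ht => hlip t (h1 (Ioc_subset_Icc_self ht))) (hy.continuousOn.mono h1) (hl hy)
      (fun _ _ => mem_univ _) (hz.continuousOn.mono h1) (hl hz) (fun _ _ => mem_univ _) h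
  · exact ODE_solution_unique_of_mem_Icc_right (v := fun t x => L t x) (s := fun _ => univ)
      (fun t ht => hlip t (h2 (Ico_subset_Icc_self ht))) (hy.continuousOn.mono h2) (hr hy)
      (fun _ _ => mem_univ _) (hz.continuousOn.mono h2) (hr hz) (fun _ _ => mem_univ _) h

lemma isSolution_zero (L : ℝ → E →L[ℝ] E) (a b : ℝ) : IsSolution L a b fun _ => 0 := fun t _ => by
  simpa using hasDerivWithinAt_const t (Icc a b) (0 : E)

/-- In the ball of radius ‖x‖ about x the speed is at most K · 2‖x‖. In time at most 1/(2K) a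
solution cannot leave this ball, so the Picard-Lindelöf theorem applies to the whole interval. -/
lemma exists_isSolution_of_le [CompleteSpace E] {L : ℝ → E →L[ℝ] E} {a b : ℝ} (hab : a ≤ b)
    (hL : ContinuousOn L (Icc a b)) {K : NNReal} (hK : ∀ t ∈ Icc a b, ‖L t‖ ≤ K)
    (hKb : 2 * K * (b - a) ≤ 1) (x : E) : ∃ y, y a = x ∧ IsSolution L a b y := by
  have hP : IsPicardLindelof (fun t x => L t x) (⟨a, left_mem_Icc.2 hab⟩ : Icc a b) x ‖x‖₊ 0
      (K * (2 * ‖x‖₊)) K := by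
    refine ⟨fun t ht => ((L t).lipschitz.weaken (hK t ht)).lipschitzOnWith,
      fun z _ => hL.clm_apply continuousOn_const, fun t ht z hz => ?_, ?_⟩
    · refine ((L t).le_opNorm z).trans ?_
      push_cast
      have h1 : ‖z‖ ≤ 2 * ‖x‖ := by
        have h2 : ‖z - x‖ ≤ ‖x‖ := by simpa [dist_eq_norm] using hz
        have h3 := norm_le_norm_add_norm_sub' z x
        linarith
      exact mul_le_mul (hK t ht) h1 (norm_nonneg _) K.2
    · push_cast
      rw [sub_self, max_eq_left (sub_nonneg.2 hab), sub_zero]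
      nlinarith [norm_nonneg x]
  exact hP.exists_eq_forall_mem_Icc_hasDerivWithinAt₀

lemma IsSolution.glue {L : ℝ → E →L[ℝ] E} {a c b : ℝ} {y z : ℝ → E}
    (hac : a ≤ c) (hcb : c ≤ b) (hy : IsSolution L a c y) (hz : IsSolution L c b z) (h : y c = z c) :
    IsSolution L a b fun t => if t ≤ c then y t else z t := by
  have e1 : ∀ t ∈ Icc a c, (if t ≤ c then y t else z t) = y t := fun t ht => if_pos ht.2
  have e2 : ∀ t ∈ Icc c b, (if t ≤ c then y t else z t) = z t := by
    intro t ht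
    split_ifs with h'
    · rw [le_antisymm h' ht.1, h]
    · rfl
  intro t ht
  rw [← Icc_union_Icc_eq_Icc hac hcb]
  refine HasDerivWithinAt.union ?_ ?_
  · by_cases h1 : t ∈ Icc a c
    · beta_reduce
      rw [e1 t h1]
      exact (hy t h1).congr e1 (e1 t h1)
    -- `HasDerivWithinAt.union` asks for a derivative within each half even at points outside of it,
    -- where the condition is vacuous.
    · exact HasFDerivWithinAt.of_notMem_closure (by rwa [closure_Icc])
  · by_cases h1 : t ∈ Icc c b
    · beta_reduce
      rw [e2 t h1]
      exact (hz t h1).congr e2 (e2 t h1)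
    · exact HasFDerivWithinAt.of_notMem_closure (by rwa [closure_Icc])

/-- Linear equations with continuous coefficients have global solutions. -/
lemma exists_isSolution [CompleteSpace E] {L : ℝ → E →L[ℝ] E} {T : ℝ} (hT : 0 ≤ T)
    (hL : ContinuousOn L (Icc 0 T)) (x : E) : ∃ y, y 0 = x ∧ IsSolution L 0 T y := by
  obtain ⟨K, hK⟩ := exists_bound hL
  -- The step length depends only on the bound K and not on the initial value, so finitely many
  -- steps reach T.
  obtain ⟨δ, hδ, hKδ⟩ : ∃ δ : ℝ, 0 < δ ∧ 2 * K * δ ≤ 1 := by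
    refine ⟨1 / (2 * K + 1), by positivity, ?_⟩
    rw [mul_one_div, div_le_one (by positivity)]
    linarith
  have main : ∀ n : ℕ, ∀ τ ∈ Icc 0 T, τ ≤ n * δ → ∃ y, y 0 = x ∧ IsSolution L 0 τ y := by
    intro n
    induction n with
    | zero =>
      intro τ hτ h
      have hτ0 : τ = 0 := le_antisymm (by simpa using h) hτ.1
      subst hτ0
      exact exists_isSolution_of_le le_rfl (hL.mono (Icc_subset_Icc_right hT))
        (fun t ht => hK t (Icc_subset_Icc_right hT ht)) (by simp) x
    | succ n ih =>
      intro τ hτ h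
      by_cases hn : τ ≤ n * δ
      · exact ih τ hτ hn
      push Not at hn
      have h0 : 0 ≤ n * δ := by positivity
      obtain ⟨y, hy0, hy⟩ := ih (n * δ) ⟨h0, hn.le.trans hτ.2⟩ le_rfl
      have hsub : Icc (n * δ) τ ⊆ Icc 0 T := Icc_subset_Icc h0 hτ.2
      obtain ⟨z, hz0, hz⟩ := exists_isSolution_of_le hn.le (hL.mono hsub)
        (fun t ht => hK t (hsub ht)) (by
          push_cast at h
          have : τ - n * δ ≤ δ := by linarith
          have hK0 : (0 : ℝ) ≤ 2 * K := by positivity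
          nlinarith) (y (n * δ))
      exact ⟨_, by rw [if_pos h0, hy0], hy.glue h0 hn.le hz hz0.symm⟩
  obtain ⟨n, hn⟩ := exists_nat_ge (T / δ)
  exact main n T (right_mem_Icc.2 hT) ((div_le_iff₀ hδ).1 hn)

end LinearODE

/-! ## The effective potential in polar coordinates at a primary -/

namespace ThreeBody

/-- The distance to the other primary of the point with polar coordinates `r`, `s = cos θ` at a
primary, where the other primary lies in the direction `θ = 0`. -/
def polarDist (r s : ℝ) : ℝ := √(r ^ 2 - 2 * r * s + 1)

/-- The effective potential in polar coordinates at a primary of mass `1 - m`. -/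
def effPot (m r s : ℝ) : ℝ :=
  -(r ^ 2 - 2 * r * m * s + m ^ 2) / 2 - (1 - m) / r - m / polarDist r s

/-- The radial derivative of the effective potential. -/
def effForce (m r s : ℝ) : ℝ :=
  -r + m * s + (1 - m) / r ^ 2 + m * (r - s) / polarDist r s ^ 3

lemma polarDist_radicand_ge {r s : ℝ} (hr : 0 ≤ r) (hs : s ≤ 1) :
    (1 - r) ^ 2 ≤ r ^ 2 - 2 * r * s + 1 := by nlinarith

lemma polarDist_sq {r s : ℝ} (hr : 0 ≤ r) (hs : s ≤ 1) :
    polarDist r s ^ 2 = r ^ 2 - 2 * r * s + 1 :=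
  Real.sq_sqrt ((sq_nonneg _).trans (polarDist_radicand_ge hr hs))

lemma le_polarDist {r s : ℝ} (hr : 0 ≤ r) (hs : s ≤ 1) : 1 - r ≤ polarDist r s :=
  Real.le_sqrt_of_sq_le (polarDist_radicand_ge hr hs)

lemma polarDist_le {r s : ℝ} (hr : 0 ≤ r) (hs : -1 ≤ s) : polarDist r s ≤ 1 + r :=
  Real.sqrt_le_iff.2 ⟨by linarith, by nlinarith⟩

lemma polarDist_one {r : ℝ} (hr1 : r < 1) : polarDist r 1 = 1 - r := by
  rw [polarDist, show r ^ 2 - 2 * r * 1 + 1 = (1 - r) ^ 2 by ring, Real.sqrt_sq (by linarith)]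

/-- The radial force is smallest in the direction of the other primary. -/
lemma effForce_one_le {m r s : ℝ} (hm : 0 ≤ m) (hr : 0 < r) (hr1 : r < 1) (hs : -1 ≤ s)
    (hs1 : s ≤ 1) : effForce m r 1 ≤ effForce m r s := by
  have hD := le_polarDist hr.le hs1
  have hD2 := polarDist_sq hr.le hs1
  have hD' := polarDist_le hr.le hs
  rw [effForce, effForce, polarDist_one hr1]
  set D := polarDist r s
  have hD0 : 0 < D := by linarith
  have hr0 : 0 < 1 - r := by linarith
  suffices h : 1 - 1 / (1 - r) ^ 2 ≤ s + (r - s) / D ^ 3 by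
    have h1 : (r - 1) / (1 - r) ^ 3 = -(1 / (1 - r) ^ 2) := by field_simp; ring
    have h2 := mul_le_mul_of_nonneg_left h hm
    rw [mul_div_assoc, mul_div_assoc, h1]
    linarith
  have hw : 1 / D ^ 2 ≤ 1 / (1 - r) ^ 2 :=
    one_div_le_one_div_of_le (by positivity) (pow_le_pow_left₀ hr0.le hD 2)
  have hw1 : 1 ≤ 1 / (1 - r) ^ 2 := by
    rw [le_div_iff₀ (by positivity)]
    nlinarith
  -- u is the cosine of the angle, at the given point, between the radial direction and the
  -- direction to the other primary.
  obtain ⟨u, hu⟩ : ∃ u, u = (s - r) / D := ⟨_, rfl⟩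
  have huD : u * D = s - r := by rw [hu]; field_simp
  have hterm : (r - s) / D ^ 3 = -(u * (1 / D ^ 2)) := by rw [hu]; field_simp; ring
  -- For s ≥ 0 one has u ≤ s, so the right side is at least s(1 - 1/D²); this is nonnegative if D >
  -- 1, and at least 1 - 1/D² ≥ 1 - 1/(1-r)² if D ≤ 1. For s < 0 the value -2r separates the two
  -- sides.
  rcases le_or_gt 0 s with h0 | h0
  · have hus : u ≤ s := by
      by_contra! hc
      nlinarith [mul_nonneg h0 (sub_nonneg.2 hD), mul_pos (sub_pos.2 hc) hD0,
        mul_nonneg hr.le (sub_nonneg.2 hs1)]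
    have hDi : 0 < 1 / D ^ 2 := by positivity
    rw [hterm]
    rcases le_or_gt D 1 with hD1 | hD1
    · have h1 : 1 ≤ 1 / D ^ 2 := by
        rw [le_div_iff₀ (by positivity)]
        nlinarith
      nlinarith [mul_nonneg (sub_nonneg.2 h1) (sub_nonneg.2 hs1),
        mul_nonneg hDi.le (sub_nonneg.2 hus)]
    · have h1 : 1 / D ^ 2 ≤ 1 := by
        rw [div_le_iff₀ (by positivity)]
        nlinarith
      nlinarith [mul_nonneg h0 (sub_nonneg.2 h1), mul_nonneg hDi.le (sub_nonneg.2 hus)]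
  · have h1 : (r - s) / (1 + r) ^ 3 ≤ (r - s) / D ^ 3 :=
      div_le_div_of_nonneg_left (by linarith) (by positivity) (pow_le_pow_left₀ hD0.le hD' 3)
    have h2 : 1 + 2 * r ≤ 1 / (1 - r) ^ 2 := by
      rw [le_div_iff₀ (by positivity)]
      nlinarith [mul_pos hr hr, mul_pos (mul_pos hr hr) hr0]
    have h3 : -2 * r ≤ s + (r - s) / (1 + r) ^ 3 := by
      have : s + (r - s) / (1 + r) ^ 3 = (s * (1 + r) ^ 3 + (r - s)) / (1 + r) ^ 3 := by
        field_simp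
      rw [this, le_div_iff₀ (by positivity)]
      have h4 : 0 ≤ (s + 1) * ((1 + r) ^ 3 - 1) := by
        refine mul_nonneg (by linarith) ?_
        nlinarith [mul_pos hr hr, mul_pos (mul_pos hr hr) hr]
      nlinarith [mul_pos hr hr, mul_pos (mul_pos hr hr) hr, mul_pos (mul_pos (mul_pos hr hr) hr) hr]
    linarith

/-- Dividing `effForce m r 1` by r gives exactly the difference of the two sides. The inequality
turns positivity of the force into a lower bound for the attraction of the near primary. -/
lemma mass_div_cube_gt {m r : ℝ} (hr : 0 < r) (hr1 : r < 1)
    (h : 0 < effForce m r 1) : 1 + m * (2 - r) / (1 - r) ^ 2 < (1 - m) / r ^ 3 := by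
  rw [effForce, polarDist_one hr1] at h
  have hr0 : 0 < 1 - r := by linarith
  have e : (1 - m) / r ^ 3 - (1 + m * (2 - r) / (1 - r) ^ 2) =
      (-r + m * 1 + (1 - m) / r ^ 2 + m * (r - 1) / (1 - r) ^ 3) / r := by
    have : (r - 1) = -(1 - r) := by ring
    rw [this]
    field_simp
    ring
  have := div_pos h hr
  linarith

/-- The effective potential is radially concave, in a strong sense, up to the saddle. -/
lemma effForce_deriv_le {m r s : ℝ} (hm : 0 < m) (hm1 : m < 1) (hr : 0 < r) (hr1 : r < 1)
    (hs1 : s ≤ 1) (h : 0 < effForce m r 1) :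
    m / polarDist r s ^ 3 - 3 * m * (r - s) ^ 2 / polarDist r s ^ 5 ≤ 2 * (1 - m) / r ^ 3 := by
  have hM := mass_div_cube_gt hr hr1 h
  have hD := le_polarDist hr.le hs1
  have hD2 := polarDist_sq hr.le hs1
  set D := polarDist r s
  have hr0 : 0 < 1 - r := by linarith
  have hD0 : 0 < D := by linarith
  have hpos : 0 < m * (2 - r) / (1 - r) ^ 2 := by
    have : 0 < 2 - r := by linarith
    positivity
  have hM2 : 2 * (1 - m) / r ^ 3 = 2 * ((1 - m) / r ^ 3) := by ring
  rw [hM2]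
  have hneg : 0 ≤ 3 * m * (r - s) ^ 2 / D ^ 5 := by positivity
  -- The left side is the tidal term m(1 - 3u²)/D³ of the other primary. For r ≤ 0.63 one has 1 ≤
  -- 2(2-r)(1-r), and the worst case D = 1 - r is covered by the second term of `mass_div_cube_gt`.
  rcases le_or_gt r 0.63 with h63 | h63
  · have h1 : m / D ^ 3 ≤ m / (1 - r) ^ 3 :=
      div_le_div_of_nonneg_left hm.le (by positivity) (pow_le_pow_left₀ hr0.le hD 3)
    have h2 : m / (1 - r) ^ 3 ≤ 2 * (m * (2 - r) / (1 - r) ^ 2) := by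
      have : 2 * (m * (2 - r) / (1 - r) ^ 2) = m * (2 * (2 - r) * (1 - r)) / (1 - r) ^ 3 := by
        field_simp
      rw [this]
      refine div_le_div_of_nonneg_right ?_ (by positivity)
      have : 1 ≤ 2 * (2 - r) * (1 - r) := by nlinarith
      nlinarith
    linarith
  -- Far from the axis the tidal term is at most 2: positivity of the force, with denominators
  -- cleared, gives m < 4.394 (1-r)³, and 4.394 = 2 · 1.3³. Near the axis u ≥ 0.58 > 1/√3, so the
  -- tidal term is not positive.
  · by_cases hDr : 1.3 * (1 - r) ≤ D
    · have h1 : m / D ^ 3 ≤ 2 := by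
        rw [div_le_iff₀ (by positivity)]
        have h2 : (1.3 * (1 - r)) ^ 3 ≤ D ^ 3 := pow_le_pow_left₀ (by positivity) hDr 3
        have h3 : m * (r ^ 2 + (1 - r) ^ 2 * (1 - r ^ 2)) < (1 - r) ^ 3 * (1 + r + r ^ 2) := by
          rw [effForce, polarDist_one hr1] at h
          have := mul_pos h (by positivity : 0 < r ^ 2 * (1 - r) ^ 2)
          have e : (-r + m * 1 + (1 - m) / r ^ 2 + m * (r - 1) / (1 - r) ^ 3)
              * (r ^ 2 * (1 - r) ^ 2) =
              (1 - r) ^ 3 * (1 + r + r ^ 2) - m * (r ^ 2 + (1 - r) ^ 2 * (1 - r ^ 2)) := by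
            have : (r - 1) = -(1 - r) := by ring
            rw [this]
            field_simp
            ring
          linarith
        have h4 : 1 + r + r ^ 2 ≤ 4.394 * (r ^ 2 + (1 - r) ^ 2 * (1 - r ^ 2)) := by
          nlinarith [mul_pos hr hr0, mul_pos (sub_pos.2 h63) hr0,
            mul_pos (mul_pos (sub_pos.2 h63) hr0) hr, sq_nonneg (r - 0.63), sq_nonneg (r ^ 2 - 0.4),
            mul_pos (mul_pos (sub_pos.2 h63) hr0) (mul_pos hr hr0)]
        have h5 : 0 < r ^ 2 + (1 - r) ^ 2 * (1 - r ^ 2) := by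
          have : 0 < 1 - r ^ 2 := by nlinarith
          positivity
        have h6 : m * (r ^ 2 + (1 - r) ^ 2 * (1 - r ^ 2)) <
            4.394 * (1 - r) ^ 3 * (r ^ 2 + (1 - r) ^ 2 * (1 - r ^ 2)) := by
          have := mul_le_mul_of_nonneg_left h4 (by positivity : 0 ≤ (1 - r) ^ 3)
          linarith
        have h7 := lt_of_mul_lt_mul_right h6 h5.le
        have e : (1.3 * (1 - r)) ^ 3 = 2.197 * (1 - r) ^ 3 := by ring
        rw [e] at h2
        linarith
      linarith
    · push Not at hDr
      obtain ⟨u, hu⟩ : ∃ u, u = (s - r) / D := ⟨_, rfl⟩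
      have huD : u * D = s - r := by rw [hu]; field_simp
      have hu2 : 0.58 ≤ u := by
        have h1 : 2 * r * D * u = 1 - r ^ 2 - D ^ 2 := by
          rw [hD2]
          linear_combination 2 * r * huD
        by_contra! hc
        have h2 : 2 * r * D * u ≤ 2 * r * D * 0.58 :=
          mul_le_mul_of_nonneg_left hc.le (by positivity)
        have h3 : D ^ 2 ≤ (1.3 * (1 - r)) ^ 2 := pow_le_pow_left₀ hD0.le hDr.le 2
        have h4 : 2 * r * D ≤ 2 * r * (1.3 * (1 - r)) :=
          mul_le_mul_of_nonneg_left hDr.le (by positivity)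
        nlinarith [mul_pos hr0 (sub_pos.2 h63)]
      have h1 : m / D ^ 3 ≤ 3 * m * (r - s) ^ 2 / D ^ 5 := by
        have : (r - s) ^ 2 = (u * D) ^ 2 := by rw [huD]; ring
        rw [this, div_le_div_iff₀ (by positivity) (by positivity)]
        have h2 : 1 ≤ 3 * u ^ 2 := by nlinarith
        have h3 : 0 ≤ m * D ^ 5 := by positivity
        nlinarith
      linarith

/-- On a circle around a primary, the effective potential is smallest in the direction of the other
primary. -/
lemma effPot_one_le {m r s : ℝ} (hm : 0 ≤ m) (hr : 0 < r) (hr1 : r < 1) (hs : -1 ≤ s)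
    (hs1 : s ≤ 1) : effPot m r 1 ≤ effPot m r s := by
  have hD := le_polarDist hr.le hs1
  have hD2 := polarDist_sq hr.le hs1
  have hD' := polarDist_le hr.le hs
  rw [effPot, effPot, polarDist_one hr1]
  set D := polarDist r s
  have hr0 : 0 < 1 - r := by linarith
  have hD0 : 0 < D := by linarith
  -- From D² - (1-r)² = 2r(1-s), both sides contain the factor D - (1-r). The claim then reduces to
  -- (D + 1 - r)(1-r)D ≤ 2, which follows from D ≤ 1 + r.
  have key : r * (1 - s) ≤ 1 / (1 - r) - 1 / D := by
    have e : r * (1 - s) = (D - (1 - r)) * (D + (1 - r)) / 2 := by linear_combination -hD2 / 2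
    have e' : 1 / (1 - r) - 1 / D = (D - (1 - r)) * (1 / ((1 - r) * D)) := by field_simp
    rw [e, e', mul_div_assoc]
    refine mul_le_mul_of_nonneg_left ?_ (by linarith)
    rw [le_div_iff₀ (by positivity)]
    have h1 : (1 - r) * D ≤ (1 - r) * (1 + r) := mul_le_mul_of_nonneg_left hD' hr0.le
    have h2 : (D + (1 - r)) * ((1 - r) * D) ≤ 2 * 1 :=
      mul_le_mul (by linarith) (by nlinarith) (by positivity) (by norm_num)
    linarith
  have := mul_le_mul_of_nonneg_left key hm
  have e1 : m / (1 - r) = m * (1 / (1 - r)) := by ring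
  have e2 : m / D = m * (1 / D) := by ring
  rw [e1, e2]
  nlinarith

/-- The position of the saddle between the primaries. -/
lemma exists_saddle {m : ℝ} (hm : 0 < m) (hm1 : m < 1) :
    ∃ ρ, 0 < ρ ∧ ρ < 1 ∧ effForce m ρ 1 = 0 ∧ ∀ r, 0 < r → r < ρ → 0 < effForce m r 1 := by
  -- p is the numerator of `effForce m r 1`, with p(0) = 1 - m > 0 and p(1) = -m < 0.
  let p : ℝ → ℝ := fun r => (1 - m) * (1 - r) ^ 2 - (r - m) * r ^ 2 * (1 - r) ^ 2 - m * r ^ 2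
  have hp : ContinuousOn p (Icc 0 1) := by fun_prop
  obtain ⟨ρ, ⟨h0, h1⟩, hρ⟩ := intermediate_value_Ioo' zero_le_one hp
    (show (0 : ℝ) ∈ Ioo (p 1) (p 0) from ⟨by simp only [p]; linarith, by simp only [p]; linarith⟩)
  have hf : ∀ r, 0 < r → r < 1 → effForce m r 1 = p r / (r ^ 2 * (1 - r) ^ 2) := by
    intro r hr hr1
    have hr0 : 1 - r ≠ 0 := by linarith
    rw [effForce, polarDist_one hr1, show r - 1 = -(1 - r) by ring]
    simp only [p]
    field_simp
    ring
  have hz : effForce m ρ 1 = 0 := by rw [hf ρ h0 h1, hρ, zero_div]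
  refine ⟨ρ, h0, h1, hz, fun r hr hrρ => ?_⟩
  -- On the axis every r-dependent term of the force decreases in r, and -r does so strictly; hence
  -- the force is positive before its zero ρ.
  rw [← hz, effForce, effForce, polarDist_one h1, polarDist_one (hrρ.trans h1)]
  have a1 : (1 - m) / ρ ^ 2 ≤ (1 - m) / r ^ 2 := div_le_div_of_nonneg_left (by linarith)
    (by positivity) (pow_le_pow_left₀ hr.le hrρ.le 2)
  have b0 : 0 < 1 - ρ := by linarith
  have b1 : 0 < 1 - r := by linarith
  have a2 : m / (1 - r) ^ 2 ≤ m / (1 - ρ) ^ 2 := div_le_div_of_nonneg_left hm.le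
    (by positivity) (pow_le_pow_left₀ b0.le (by linarith) 2)
  have e1 : m * (ρ - 1) / (1 - ρ) ^ 3 = -(m / (1 - ρ) ^ 2) := by field_simp; ring
  have e2 : m * (r - 1) / (1 - r) ^ 3 = -(m / (1 - r) ^ 2) := by field_simp; ring
  rw [e1, e2]
  linarith

/-! ### Radial derivatives of the effective potential. -/

lemma hasDerivAt_polarDist {r s : ℝ} (hr : 0 ≤ r) (hr1 : r < 1) (hs1 : s ≤ 1) :
    HasDerivAt (fun r => polarDist r s) ((r - s) / polarDist r s) r := by
  have hpos : r ^ 2 - 2 * r * s + 1 ≠ 0 := by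
    have := polarDist_radicand_ge hr hs1
    have : 0 < (1 - r) ^ 2 := by
      have : 0 < 1 - r := by linarith
      positivity
    linarith
  have h1 : HasDerivAt (fun r : ℝ => r ^ 2 - 2 * r * s + 1) (2 * r - 2 * s) r := by
    have := (((hasDerivAt_id r).pow 2).sub (((hasDerivAt_id r).const_mul 2).mul_const s)).add_const 1
    refine this.congr_deriv ?_
    simp
  refine (h1.sqrt hpos).congr_deriv ?_
  rw [polarDist]
  have : √(r ^ 2 - 2 * r * s + 1) ≠ 0 := by
    have h := le_polarDist hr hs1
    rw [polarDist] at h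
    linarith
  field_simp

lemma hasDerivAt_effPot {m r s : ℝ} (hr : 0 < r) (hr1 : r < 1) (hs1 : s ≤ 1) :
    HasDerivAt (fun r => effPot m r s) (effForce m r s) r := by
  have hD := hasDerivAt_polarDist hr.le hr1 hs1
  have hD0 : polarDist r s ≠ 0 := by
    have := le_polarDist hr.le hs1
    linarith
  have h1 : HasDerivAt (fun r : ℝ => -(r ^ 2 - 2 * r * m * s + m ^ 2) / 2)
      (-(2 * r - 2 * m * s) / 2) r := by
    refine (((((hasDerivAt_id r).pow 2).sub ((((hasDerivAt_id r).const_mul 2).mul_const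
      m).mul_const s)).add_const (m ^ 2)).neg.div_const 2).congr_deriv ?_
    simp
  have h2 : HasDerivAt (fun r : ℝ => (1 - m) / r) (-(1 - m) / r ^ 2) r := by
    refine ((hasDerivAt_const r (1 - m)).div (hasDerivAt_id r) hr.ne').congr_deriv ?_
    simp
  have h3 : HasDerivAt (fun r => m / polarDist r s) (-(m * ((r - s) / polarDist r s)) /
      polarDist r s ^ 2) r := by
    refine ((hasDerivAt_const r m).div hD hD0).congr_deriv ?_
    simp
  refine ((h1.sub h2).sub h3).congr_deriv ?_
  rw [effForce]
  field_simp
  ring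

lemma hasDerivAt_effForce {m r s : ℝ} (hr : 0 < r) (hr1 : r < 1) (hs1 : s ≤ 1) :
    HasDerivAt (fun r => effForce m r s) (-1 - 2 * (1 - m) / r ^ 3 +
      (m / polarDist r s ^ 3 - 3 * m * (r - s) ^ 2 / polarDist r s ^ 5)) r := by
  have hD := hasDerivAt_polarDist hr.le hr1 hs1
  have hD0 : polarDist r s ≠ 0 := by
    have := le_polarDist hr.le hs1
    linarith
  have h1 : HasDerivAt (fun r : ℝ => -r + m * s) (-1) r :=
    (hasDerivAt_id r).neg.add_const (m * s)
  have h2 : HasDerivAt (fun r : ℝ => (1 - m) / r ^ 2) (-((1 - m) * (2 * r)) / (r ^ 2) ^ 2) r := by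
    refine ((hasDerivAt_const r (1 - m)).div ((hasDerivAt_id r).pow 2) (by simp [hr.ne'])).congr_deriv ?_
    simp
  have h3 : HasDerivAt (fun r => m * (r - s) / polarDist r s ^ 3)
      ((m * polarDist r s ^ 3 - m * (r - s) * (3 * polarDist r s ^ 2 * ((r - s) / polarDist r s))) /
      (polarDist r s ^ 3) ^ 2) r := by
    refine ((((hasDerivAt_id r).sub_const s).const_mul m).div (hD.pow 3) (by simp [hD0])).congr_deriv ?_
    simp
  refine ((h1.add h2).add h3).congr_deriv ?_
  field_simp
  ring

/-- Below the energy of the saddle, the radial force exceeds the speed inside of the saddle. -/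
lemma effForce_pos_and_sq_gt {m c ρ r s : ℝ} (hm : 0 < m) (hm1 : m < 1) (hρ1 : ρ < 1)
    (hρ : ∀ r, 0 < r → r < ρ → 0 < effForce m r 1) (hc : c < effPot m ρ 1) (hr : 0 < r)
    (hrρ : r < ρ) (hs : -1 ≤ s) (hs1 : s ≤ 1) :
    0 < effForce m r s ∧ 2 * (c - effPot m r s) < effForce m r s ^ 2 := by
  have hpos : ∀ t, 0 < t → t < ρ → 0 < effForce m t s := fun t h0 h1 =>
    (hρ t h0 h1).trans_le (effForce_one_le hm.le h0 (h1.trans hρ1) hs hs1)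
  refine ⟨hpos r hr hrρ, ?_⟩
  -- Writing F = U', the derivative of F² + 2U is 2F(F' + 1), and `effForce_deriv_le` says F' ≤ -1.
  -- So F² + 2U at r is at least its value at ρ, hence at least 2U(ρ, s) ≥ 2U(ρ, 1) > 2c.
  have hd : ∀ t ∈ Icc r ρ, HasDerivAt (fun t => effForce m t s ^ 2 + 2 * effPot m t s)
      (2 * effForce m t s * ((-1 - 2 * (1 - m) / t ^ 3 +
      (m / polarDist t s ^ 3 - 3 * m * (t - s) ^ 2 / polarDist t s ^ 5)) + 1)) t := by
    intro t ht
    have h0 : 0 < t := hr.trans_le ht.1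
    have h1 : t < 1 := ht.2.trans_lt hρ1
    refine (((hasDerivAt_effForce (m := m) h0 h1 hs1).pow 2).add
      ((hasDerivAt_effPot (m := m) h0 h1 hs1).const_mul 2)).congr_deriv ?_
    simp only [Nat.cast_ofNat, Nat.add_one_sub_one, pow_one]
    ring
  have hanti : AntitoneOn (fun t => effForce m t s ^ 2 + 2 * effPot m t s) (Icc r ρ) := by
    refine antitoneOn_of_deriv_nonpos (convex_Icc r ρ)
      (fun t ht => (hd t ht).continuousAt.continuousWithinAt)
      (fun t ht => (hd t (interior_subset ht)).differentiableAt.differentiableWithinAt)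
      fun t ht => ?_
    rw [(hd t (interior_subset ht)).deriv]
    rw [interior_Icc] at ht
    have h0 : 0 < t := hr.trans ht.1
    have h1 := effForce_deriv_le (s := s) hm hm1 h0 (ht.2.trans hρ1) hs1 (hρ t h0 ht.2)
    have h2 := hpos t h0 ht.2
    nlinarith
  have h1 := hanti (left_mem_Icc.2 hrρ.le) (right_mem_Icc.2 hrρ.le) hrρ.le
  simp only at h1
  have h2 := effPot_one_le (s := s) hm.le (hr.trans hrρ) hρ1 hs hs1
  nlinarith [sq_nonneg (effForce m ρ s)]

end ThreeBody

/-! ## The component of the Hill's region at a primary -/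

namespace ThreeBody

/-- The sign of the direction from a primary to the other one. -/
def Primary.dirSign : Primary → ℝ
  | Primary.earth => -1
  | Primary.moon => 1

/-- The cosine of the angle at the primary `P` between `y` and the direction to the other primary. -/
def polarCos (P : Primary) (y : R2) : ℝ := P.dirSign * y 0 / ‖y‖

lemma Primary.dirSign_sq (P : Primary) : P.dirSign ^ 2 = 1 := by cases P <;> simp [dirSign]

lemma Primary.mass_eq (μ : ℝ) (P : Primary) : P.mass μ = 1 - P.other.mass μ := by
  cases P <;> simp [mass, other]

lemma Primary.mass_pos {μ : ℝ} (h0 : 0 < μ) (h1 : μ < 1) (P : Primary) : 0 < P.mass μ := by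
  cases P <;> simp [mass, h0, h1]

lemma Primary.pos_zero (μ : ℝ) (P : Primary) : P.pos μ 0 = -(P.dirSign * P.other.mass μ) := by
  cases P <;> simp [mass, other, dirSign, pos]

lemma Primary.pos_one (μ : ℝ) (P : Primary) : P.pos μ 1 = 0 := by
  cases P <;> simp [pos]

lemma Primary.other_pos_zero (μ : ℝ) (P : Primary) :
    P.other.pos μ 0 = P.pos μ 0 + P.dirSign := by
  cases P <;> simp [other, dirSign, pos]; ring

lemma sq_norm_R2 (y : R2) : ‖y‖ ^ 2 = y 0 ^ 2 + y 1 ^ 2 := by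
  rw [EuclideanSpace.real_norm_sq_eq, Fin.sum_univ_two]

lemma norm_mul_polarCos (P : Primary) {y : R2} (hy : y ≠ 0) :
    ‖y‖ * polarCos P y = P.dirSign * y 0 := by
  rw [polarCos, mul_div_cancel₀ _ (norm_ne_zero_iff.2 hy)]

lemma abs_polarCos_le (P : Primary) {y : R2} (hy : y ≠ 0) : |polarCos P y| ≤ 1 := by
  have hn := norm_pos_iff.2 hy
  rw [← sq_le_one_iff_abs_le_one, polarCos, div_pow, mul_pow, P.dirSign_sq, sq_norm_R2,
    div_le_one (by rw [← sq_norm_R2]; positivity)]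
  nlinarith [sq_nonneg (y 1)]

lemma norm_sub_other_pos (μ : ℝ) (P : Primary) {y : R2} (hy : y ≠ 0) :
    ‖y + P.pos μ - P.other.pos μ‖ = polarDist ‖y‖ (polarCos P y) := by
  have h := norm_mul_polarCos P hy
  rw [polarDist, mul_assoc, h, ← Real.sqrt_sq (norm_nonneg (y + P.pos μ - P.other.pos μ)),
    sq_norm_R2, sq_norm_R2]
  congr 1
  simp only [PiLp.sub_apply, PiLp.add_apply, Primary.other_pos_zero, Primary.pos_one]
  linear_combination P.dirSign_sq

/-- The Hamiltonian, written such that the primary `P` is distinguished. -/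
lemma hamiltonian_eq (μ : ℝ) (P : Primary) (z : R2 × R2) :
    hamiltonian μ z = (1 / 2) * ‖z.2‖ ^ 2 - P.mass μ / ‖z.1 - P.pos μ‖
      - P.other.mass μ / ‖z.1 - P.other.pos μ‖ + (z.1 0 * z.2 1 - z.1 1 * z.2 0) := by
  cases P <;> simp [hamiltonian, Primary.mass, Primary.other]
  ring

/-- Completing the square in the momentum separates the squared velocity from the effective
potential, which absorbs the centrifugal term. -/
lemma hamiltonian_eq_effPot (μ : ℝ) (P : Primary) {y : R2} (hy : y ≠ 0) (p : R2) :
    hamiltonian μ (y + P.pos μ, p) =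
      ((p 0 - (y + P.pos μ) 1) ^ 2 + (p 1 + (y + P.pos μ) 0) ^ 2) / 2
        + effPot (P.other.mass μ) ‖y‖ (polarCos P y) := by
  have h := norm_mul_polarCos P hy
  rw [hamiltonian_eq μ P, effPot, ← norm_sub_other_pos μ P hy, P.mass_eq μ]
  simp only [add_sub_cancel_right, sq_norm_R2, PiLp.add_apply, Primary.pos_zero, Primary.pos_one]
  linear_combination (-P.other.mass μ) * h + (-P.other.mass μ ^ 2 / 2) * P.dirSign_sq

/-- The radial derivative of the Hamiltonian, multiplied by the radius, in terms of the position
`y` relative to the primary `P` and of the momentum `p`. -/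
def radialDeriv (μ : ℝ) (P : Primary) (y p : R2) : ℝ :=
  P.mass μ / ‖y‖ + P.other.mass μ * ⟪y, y + P.pos μ - P.other.pos μ⟫ /
    ‖y + P.pos μ - P.other.pos μ‖ ^ 3 + (y 0 * p 1 - y 1 * p 0)

lemma inner_R2 (x y : R2) : ⟪x, y⟫ = x 0 * y 0 + x 1 * y 1 := by
  simp only [PiLp.inner_apply, Fin.sum_univ_two, RCLike.inner_apply, conj_trivial]
  ring

/-- Written in terms of the velocity instead of the momentum, the part of the derivative that is not
the force is a determinant of y with the velocity, which Cauchy-Schwarz controls. -/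
lemma radialDeriv_eq (μ : ℝ) (P : Primary) {y : R2} (hy : y ≠ 0) (p : R2) :
    radialDeriv μ P y p = ‖y‖ * effForce (P.other.mass μ) ‖y‖ (polarCos P y)
      + (y 0 * (p 1 + (y + P.pos μ) 0) - y 1 * (p 0 - (y + P.pos μ) 1)) := by
  have h := norm_mul_polarCos P hy
  have hn := norm_ne_zero_iff.2 hy
  have hi : ⟪y, y + P.pos μ - P.other.pos μ⟫ = ‖y‖ * (‖y‖ - polarCos P y) := by
    rw [mul_sub, h, ← sq, sq_norm_R2, inner_R2]
    simp only [PiLp.sub_apply, PiLp.add_apply, Primary.other_pos_zero, Primary.pos_one]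
    ring
  have e1 : ‖y‖ * effForce (P.other.mass μ) ‖y‖ (polarCos P y) =
      -‖y‖ ^ 2 + P.other.mass μ * (‖y‖ * polarCos P y) + (1 - P.other.mass μ) / ‖y‖
        + P.other.mass μ * (‖y‖ * (‖y‖ - polarCos P y)) / polarDist ‖y‖ (polarCos P y) ^ 3 := by
    rw [effForce]
    field_simp
  rw [radialDeriv, hi, e1, norm_sub_other_pos μ P hy, P.mass_eq μ, sq_norm_R2, h]
  simp only [PiLp.add_apply, Primary.pos_zero, Primary.pos_one]
  ring

/-- Below the energy of the saddle, the energy surface is radially transverse inside of it. -/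
lemma radialDeriv_pos {μ c ρ : ℝ} (h0 : 0 < μ) (h1 : μ < 1) (P : Primary) (hρ1 : ρ < 1)
    (hρ : ∀ r, 0 < r → r < ρ → 0 < effForce (P.other.mass μ) r 1)
    (hc : c < effPot (P.other.mass μ) ρ 1) {y p : R2} (hy : y ≠ 0) (hyρ : ‖y‖ < ρ)
    (hH : hamiltonian μ (y + P.pos μ, p) = c) : 0 < radialDeriv μ P y p := by
  have hm := P.other.mass_pos h0 h1
  have hm1 : P.other.mass μ < 1 := by
    have := P.mass_pos h0 h1
    rw [P.mass_eq] at this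
    linarith
  have hs := abs_le.1 (abs_polarCos_le P hy)
  have hn := norm_pos_iff.2 hy
  obtain ⟨hF, hF2⟩ := effForce_pos_and_sq_gt hm hm1 hρ1 hρ hc hn hyρ hs.1 hs.2
  rw [radialDeriv_eq μ P hy]
  rw [hamiltonian_eq_effPot μ P hy] at hH
  set F := effForce (P.other.mass μ) ‖y‖ (polarCos P y)
  set a := p 0 - (y + P.pos μ) 1
  set b := p 1 + (y + P.pos μ) 0
  have hab : a ^ 2 + b ^ 2 < F ^ 2 := by linarith
  -- The determinant of y and (a, b) is at most ‖y‖ |(a, b)| by Lagrange's identity, and |(a, b)| <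
  -- F by the energy bound. The force term ‖y‖ F therefore dominates.
  have hsq := sq_norm_R2 y
  have hcs : (y 0 * b - y 1 * a) ^ 2 < (‖y‖ * F) ^ 2 := by
    have h2 : 0 < ‖y‖ ^ 2 := by positivity
    nlinarith [sq_nonneg (y 0 * a + y 1 * b), mul_lt_mul_of_pos_left hab h2]
  have := (abs_lt.1 (abs_lt_of_sq_lt_sq hcs (by positivity))).1
  linarith

/-! ### The saddle as a critical point and its circle as a barrier. -/

lemma hasFDerivAt_inv_norm_sub {F : Type*} [NormedAddCommGroup F] [InnerProductSpace ℝ F] {a x : F}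
    (h : x - a ≠ 0) : HasFDerivAt (fun x => ‖x - a‖⁻¹) (-(‖x - a‖ ^ 3)⁻¹ • innerSL ℝ (x - a)) x := by
  have hn := norm_ne_zero_iff.2 h
  have h1 := (((hasFDerivAt_id (𝕜 := ℝ) x).sub_const a).norm_sq).sqrt (by simpa using h)
  have h2 := (hasDerivAt_inv (by simpa using h)).comp_hasFDerivAt x h1
  have h3 : (fun x => ‖x - a‖⁻¹) = (fun x => x⁻¹) ∘ fun x => √(‖id x - a‖ ^ 2) := by
    ext x
    simp [Real.sqrt_sq]
  rw [h3]
  refine h2.congr_fderiv ?_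
  ext v
  simp only [id_eq, Real.sqrt_sq (norm_nonneg _), smul_apply, smul_eq_mul,
    ContinuousLinearMap.comp_apply, ContinuousLinearMap.id_apply, nsmul_eq_mul, Nat.cast_ofNat,
    innerSL_apply_apply]
  field_simp

/-- The saddle is a critical point of the Hamiltonian. -/
lemma hasFDerivAt_hamiltonian_saddle {μ : ℝ} (P : Primary) {ρ : ℝ} (hρ0 : 0 < ρ) (hρ1 : ρ < 1)
    (hρ : effForce (P.other.mass μ) ρ 1 = 0) {q : R2}
    (hq : q = !₂[P.dirSign * ρ, 0] + P.pos μ) :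
    HasFDerivAt (hamiltonian μ) (0 : R2 × R2 →L[ℝ] ℝ) (q, !₂[0, -q 0]) := by
  have q0 : q 0 - P.pos μ 0 = P.dirSign * ρ := by rw [hq]; simp
  have q1 : q 1 = 0 := by rw [hq]; simp [Primary.pos_one]
  have q0' : q 0 - P.other.pos μ 0 = -(P.dirSign * (1 - ρ)) := by
    rw [Primary.other_pos_zero]
    linarith
  have nP : ‖q - P.pos μ‖ = ρ := by
    rw [← sq_eq_sq₀ (norm_nonneg _) hρ0.le, sq_norm_R2]
    simp only [PiLp.sub_apply, q0, q1, Primary.pos_one]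
    linear_combination ρ ^ 2 * P.dirSign_sq
  have nO : ‖q - P.other.pos μ‖ = 1 - ρ := by
    rw [← sq_eq_sq₀ (norm_nonneg _) (by linarith), sq_norm_R2]
    simp only [PiLp.sub_apply, q0', q1, Primary.pos_one]
    linear_combination (1 - ρ) ^ 2 * P.dirSign_sq
  have hP : q - P.pos μ ≠ 0 := norm_ne_zero_iff.1 (by rw [nP]; exact hρ0.ne')
  have hO : q - P.other.pos μ ≠ 0 := norm_ne_zero_iff.1 (by rw [nO]; linarith)
  -- The saddle lies on the axis, and this momentum makes the velocity vanish; only the axial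
  -- derivative of the potential remains, and it is the force.
  set z : R2 × R2 := (q, !₂[0, -q 0]) with hz
  have hf : hamiltonian μ = fun z => (1 / 2) * ‖z.2‖ ^ 2 - P.mass μ * ‖z.1 - P.pos μ‖⁻¹
      - P.other.mass μ * ‖z.1 - P.other.pos μ‖⁻¹ + (z.1 0 * z.2 1 - z.1 1 * z.2 0) := by
    ext z
    rw [hamiltonian_eq μ P, div_eq_mul_inv (P.mass μ), div_eq_mul_inv (P.other.mass μ)]
  have h1 : ∀ i : Fin 2, HasFDerivAt (fun z : R2 × R2 => z.1 i)
      ((EuclideanSpace.proj i : R2 →L[ℝ] ℝ).comp (ContinuousLinearMap.fst ℝ R2 R2)) z := fun i =>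
    ((EuclideanSpace.proj i : R2 →L[ℝ] ℝ).comp (ContinuousLinearMap.fst ℝ R2 R2)).hasFDerivAt
  have h2 : ∀ i : Fin 2, HasFDerivAt (fun z : R2 × R2 => z.2 i)
      ((EuclideanSpace.proj i : R2 →L[ℝ] ℝ).comp (ContinuousLinearMap.snd ℝ R2 R2)) z := fun i =>
    ((EuclideanSpace.proj i : R2 →L[ℝ] ℝ).comp (ContinuousLinearMap.snd ℝ R2 R2)).hasFDerivAt
  have h3 : HasFDerivAt (fun z : R2 × R2 => ‖z.1 - P.pos μ‖⁻¹) _ z :=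
    HasFDerivAt.comp (g := fun x => ‖x - P.pos μ‖⁻¹) z (hasFDerivAt_inv_norm_sub hP) hasFDerivAt_fst
  have h4 : HasFDerivAt (fun z : R2 × R2 => ‖z.1 - P.other.pos μ‖⁻¹) _ z :=
    HasFDerivAt.comp (g := fun x => ‖x - P.other.pos μ‖⁻¹) z (hasFDerivAt_inv_norm_sub hO)
      hasFDerivAt_fst
  have h5 : HasFDerivAt (fun z : R2 × R2 => ‖z.2‖ ^ 2) _ z := (hasFDerivAt_snd (p := z)).norm_sq
  rw [hf]
  refine ((((h5.const_mul (1 / 2)).sub (h3.const_mul (P.mass μ))).sub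
    (h4.const_mul (P.other.mass μ))).add (((h1 0).mul (h2 1)).sub ((h1 1).mul (h2 0)))).congr_fderiv ?_
  rw [effForce, polarDist_one hρ1] at hρ
  refine ContinuousLinearMap.ext fun v => ?_
  simp only [hz, nP, nO, q0, q0', q1, inner_R2, Primary.pos_one, P.mass_eq μ,
    add_apply, sub_apply, smul_apply,
    ContinuousLinearMap.comp_apply, innerSL_apply_apply, smul_eq_mul, nsmul_eq_mul,
    ContinuousLinearMap.coe_fst', ContinuousLinearMap.coe_snd', PiLp.proj_apply,
    PiLp.sub_apply, zero_apply, Matrix.cons_val_zero, Matrix.cons_val_one]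
  have hb : (1 - ρ) ≠ 0 := by linarith
  have hρ' : -ρ + P.other.mass μ + (1 - P.other.mass μ) * ((ρ ^ 3)⁻¹ * ρ)
      - P.other.mass μ * (((1 - ρ) ^ 3)⁻¹ * (1 - ρ)) = 0 := by
    rw [← hρ, show ρ - 1 = -(1 - ρ) by ring]
    field_simp
    ring
  rw [Primary.pos_zero] at q0
  push_cast
  linear_combination (P.dirSign * v.1 0) * hρ' - v.1 0 * q0

/-- The saddle is a point of the configuration space of energy `effPot _ ρ 1`. -/
lemma lt_effPot_saddle {μ c : ℝ} (hc : IsBelowFirstCriticalValue μ c) (P : Primary) {ρ : ℝ}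
    (hρ0 : 0 < ρ) (hρ1 : ρ < 1) (hρ : effForce (P.other.mass μ) ρ 1 = 0) :
    c < effPot (P.other.mass μ) ρ 1 := by
  set y : R2 := !₂[P.dirSign * ρ, 0] with hy
  have hn : ‖y‖ = ρ := by
    rw [← sq_eq_sq₀ (norm_nonneg _) hρ0.le, sq_norm_R2]
    simp only [hy, Matrix.cons_val_zero, Matrix.cons_val_one]
    linear_combination ρ ^ 2 * P.dirSign_sq
  have hy0 : y ≠ 0 := norm_ne_zero_iff.1 (by rw [hn]; exact hρ0.ne')
  have hcos : polarCos P y = 1 := by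
    rw [polarCos, hn, div_eq_one_iff_eq hρ0.ne']
    simp only [hy, Matrix.cons_val_zero]
    linear_combination ρ * P.dirSign_sq
  have hO : ‖y + P.pos μ - P.other.pos μ‖ = 1 - ρ := by
    rw [norm_sub_other_pos μ P hy0, hn, hcos, polarDist_one hρ1]
  have hcfg : y + P.pos μ ∈ configSpace μ := by
    intro P' h
    have hcase : P' = P ∨ P' = P.other := by cases P <;> cases P' <;> simp [Primary.other]
    rcases hcase with rfl | rfl
    · simp [hy0] at h
    · rw [h, sub_self, norm_zero] at hO
      linarith
  have h := hc (y + P.pos μ, !₂[0, -(y + P.pos μ) 0]) hcfg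
    (hasFDerivAt_hamiltonian_saddle P hρ0 hρ1 hρ rfl)
  rw [hamiltonian_eq_effPot μ P hy0, hn, hcos] at h
  have e : (y + P.pos μ) 1 = 0 := by simp [hy, Primary.pos_one]
  simp only [Matrix.cons_val_zero, Matrix.cons_val_one, e] at h
  linarith

/-- Below the energy of the saddle, the component of the Hill's region at a primary lies inside of
the circle through the saddle. -/
lemma norm_lt_of_mem_hillComponent {μ c ρ : ℝ} (h0 : 0 < μ) (h1 : μ < 1) (P : Primary)
    (hρ0 : 0 < ρ) (hρ1 : ρ < 1) (hc : c < effPot (P.other.mass μ) ρ 1) {q : R2}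
    (hq : q ∈ hillComponent μ c P) : ‖q - P.pos μ‖ < ρ := by
  obtain ⟨hqR, hcl⟩ := hq
  by_contra! hge
  set C := connectedComponentIn (hillRegion μ c) q
  obtain ⟨q', hq', hd⟩ := Metric.mem_closure_iff.1 hcl ρ hρ0
  have hpre : IsPreconnected C := isPreconnected_connectedComponentIn
  have hlt : ‖q' - P.pos μ‖ ≤ ρ := by
    rw [dist_comm, dist_eq_norm] at hd
    exact hd.le
  -- The component comes close to the primary, so if it also left the disc it would meet the circle
  -- of radius ρ. There the effective potential exceeds c, which leaves negative kinetic energy.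
  obtain ⟨w, hw, hwρ⟩ := hpre.intermediate_value hq' (mem_connectedComponentIn hqR)
    (f := fun q => ‖q - P.pos μ‖) (by fun_prop) ⟨hlt, hge⟩
  obtain ⟨⟨w', p⟩, ⟨-, hH⟩, rfl⟩ := connectedComponentIn_subset _ _ hw
  simp only at hwρ
  have hy : w' - P.pos μ ≠ 0 := norm_ne_zero_iff.1 (by rw [hwρ]; exact hρ0.ne')
  have hH' := hamiltonian_eq_effPot μ P hy p
  rw [sub_add_cancel, hH, hwρ] at hH'
  have hs := abs_le.1 (abs_polarCos_le P hy)
  have := effPot_one_le (P.other.mass_pos h0 h1).le hρ0 hρ1 hs.1 hs.2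
  nlinarith [sq_nonneg (p 0 - w' 1), sq_nonneg (p 1 + w' 0)]

/-- Below the first critical value, the energy surface over the component of the Hill's region at
a primary is radially transverse. -/
theorem radialDeriv_pos_of_mem_hillComponent {μ c : ℝ} (h0 : 0 < μ) (h1 : μ < 1)
    (hc : IsBelowFirstCriticalValue μ c) (P : Primary) {y p : R2} (hy : y ≠ 0)
    (hq : y + P.pos μ ∈ hillComponent μ c P) (hH : hamiltonian μ (y + P.pos μ, p) = c) :
    0 < radialDeriv μ P y p := by
  have hm1 : P.other.mass μ < 1 := by
    have := P.mass_pos h0 h1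
    rw [P.mass_eq] at this
    linarith
  obtain ⟨ρ, hρ0, hρ1, hρz, hρ⟩ := exists_saddle (P.other.mass_pos h0 h1) hm1
  have hc' := lt_effPot_saddle hc P hρ0 hρ1 hρz
  have hyρ := norm_lt_of_mem_hillComponent h0 h1 P hρ0 hρ1 hc' hq
  rw [add_sub_cancel_right] at hyρ
  exact radialDeriv_pos h0 h1 P hρ1 hρ hc' hy hyρ hH

end ThreeBody

/-! ## The anti-symplectic involution -/

namespace ThreeBody

/-- The reflection `ρ` as a linear isometry. -/
def reflectL : R3 ≃ₗᵢ[ℝ] R3 where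
  toFun := reflect
  invFun := reflect
  map_add' x y := by
    ext i
    fin_cases i <;> simp [reflect]
    ring
  map_smul' a x := by
    ext i
    fin_cases i <;> simp [reflect]
  left_inv x := by
    ext i
    fin_cases i <;> simp [reflect]
  right_inv x := by
    ext i
    fin_cases i <;> simp [reflect]
  norm_map' x := by
    rw [← sq_eq_sq₀ (norm_nonneg _) (norm_nonneg _), EuclideanSpace.real_norm_sq_eq,
      EuclideanSpace.real_norm_sq_eq]
    simp [Fin.sum_univ_three, reflect]

lemma reflectL_apply (x : R3) : reflectL x = reflect x := rfl

lemma reflect_reflect (x : R3) : reflect (reflect x) = x := reflectL.left_inv x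

lemma inner_reflect (x y : R3) : ⟪reflect x, reflect y⟫ = ⟪x, y⟫ := reflectL.inner_map_map x y

lemma norm_reflect (x : R3) : ‖reflect x‖ = ‖x‖ := reflectL.norm_map x

/-- The involution `𝓡` as a continuous linear map. -/
def involutionL : R3 × R3 →L[ℝ] R3 × R3 :=
  (reflectL.toContinuousLinearEquiv : R3 →L[ℝ] R3).prodMap
    (-(reflectL.toContinuousLinearEquiv : R3 →L[ℝ] R3))

lemma involutionL_apply (z : R3 × R3) : involutionL z = involution z := rfl

lemma involution_involution (z : R3 × R3) : involution (involution z) = z := by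
  have h : reflect (-reflect z.2) = -z.2 := by
    rw [← reflectL_apply, map_neg, reflectL_apply, reflect_reflect]
  simp only [involution, reflect_reflect, h, neg_neg]

lemma cotForm_involution (u v : R3 × R3) :
    cotForm (involution u) (involution v) = -cotForm u v := by
  simp only [cotForm_apply, involution, inner_neg_left, inner_neg_right, inner_reflect]
  ring

lemma gradient_comp_isometry (L : R3 ≃ₗᵢ[ℝ] R3) (f : R3 → ℝ) (x : R3) :
    gradient (fun y => f (L y)) x = L.symm (gradient f (L x)) := by
  have h : fderiv ℝ (fun y => f (L y)) x =
      (fderiv ℝ f (L x)).comp (L.toContinuousLinearEquiv : R3 →L[ℝ] R3) :=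
    L.toContinuousLinearEquiv.comp_right_fderiv
  refine ext_inner_right ℝ fun v => ?_
  rw [inner_gradient_left, h, ← L.inner_map_map, L.apply_symm_apply, inner_gradient_left]
  rfl

lemma gradBase_involution {Q : R3 × R3 → ℝ} (hQ : ∀ z, Q (involution z) = Q z) (z : R3 × R3) :
    gradBase Q (involution z) = reflect (gradBase Q z) := by
  have h : (fun ξ => Q (ξ, (involution z).2)) = fun ξ => Q (reflectL ξ, z.2) := by
    ext ξ
    rw [← hQ]
    simp only [involution, ← reflectL_apply, map_neg]
    simp only [reflectL_apply, reflect_reflect, neg_neg]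
  rw [gradBase, h, gradient_comp_isometry reflectL (fun ξ => Q (ξ, z.2))]
  have : reflectL (involution z).1 = z.1 := reflect_reflect z.1
  rw [this]
  rfl

lemma gradFibre_involution {Q : R3 × R3 → ℝ} (hQ : ∀ z, Q (involution z) = Q z) (z : R3 × R3) :
    gradFibre Q (involution z) = -reflect (gradFibre Q z) := by
  have h : (fun η => Q ((involution z).1, η)) =
      fun η => Q (z.1, (reflectL.trans (LinearIsometryEquiv.neg ℝ)) η) := by
    ext η
    rw [← hQ]
    simp only [involution, LinearIsometryEquiv.trans_apply, LinearIsometryEquiv.coe_neg,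
      reflectL_apply, reflect_reflect]
  rw [gradFibre, h, gradient_comp_isometry _ (fun η => Q (z.1, η))]
  have : (reflectL.trans (LinearIsometryEquiv.neg ℝ)) (involution z).2 = z.2 := by
    simp only [involution, LinearIsometryEquiv.trans_apply, LinearIsometryEquiv.coe_neg, map_neg,
      reflectL_apply, reflect_reflect, neg_neg]
  rw [this]
  simp only [LinearIsometryEquiv.symm_trans, LinearIsometryEquiv.trans_apply,
    LinearIsometryEquiv.symm_neg, LinearIsometryEquiv.coe_neg, map_neg]
  rfl

lemma reflect_neg (x : R3) : reflect (-x) = -reflect x := map_neg reflectL x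

lemma reflect_add (x y : R3) : reflect (x + y) = reflect x + reflect y := map_add reflectL x y

lemma reflect_sub (x y : R3) : reflect (x - y) = reflect x - reflect y := map_sub reflectL x y

lemma reflect_smul (a : ℝ) (x : R3) : reflect (a • x) = a • reflect x := map_smul reflectL a x

/-- The Hamiltonian field of an invariant function is reversed by the involution. -/
lemma hamField_involution {Q : R3 × R3 → ℝ} (hQ : ∀ z, Q (involution z) = Q z) (z : R3 × R3) :
    hamField Q (involution z) = -involution (hamField Q z) := by
  simp only [hamField, gradBase_involution hQ, gradFibre_involution hQ]
  simp only [involution, inner_neg_left, inner_neg_right, inner_reflect, reflect_sub, reflect_add,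
    reflect_smul, reflect_neg, Prod.neg_mk]
  congr 1
  · module
  · module

/-- The reflection ρ reverses orientation, so ρξ × ρη = -ρ(ξ × η); the minus sign in 𝓡η = -ρη
compensates. -/
lemma crossUnit_involution (z : R3 × R3) :
    crossUnit (involution z) = reflect (crossUnit z) := by
  have h : (WithLp.toLp 2 ((involution z).1.ofLp ⨯₃ (involution z).2.ofLp) : R3) =
      reflect (WithLp.toLp 2 (z.1.ofLp ⨯₃ z.2.ofLp)) := by
    ext i
    fin_cases i <;> simp [involution, reflect, cross_apply]
    ring
  rw [crossUnit, h, norm_reflect, crossUnit, reflect_smul]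

lemma frameHor_involution {Q : R3 × R3 → ℝ} (hQ : ∀ z, Q (involution z) = Q z) (z : R3 × R3) :
    frameHor Q (involution z) = involution (frameHor Q z) := by
  simp only [frameHor, gradBase_involution hQ, gradFibre_involution hQ, crossUnit_involution]
  simp only [involution, inner_neg_left, inner_neg_right, inner_reflect, reflect_smul, neg_neg,
    smul_neg]

lemma frameVert_involution {Q : R3 × R3 → ℝ} (hQ : ∀ z, Q (involution z) = Q z) (z : R3 × R3) :
    frameVert Q (involution z) = -involution (frameVert Q z) := by
  have h0 : reflect 0 = 0 := map_zero reflectL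
  simp only [frameVert, gradFibre_involution hQ, crossUnit_involution]
  simp only [involution, inner_neg_left, inner_neg_right, inner_reflect, reflect_smul, neg_neg,
    smul_neg, reflect_sub, h0, Prod.neg_mk, neg_zero, neg_div, neg_smul]

/-- The trivialization conjugates the involution to the reflection in `planeV`. -/
lemma triv_involution {Q : R3 × R3 → ℝ} (hQ : ∀ z, Q (involution z) = Q z) (z v : R3 × R3) :
    triv Q (involution z) (involution v) = ((triv Q z v).1, -(triv Q z v).2) := by
  simp only [triv_apply, frameHor_involution hQ, frameVert_involution hQ, map_neg,
    cotForm_involution, neg_neg]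

/-! ### Invariance of the regularized surface -/

/-- The reflection `(a, b) ↦ (a, -b)` of the plane. -/
def reflectPlane (q : R2) : R2 := !₂[q 0, -q 1]

lemma continuous_reflectPlane : Continuous reflectPlane := by
  unfold reflectPlane
  fun_prop

lemma reflectPlane_reflectPlane (q : R2) : reflectPlane (reflectPlane q) = q := by
  ext i
  fin_cases i <;> simp [reflectPlane]

lemma reflectPlane_pos (μ : ℝ) (P : Primary) : reflectPlane (P.pos μ) = P.pos μ := by
  ext i
  fin_cases i <;> simp [reflectPlane, Primary.pos_one]

lemma norm_reflectPlane (q : R2) : ‖reflectPlane q‖ = ‖q‖ := by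
  rw [← sq_eq_sq₀ (norm_nonneg _) (norm_nonneg _), sq_norm_R2, sq_norm_R2]
  simp [reflectPlane]

lemma norm_reflectPlane_sub_pos (μ : ℝ) (P : Primary) (q : R2) :
    ‖reflectPlane q - P.pos μ‖ = ‖q - P.pos μ‖ := by
  rw [← norm_reflectPlane (q - P.pos μ)]
  congr 1
  ext i
  fin_cases i <;> simp [reflectPlane, Primary.pos_one]

lemma hamiltonian_reflect (μ : ℝ) (q p : R2) :
    hamiltonian μ (reflectPlane q, -reflectPlane p) = hamiltonian μ (q, p) := by
  simp only [hamiltonian, norm_reflectPlane_sub_pos, norm_neg, norm_reflectPlane]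
  simp [reflectPlane]

lemma mem_energySurface_reflect {μ c : ℝ} {q p : R2} (h : (q, p) ∈ energySurface μ c) :
    (reflectPlane q, -reflectPlane p) ∈ energySurface μ c := by
  refine ⟨fun P hP => h.1 P ?_, by rw [hamiltonian_reflect, h.2]⟩
  rw [← reflectPlane_reflectPlane q]
  simp only at hP
  rw [hP, reflectPlane_pos]

lemma reflectPlane_mem_hillRegion {μ c : ℝ} {q : R2} (h : q ∈ hillRegion μ c) :
    reflectPlane q ∈ hillRegion μ c := by
  obtain ⟨⟨q, p⟩, hz, rfl⟩ := h
  exact ⟨_, mem_energySurface_reflect hz, rfl⟩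

/-- The reflection is continuous, preserves the Hill's region and fixes the primary. It carries
connected components into connected components and respects closures. -/
lemma reflectPlane_mem_hillComponent {μ c : ℝ} {P : Primary} {q : R2}
    (h : q ∈ hillComponent μ c P) : reflectPlane q ∈ hillComponent μ c P := by
  refine ⟨reflectPlane_mem_hillRegion h.1, ?_⟩
  have h1 : reflectPlane '' connectedComponentIn (hillRegion μ c) q ⊆
      connectedComponentIn (hillRegion μ c) (reflectPlane q) := by
    refine (isPreconnected_connectedComponentIn.image _
      continuous_reflectPlane.continuousOn).subset_connectedComponentIn
      ⟨q, mem_connectedComponentIn h.1, rfl⟩ ?_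
    rintro _ ⟨w, hw, rfl⟩
    exact reflectPlane_mem_hillRegion (connectedComponentIn_subset _ _ hw)
  refine closure_mono h1 ?_
  rw [← reflectPlane_pos μ P]
  exact image_closure_subset_closure_image continuous_reflectPlane ⟨_, h.2, rfl⟩

lemma stereoY_involution (z : R3 × R3) : stereoY (involution z) = reflectPlane (stereoY z) := by
  ext i
  fin_cases i <;> simp [stereoY, involution, reflect, reflectPlane]
  ring

lemma stereoX_involution (z : R3 × R3) : stereoX (involution z) = -reflectPlane (stereoX z) := by
  ext i
  fin_cases i <;> simp [stereoX, involution, reflect, reflectPlane, neg_div]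

lemma reflectPlane_add_pos (μ : ℝ) (P : Primary) (y : R2) :
    reflectPlane y + P.pos μ = reflectPlane (y + P.pos μ) := by
  ext i
  fin_cases i <;> simp [reflectPlane, Primary.pos_one]

lemma unregularize_involution (μ : ℝ) (P : Primary) (z : R3 × R3) :
    unregularize μ P (involution z) =
      (reflectPlane (unregularize μ P z).1, -reflectPlane (unregularize μ P z).2) := by
  rw [unregularize, stereoY_involution, stereoX_involution, reflectPlane_add_pos]
  congr 1
  ext i
  fin_cases i <;> simp [unregularize, reflectPlane]

lemma involution_mem_cotSphere {z : R3 × R3} (h : z ∈ cotSphere) : involution z ∈ cotSphere := by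
  have h2 : ⟪z.1, z.2⟫ = 0 := h.2
  exact ⟨(norm_reflect z.1).trans h.1, by simp [involution, inner_reflect, h2]⟩

lemma involution_mem_regSurface {μ c : ℝ} {P : Primary} {z : R3 × R3}
    (h : z ∈ regSurface μ c P) : involution z ∈ regSurface μ c P := by
  refine ⟨involution_mem_cotSphere h.1, ?_⟩
  have h0 : (involution z).1 0 = z.1 0 := by simp [involution, reflect]
  rw [h0, unregularize_involution]
  rcases h.2 with ⟨h1, h2, h3⟩ | ⟨h1, h2⟩
  · exact Or.inl ⟨h1, mem_energySurface_reflect h2, reflectPlane_mem_hillComponent h3⟩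
  · refine Or.inr ⟨h1, ?_⟩
    rw [← h2]
    simp only [involution, norm_neg, norm_reflect]

lemma regHamiltonian_involution (μ c : ℝ) (P : Primary) (z : R3 × R3) :
    regHamiltonian μ c P (involution z) = regHamiltonian μ c P z := by
  have h0 : ‖(involution z).2‖ = ‖z.2‖ := by simp only [involution, norm_neg, norm_reflect]
  have h1 : ‖stereoY (involution z) + P.pos μ - P.other.pos μ‖ =
      ‖stereoY z + P.pos μ - P.other.pos μ‖ := by
    rw [stereoY_involution, reflectPlane_add_pos, norm_reflectPlane_sub_pos]
  have h2 : regFactor μ c P (involution z) = regFactor μ c P z := by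
    rw [regFactor, regFactor, h1, stereoY_involution, reflectPlane_add_pos]
    simp [involution, reflect, reflectPlane]
    ring
  rw [regHamiltonian, regHamiltonian, h0, h2]

end ThreeBody

/-! ## Smoothness and fibrewise star-shapedness of the regularized surface -/

namespace ThreeBody

lemma contDiff_stereoY {n : WithTop ℕ∞} : ContDiff ℝ n stereoY := by
  rw [contDiff_euclidean]
  intro i
  fin_cases i <;> simp only [stereoY] <;> simp <;> fun_prop

lemma contDiffAt_regFactor {n : WithTop ℕ∞} {μ c : ℝ} {P : Primary} {z : R3 × R3}
    (h : stereoY z + P.pos μ - P.other.pos μ ≠ 0) : ContDiffAt ℝ n (regFactor μ c P) z := by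
  have hY : ContDiffAt ℝ n stereoY z := contDiff_stereoY.contDiffAt
  have hN : ContDiffAt ℝ n (fun z => ‖stereoY z + P.pos μ - P.other.pos μ‖) z :=
    ((hY.add contDiffAt_const).sub contDiffAt_const).norm ℝ h
  have hq : ∀ i, ContDiffAt ℝ n (fun z => (stereoY z + P.pos μ) i) z := fun i =>
    contDiffAt_euclidean.1 (hY.add contDiffAt_const) i
  have h1 : ∀ i, ContDiffAt ℝ n (fun z : R3 × R3 => z.1 i) z := fun i => by fun_prop
  unfold regFactor
  refine ContDiffAt.add (ContDiffAt.sub ((contDiffAt_const.add (h1 0)).div_const 2)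
    ((contDiffAt_const.sub (h1 0)).mul (contDiffAt_const.add
      (contDiffAt_const.div hN (norm_ne_zero_iff.2 h))))) (((hq 1).mul (h1 1)).sub ((hq 0).mul (h1 2)))

lemma contDiffAt_regHamiltonian {n : WithTop ℕ∞} {μ c : ℝ} {P : Primary} {z : R3 × R3}
    (h : stereoY z + P.pos μ - P.other.pos μ ≠ 0) : ContDiffAt ℝ n (regHamiltonian μ c P) z := by
  have h1 : ContDiffAt ℝ n (fun z : R3 × R3 => ‖z.2‖ ^ 2) z := contDiffAt_snd.norm_sq ℝ
  unfold regHamiltonian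
  exact (contDiffAt_const.mul h1).mul ((contDiffAt_regFactor h).pow 2)

/-- The gradient is the Riesz dual of the restricted derivative wherever Q is differentiable, which
is the case near z. -/
lemma contDiffAt_gradBase {Q : R3 × R3 → ℝ} {z : R3 × R3} {n m : WithTop ℕ∞}
    (hQ : ContDiffAt ℝ n Q z) (hmn : m + 1 ≤ n) : ContDiffAt ℝ m (gradBase Q) z := by
  have h1 : ContDiffAt ℝ m (fun z => (InnerProductSpace.toDual ℝ R3).symm
      ((fderiv ℝ Q z).comp (ContinuousLinearMap.inl ℝ R3 R3))) z :=
    (InnerProductSpace.toDual ℝ R3).symm.contDiff.contDiffAt.comp z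
      ((hQ.fderiv_right hmn).clm_comp contDiffAt_const)
  refine h1.congr_of_eventuallyEq ?_
  have h2 : ContDiffAt ℝ 1 Q z := hQ.of_le (le_trans (by simp) hmn)
  filter_upwards [h2.eventually (by simp)] with w hw
  refine ext_inner_right ℝ fun v => ?_
  rw [inner_gradBase (hw.differentiableAt (by simp)), InnerProductSpace.toDual_symm_apply]
  simp

lemma contDiffAt_gradFibre {Q : R3 × R3 → ℝ} {z : R3 × R3} {n m : WithTop ℕ∞}
    (hQ : ContDiffAt ℝ n Q z) (hmn : m + 1 ≤ n) : ContDiffAt ℝ m (gradFibre Q) z := by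
  have h1 : ContDiffAt ℝ m (fun z => (InnerProductSpace.toDual ℝ R3).symm
      ((fderiv ℝ Q z).comp (ContinuousLinearMap.inr ℝ R3 R3))) z :=
    (InnerProductSpace.toDual ℝ R3).symm.contDiff.contDiffAt.comp z
      ((hQ.fderiv_right hmn).clm_comp contDiffAt_const)
  refine h1.congr_of_eventuallyEq ?_
  have h2 : ContDiffAt ℝ 1 Q z := hQ.of_le (le_trans (by simp) hmn)
  filter_upwards [h2.eventually (by simp)] with w hw
  refine ext_inner_right ℝ fun v => ?_
  rw [inner_gradFibre (hw.differentiableAt (by simp)), InnerProductSpace.toDual_symm_apply]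
  simp

lemma contDiffAt_hamField {Q : R3 × R3 → ℝ} {z : R3 × R3} {n m : WithTop ℕ∞}
    (hQ : ContDiffAt ℝ n Q z) (hmn : m + 1 ≤ n) : ContDiffAt ℝ m (hamField Q) z := by
  have hB := contDiffAt_gradBase hQ hmn
  have hF := contDiffAt_gradFibre hQ hmn
  have h1 : ContDiffAt ℝ m (fun z : R3 × R3 => z.1) z := contDiffAt_fst
  have h2 : ContDiffAt ℝ m (fun z : R3 × R3 => z.2) z := contDiffAt_snd
  unfold hamField
  exact (hF.sub ((h1.inner ℝ hF).smul h1)).prodMk ((hB.neg.add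
    (((h1.inner ℝ hB).sub (h2.inner ℝ hF)).smul h1)).add ((h1.inner ℝ hF).smul h2))

/-! ### Points of the regularized surface -/

lemma sum_sq_of_mem_cotSphere {z : R3 × R3} (hz : z ∈ cotSphere) :
    z.1 0 ^ 2 + z.1 1 ^ 2 + z.1 2 ^ 2 = 1 := by
  have := EuclideanSpace.real_norm_sq_eq z.1
  rw [hz.1, Fin.sum_univ_three] at this
  linarith

lemma collision_coords {z : R3 × R3} (hz : z ∈ cotSphere) (h : z.1 0 = 1) :
    z.1 1 = 0 ∧ z.1 2 = 0 := by
  have := sum_sq_of_mem_cotSphere hz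
  rw [h] at this
  constructor <;> nlinarith [sq_nonneg (z.1 1), sq_nonneg (z.1 2)]

lemma stereoY_collision {z : R3 × R3} (hz : z ∈ cotSphere) (h : z.1 0 = 1) : stereoY z = 0 := by
  obtain ⟨h1, h2⟩ := collision_coords hz h
  ext i
  fin_cases i <;> simp [stereoY, h, h1, h2]

lemma Primary.pos_ne_other_pos (μ : ℝ) (P : Primary) : P.pos μ - P.other.pos μ ≠ 0 := by
  intro h
  have h1 := congrArg (fun q : R2 => q 0) h
  simp only [PiLp.sub_apply, P.other_pos_zero, PiLp.zero_apply] at h1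
  have h2 := P.dirSign_sq
  have h3 : P.dirSign = 0 := by linarith
  rw [h3] at h2
  norm_num at h2

lemma regular_of_mem_regSurface {μ c : ℝ} {P : Primary} {z : R3 × R3}
    (hz : z ∈ regSurface μ c P) : stereoY z + P.pos μ - P.other.pos μ ≠ 0 := by
  obtain ⟨hT, ⟨-, ⟨hq, -⟩, -⟩ | ⟨h0, -⟩⟩ := hz
  · exact sub_ne_zero.2 (hq P.other)
  · rw [stereoY_collision hT h0, zero_add]
    exact P.pos_ne_other_pos μ

lemma stereoY_ne_zero {μ c : ℝ} {P : Primary} {z : R3 × R3}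
    (hq : unregularize μ P z ∈ energySurface μ c) : stereoY z ≠ 0 := by
  intro h
  apply hq.1 P
  simp [unregularize, h]

lemma snd_ne_zero_of_mem_regSurface {μ c : ℝ} (hμ0 : 0 < μ) (hμ1 : μ < 1) {P : Primary}
    {z : R3 × R3} (hz : z ∈ regSurface μ c P) : z.2 ≠ 0 := by
  obtain ⟨hT, ⟨h0, hq, -⟩ | ⟨h0, hη⟩⟩ := hz
  · intro h
    have := norm_stereoY hT h0
    rw [h, norm_zero, zero_mul, norm_eq_zero] at this
    exact stereoY_ne_zero hq this
  · rw [← norm_ne_zero_iff, hη]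
    exact (P.mass_pos hμ0 hμ1).ne'

/-- `stereoY` is linear in η, so Q(ξ, tη) is an explicit function of t, and its derivative at t = 1
is the radial derivative. -/
lemma fderiv_regHamiltonian_radial {μ c : ℝ} {P : Primary} {z : R3 × R3}
    (h : stereoY z + P.pos μ - P.other.pos μ ≠ 0) :
    fderiv ℝ (regHamiltonian μ c P) z (0, z.2) = ‖z.2‖ ^ 2 * regFactor μ c P z ^ 2 +
      ‖z.2‖ ^ 2 * regFactor μ c P z *
        ((1 - z.1 0) * (P.other.mass μ * ⟪stereoY z, stereoY z + P.pos μ - P.other.pos μ⟫ /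
          ‖stereoY z + P.pos μ - P.other.pos μ‖ ^ 3) +
        (stereoY z 1 * z.1 1 - stereoY z 0 * z.1 2)) := by
  have hl : HasDerivAt (fun t : ℝ => ((z.1, t • z.2) : R3 × R3)) (0, z.2) 1 := by
    have := (hasDerivAt_const (1 : ℝ) z.1).prodMk ((hasDerivAt_id (1 : ℝ)).smul_const z.2)
    simpa using this
  have e1 : ((z.1, (1 : ℝ) • z.2) : R3 × R3) = z := by rw [one_smul]
  have hQ : HasFDerivAt (regHamiltonian μ c P) (fderiv ℝ (regHamiltonian μ c P) z)
      (z.1, (1 : ℝ) • z.2) := by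
    rw [e1]
    exact ((contDiffAt_regHamiltonian (n := 1) h).differentiableAt (by simp)).hasFDerivAt
  have hQ' := hQ.comp_hasDerivAt (1 : ℝ) hl
  have hY : ∀ t : ℝ, stereoY (z.1, t • z.2) = t • stereoY z := by
    intro t
    ext i
    fin_cases i <;> simp [stereoY] <;> ring
  have hy : HasDerivAt (fun t : ℝ => t • stereoY z + P.pos μ) (stereoY z) 1 := by
    simpa using ((hasDerivAt_id (1 : ℝ)).smul_const (stereoY z)).add_const (P.pos μ)
  have hyi : ∀ i, HasDerivAt (fun t : ℝ => (t • stereoY z + P.pos μ) i) (stereoY z i) 1 := fun i =>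
    (EuclideanSpace.proj i : R2 →L[ℝ] ℝ).hasFDerivAt.comp_hasDerivAt (1 : ℝ) hy
  have h' : (1 : ℝ) • stereoY z + P.pos μ - P.other.pos μ ≠ 0 := by rwa [one_smul]
  have hinv := (hasFDerivAt_inv_norm_sub h').comp_hasDerivAt (1 : ℝ) hy
  have hf : HasDerivAt (fun t : ℝ => (1 + z.1 0) / 2 - (1 - z.1 0) * (c + P.other.mass μ *
      ‖t • stereoY z + P.pos μ - P.other.pos μ‖⁻¹) + ((t • stereoY z + P.pos μ) 1 * z.1 1
        - (t • stereoY z + P.pos μ) 0 * z.1 2)) _ 1 :=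
    ((((hinv.const_mul (P.other.mass μ)).const_add c).const_mul (1 - z.1 0)).const_sub
      ((1 + z.1 0) / 2)).add (((hyi 1).mul_const (z.1 1)).sub ((hyi 0).mul_const (z.1 2)))
  have hn : HasDerivAt (fun t : ℝ => 1 / 2 * (t ^ 2 * ‖z.2‖ ^ 2)) _ 1 :=
    (((hasDerivAt_id (1 : ℝ)).pow 2).mul_const (‖z.2‖ ^ 2)).const_mul (1 / 2)
  have hfun : (regHamiltonian μ c P ∘ fun t : ℝ => ((z.1, t • z.2) : R3 × R3)) =
      fun t : ℝ => 1 / 2 * (t ^ 2 * ‖z.2‖ ^ 2) * ((1 + z.1 0) / 2 - (1 - z.1 0) *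
      (c + P.other.mass μ * ‖t • stereoY z + P.pos μ - P.other.pos μ‖⁻¹) +
        ((t • stereoY z + P.pos μ) 1 * z.1 1 - (t • stereoY z + P.pos μ) 0 * z.1 2)) ^ 2 := by
    ext t
    simp only [Function.comp_apply, regHamiltonian, regFactor, hY, norm_smul, mul_pow,
      Real.norm_eq_abs, sq_abs, div_eq_mul_inv]
  rw [hfun] at hQ'
  rw [hQ'.unique (hn.mul (hf.pow 2)), regFactor]
  simp only [one_smul, id_eq, one_pow, smul_apply, smul_eq_mul, innerSL_apply_apply,
    Nat.cast_ofNat, Nat.add_one_sub_one, pow_one, div_eq_mul_inv]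
  rw [real_inner_comm (stereoY z)]
  ring

/-- The regularized surface is fibrewise star-shaped. -/
theorem inner_gradFibre_pos {μ c : ℝ} (hμ0 : 0 < μ) (hμ1 : μ < 1)
    (hc : IsBelowFirstCriticalValue μ c) {P : Primary} {z : R3 × R3}
    (hz : z ∈ regSurface μ c P) : 0 < ⟪z.2, gradFibre (regHamiltonian μ c P) z⟫ := by
  have hreg := regular_of_mem_regSurface hz
  have hη := snd_ne_zero_of_mem_regSurface hμ0 hμ1 hz
  rw [real_inner_comm, inner_gradFibre ((contDiffAt_regHamiltonian (n := 1) hreg).differentiableAt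
    (by simp)), fderiv_regHamiltonian_radial hreg]
  have hn := norm_pos_iff.2 hη
  have hm := P.mass_pos hμ0 hμ1
  obtain ⟨hT, ⟨h0, hq, hcomp⟩ | ⟨h0, hη'⟩⟩ := hz
  · have hy := stereoY_ne_zero hq
    have hpos := radialDeriv_pos_of_mem_hillComponent hμ0 hμ1 hc P (p := -stereoX z) hy hcomp hq.2
    have hspec := regFactor_spec μ c P hT h0 hη
    rw [hq.2, sub_self, mul_zero, zero_add] at hspec
    have hyn := norm_stereoY hT h0
    have hyp := norm_pos_iff.2 hy
    have h1 : 1 - z.1 0 ≠ 0 := sub_ne_zero.2 (Ne.symm h0)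
    -- On Σ one has |η| f = m_P. Substituting this, together with r = |η|(1 - ξ₀) and the
    -- stereographic coordinates, produces the radial derivative of H.
    have e : ‖z.2‖ ^ 2 * regFactor μ c P z ^ 2 + ‖z.2‖ ^ 2 * regFactor μ c P z *
        ((1 - z.1 0) * (P.other.mass μ * ⟪stereoY z, stereoY z + P.pos μ - P.other.pos μ⟫ /
          ‖stereoY z + P.pos μ - P.other.pos μ‖ ^ 3) +
        (stereoY z 1 * z.1 1 - stereoY z 0 * z.1 2)) =
        P.mass μ * (‖stereoY z‖ * radialDeriv μ P (stereoY z) (-stereoX z)) := by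
      have e1 : (1 - z.1 0) * stereoX z 0 = z.1 1 := by
        simp only [stereoX, Matrix.cons_val_zero]
        field_simp
      have e2 : (1 - z.1 0) * stereoX z 1 = z.1 2 := by
        rw [mul_comm]
        exact div_mul_cancel₀ _ h1
      have e3 : ‖stereoY z‖ * radialDeriv μ P (stereoY z) (-stereoX z) = P.mass μ +
          ‖stereoY z‖ * (P.other.mass μ * ⟪stereoY z, stereoY z + P.pos μ - P.other.pos μ⟫ /
          ‖stereoY z + P.pos μ - P.other.pos μ‖ ^ 3 + (stereoY z 1 * stereoX z 0
            - stereoY z 0 * stereoX z 1)) := by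
        rw [radialDeriv, add_assoc, mul_add, mul_div_cancel₀ _ hyp.ne']
        simp only [PiLp.neg_apply]
        ring
      rw [e3, hyn, ← hspec, ← e1, ← e2]
      ring
    rw [e]
    positivity
  -- At a collision f = 1 and the remaining terms vanish, so the radial derivative is |η|².
  · obtain ⟨h1, h2⟩ := collision_coords hT h0
    have hf : regFactor μ c P z = 1 := by
      simp only [regFactor, h0, h1, h2]
      ring
    rw [hf, h0, h1, h2]
    simp only [sub_self, zero_mul, mul_zero, add_zero]
    positivity

end ThreeBody

/-! ## The linearized flow along a chord -/

namespace ThreeBody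

/-- The function `|ξ|²`. -/
def baseNormSq (z : R3 × R3) : ℝ := ⟪z.1, z.1⟫

/-- The function `ξ · η`. -/
def basePairing (z : R3 × R3) : ℝ := ⟪z.1, z.2⟫

lemma contDiff_baseNormSq {n : WithTop ℕ∞} : ContDiff ℝ n baseNormSq :=
  contDiff_fst.inner ℝ contDiff_fst

lemma contDiff_basePairing {n : WithTop ℕ∞} : ContDiff ℝ n basePairing :=
  contDiff_fst.inner ℝ contDiff_snd

lemma fderiv_baseNormSq (z v : R3 × R3) : fderiv ℝ baseNormSq z v = 2 * ⟪z.1, v.1⟫ := by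
  have h : HasFDerivAt baseNormSq _ z := (hasFDerivAt_fst (p := z)).inner ℝ (hasFDerivAt_fst (p := z))
  rw [h.fderiv]
  simp only [ContinuousLinearMap.comp_apply, ContinuousLinearMap.prod_apply,
    ContinuousLinearMap.coe_fst', fderivInnerCLM_apply]
  rw [real_inner_comm z.1]
  ring

lemma fderiv_basePairing (z v : R3 × R3) :
    fderiv ℝ basePairing z v = ⟪v.1, z.2⟫ + ⟪z.1, v.2⟫ := by
  have h : HasFDerivAt basePairing _ z := (hasFDerivAt_fst (p := z)).inner ℝ (hasFDerivAt_snd (p := z))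
  rw [h.fderiv]
  simp only [ContinuousLinearMap.comp_apply, ContinuousLinearMap.prod_apply,
    ContinuousLinearMap.coe_fst', ContinuousLinearMap.coe_snd', fderivInnerCLM_apply]
  ring

/-- The tangent space at `z` of the level set of `Q` in `T*S²`. -/
def surfTangent (Q : R3 × R3 → ℝ) (z : R3 × R3) : Submodule ℝ (R3 × R3) :=
  (fderiv ℝ baseNormSq z).ker ⊓ (fderiv ℝ basePairing z).ker ⊓ (fderiv ℝ Q z).ker

lemma mem_surfTangent {Q : R3 × R3 → ℝ} {z v : R3 × R3} :
    v ∈ surfTangent Q z ↔ v ∈ cotSphereTangent z ∧ fderiv ℝ Q z v = 0 := by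
  simp only [surfTangent, Submodule.mem_inf, LinearMap.mem_ker, ContinuousLinearMap.coe_coe,
    fderiv_baseNormSq, fderiv_basePairing, cotSphereTangent, mem_ofPred_eq, mul_eq_zero,
    OfNat.ofNat_ne_zero, false_or]

/-- The vectors ξ, η and e form an orthogonal basis of ℝ³. -/
lemma eq_zero_of_inner_eq_zero {z : R3 × R3} (hz : z ∈ cotSphere) (hη : z.2 ≠ 0) {w : R3}
    (h1 : ⟪z.1, w⟫ = 0) (h2 : ⟪z.2, w⟫ = 0) (h3 : ⟪crossUnit z, w⟫ = 0) : w = 0 := by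
  have hc := inner_crossUnit_self hz hη
  have hn := inner_crossUnit_right z
  have hon : LinearIndependent ℝ ![z.1, z.2, crossUnit z] := by
    refine linearIndependent_of_ne_zero_of_inner_eq_zero (𝕜 := ℝ) ?_ ?_
    · intro i
      fin_cases i
      · have h : ‖z.1‖ ≠ 0 := by rw [hz.1]; norm_num
        exact norm_ne_zero_iff.1 h
      · exact hη
      · intro h
        have h : crossUnit z = 0 := h
        rw [h, inner_zero_left] at hc
        norm_num at hc
    · have e1 : ⟪z.1, z.2⟫ = 0 := hz.2
      have e2 := inner_crossUnit_left z
      intro i j hij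
      fin_cases i <;> fin_cases j <;>
        first
        | exact absurd rfl hij
        | exact e1
        | exact e2
        | exact hn
        | exact (real_inner_comm _ _).trans e1
        | exact (real_inner_comm _ _).trans e2
        | exact (real_inner_comm _ _).trans hn
  let b := basisOfLinearIndependentOfCardEqFinrank hon (by simp)
  refine InnerProductSpace.ext_inner_left_basis (𝕜 := ℝ) b fun i => ?_
  rw [inner_zero_right, coe_basisOfLinearIndependentOfCardEqFinrank]
  fin_cases i
  · exact h1
  · exact h2
  · exact h3

/-- The trivialization vanishes on the tangent space of the surface only along the flow. -/
lemma exists_smul_hamField {Q : R3 × R3 → ℝ} {z v : R3 × R3} (hQ : DifferentiableAt ℝ Q z)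
    (hz : z ∈ cotSphere) (hη : z.2 ≠ 0) (hs : ⟪z.2, gradFibre Q z⟫ ≠ 0)
    (hv : v ∈ surfTangent Q z) (h : triv Q z v = 0) : ∃ a : ℝ, v = a • hamField Q z := by
  obtain ⟨hvt, hvQ⟩ := mem_surfTangent.1 hv
  have hX := hamField_mem_tangent Q hz
  have hzz : ⟪z.1, z.2⟫ = 0 := hz.2
  have hX1 : ⟪(hamField Q z).1, z.2⟫ = ⟪z.2, gradFibre Q z⟫ := by
    simp only [hamField, inner_sub_left, inner_smul_left, hzz, mul_zero, sub_zero]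
    rw [real_inner_comm]
  refine ⟨⟪v.1, z.2⟫ / ⟪z.2, gradFibre Q z⟫, ?_⟩
  set a := ⟪v.1, z.2⟫ / ⟪z.2, gradFibre Q z⟫ with ha
  -- The multiple of X_Q is chosen such that w_ξ · η = 0, which needs η · n_η ≠ 0. Then w_ξ is
  -- orthogonal to ξ, η and e, hence zero; w_η is a multiple of η, and dQ(w) = 0 with transversality
  -- makes it zero too.
  obtain ⟨w, hw⟩ : ∃ w, w = v - a • hamField Q z := ⟨_, rfl⟩
  have htr : triv Q z w = 0 := by
    have h0 := triv_hamField hQ hz hs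
    rw [hw, map_sub, map_smul, h, h0]
    simp
  have hXX : fderiv ℝ Q z (hamField Q z) = 0 := by
    rw [← cotForm_hamField hQ hX, cotForm_self]
  have hwT : w ∈ surfTangent Q z := by
    rw [hw]
    exact Submodule.sub_mem _ hv (Submodule.smul_mem _ _ (mem_surfTangent.2 ⟨hX, hXX⟩))
  obtain ⟨⟨w1, w2⟩, wQ⟩ := mem_surfTangent.1 hwT
  have hw3 : ⟪w.1, z.2⟫ = 0 := by
    rw [hw]
    simp only [Prod.fst_sub, Prod.smul_fst, inner_sub_left, inner_smul_left, conj_trivial, hX1, ha]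
    field_simp
    ring
  rw [triv_apply, Prod.mk_eq_zero, cotForm_apply, cotForm_apply] at htr
  obtain ⟨t1, t2⟩ := htr
  simp only [frameVert, frameHor, inner_sub_right, inner_smul_right, hw3, inner_zero_right, mul_zero,
    sub_zero] at t1 t2
  have hw1 : w.1 = 0 := by
    refine eq_zero_of_inner_eq_zero hz hη w1 ?_ ?_
    · rw [real_inner_comm]; exact hw3
    · rw [real_inner_comm]; exact t1
  rw [hw1] at w2 t2
  simp only [inner_zero_left, inner_zero_right, zero_add, sub_zero] at w2 t2
  have hw2 : w.2 = (⟪z.2, w.2⟫ / ⟪z.2, z.2⟫) • z.2 := by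
    rw [← sub_eq_zero]
    have hne : ⟪z.2, z.2⟫ ≠ 0 := inner_self_ne_zero.2 hη
    refine eq_zero_of_inner_eq_zero hz hη ?_ ?_ ?_
    · rw [inner_sub_right, inner_smul_right, w2, hzz]; ring
    · rw [inner_sub_right, inner_smul_right]; field_simp; ring
    · rw [inner_sub_right, inner_smul_right, t2, inner_crossUnit_right]; ring
  have hF : ⟪gradFibre Q z, w.2⟫ = 0 := by
    rw [inner_gradFibre hQ, ← wQ]
    congr 1
    exact Prod.ext hw1.symm rfl
  rw [hw2, inner_smul_right, real_inner_comm z.2 (gradFibre Q z)] at hF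
  have h0 := (mul_eq_zero.1 hF).resolve_right hs
  rw [h0, zero_smul] at hw2
  have : w = 0 := Prod.ext hw1 hw2
  rw [hw] at this
  exact sub_eq_zero.1 this

/-- Along a solution of the variational equation of `X`, the derivative of a function `g` evolves
by the derivative of `X g`. -/
lemma hasDerivWithinAt_fderiv_apply {F : Type*} [NormedAddCommGroup F] [NormedSpace ℝ F]
    {X : F → F} {g : F → ℝ} {S : Set ℝ} {x y : ℝ → F} {t : ℝ} (hg : ContDiffAt ℝ 2 g (x t))
    (hX : DifferentiableAt ℝ X (x t)) (hx : HasDerivWithinAt x (X (x t)) S t)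
    (hy : HasDerivWithinAt y (fderiv ℝ X (x t) (y t)) S t) :
    HasDerivWithinAt (fun t => fderiv ℝ g (x t) (y t))
      (fderiv ℝ (fun w => fderiv ℝ g w (X w)) (x t) (y t)) S t := by
  have hg1 : DifferentiableAt ℝ (fderiv ℝ g) (x t) :=
    (hg.fderiv_right (m := 1) (by norm_num)).differentiableAt (by simp)
  have h1 : HasDerivWithinAt (fun t => fderiv ℝ g (x t)) _ S t :=
    hg1.hasFDerivAt.comp_hasDerivWithinAt t hx
  refine (h1.clm_apply hy).congr_deriv ?_
  have h2 := hg1.hasFDerivAt.clm_apply hX.hasFDerivAt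
  -- Differentiating dg(y) along x gives D²g(X, y), while the derivative of dg(X) in direction y
  -- gives D²g(y, X).
  have hsymm : IsSymmSndFDerivAt ℝ g (x t) := hg.isSymmSndFDerivAt (by simp)
  rw [h2.fderiv]
  simp only [add_apply, ContinuousLinearMap.comp_apply, ContinuousLinearMap.flip_apply]
  rw [hsymm.eq (X (x t)) (y t)]
  ring

lemma fderiv_eq_inner {Q : R3 × R3 → ℝ} {z : R3 × R3} (hQ : DifferentiableAt ℝ Q z)
    (v : R3 × R3) : fderiv ℝ Q z v = ⟪gradBase Q z, v.1⟫ + ⟪gradFibre Q z, v.2⟫ := by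
  rw [inner_gradBase hQ, inner_gradFibre hQ, ← map_add]
  simp

/-- Off T*S² the extended field does not preserve |ξ|², but the defect carries the factor 1 - |ξ|².
This suffices for the differentials of the constraints to satisfy homogeneous linear equations along
a curve in T*S². -/
lemma fderiv_baseNormSq_hamField (Q : R3 × R3 → ℝ) (z : R3 × R3) :
    fderiv ℝ baseNormSq z (hamField Q z) = 2 * ⟪z.1, gradFibre Q z⟫ * (1 - baseNormSq z) := by
  rw [fderiv_baseNormSq]
  simp only [hamField, inner_sub_right, inner_smul_right, baseNormSq]
  ring

lemma fderiv_basePairing_hamField (Q : R3 × R3 → ℝ) (z : R3 × R3) :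
    fderiv ℝ basePairing z (hamField Q z) =
      (⟪z.2, gradFibre Q z⟫ - ⟪z.1, gradBase Q z⟫) * (1 - baseNormSq z) := by
  rw [fderiv_basePairing]
  simp only [hamField, inner_sub_left, inner_add_right, inner_neg_right, inner_smul_left,
    inner_smul_right, baseNormSq, conj_trivial, real_inner_comm z.2 (gradFibre Q z)]
  ring

/-- The identity holds off T*S² as well, so it can be differentiated in all directions. -/
lemma fderiv_hamField_self {Q : R3 × R3 → ℝ} {z : R3 × R3} (hQ : DifferentiableAt ℝ Q z) :
    fderiv ℝ Q z (hamField Q z) = 0 := by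
  rw [fderiv_eq_inner hQ]
  simp only [hamField, inner_sub_right, inner_add_right, inner_neg_right, inner_smul_right,
    real_inner_comm (gradBase Q z) z.1, real_inner_comm (gradFibre Q z) z.1,
    real_inner_comm (gradFibre Q z) z.2, real_inner_comm (gradFibre Q z) (gradBase Q z)]
  ring

lemma fderiv_mul_one_sub_baseNormSq {α : R3 × R3 → ℝ} {z : R3 × R3} (hα : DifferentiableAt ℝ α z)
    (hz : z ∈ cotSphere) (v : R3 × R3) :
    fderiv ℝ (fun w => α w * (1 - baseNormSq w)) z v = -α z * fderiv ℝ baseNormSq z v := by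
  have hb : DifferentiableAt ℝ baseNormSq z :=
    (contDiff_baseNormSq (n := 1)).contDiffAt.differentiableAt (by simp)
  have h1 : baseNormSq z = 1 := by
    rw [baseNormSq, real_inner_self_eq_norm_sq, hz.1]
    norm_num
  have h : HasFDerivAt (fun w => α w * (1 - baseNormSq w)) _ z :=
    hα.hasFDerivAt.mul (hb.hasFDerivAt.const_sub 1)
  rw [h.fderiv]
  simp [h1]

open LinearODE LagrangianPath

/-- `z` is a point of `T*S²` off the zero section at which `Q` is smooth and its level set is
transverse to the fibrewise radial direction. -/
structure IsTransversePoint (Q : R3 × R3 → ℝ) (z : R3 × R3) : Prop where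
  contDiffAt : ContDiffAt ℝ 2 Q z
  mem : z ∈ cotSphere
  ne_zero : z.2 ≠ 0
  inner_ne_zero : ⟪z.2, gradFibre Q z⟫ ≠ 0

namespace IsTransversePoint

variable {Q : R3 × R3 → ℝ} {z : R3 × R3}

lemma differentiableAt (h : IsTransversePoint Q z) : DifferentiableAt ℝ Q z :=
  h.contDiffAt.differentiableAt (by simp)

lemma contDiffAt_hamField (h : IsTransversePoint Q z) : ContDiffAt ℝ 1 (hamField Q) z :=
  ThreeBody.contDiffAt_hamField h.contDiffAt (by norm_num)

lemma continuousAt_fderiv_hamField (h : IsTransversePoint Q z) :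
    ContinuousAt (fderiv ℝ (hamField Q)) z :=
  (h.contDiffAt_hamField.fderiv_right (m := 0) (by norm_num)).continuousAt

lemma continuousAt_gradBase (h : IsTransversePoint Q z) : ContinuousAt (gradBase Q) z :=
  (contDiffAt_gradBase (m := 1) h.contDiffAt (by norm_num)).continuousAt

lemma continuousAt_gradFibre (h : IsTransversePoint Q z) : ContinuousAt (gradFibre Q) z :=
  (contDiffAt_gradFibre (m := 1) h.contDiffAt (by norm_num)).continuousAt

lemma continuousAt_crossUnit (h : IsTransversePoint Q z) : ContinuousAt crossUnit z := by
  have hc : Continuous fun z : R3 × R3 => (WithLp.toLp 2 (z.1.ofLp ⨯₃ z.2.ofLp) : R3) := by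
    refine (PiLp.continuous_toLp 2 _).comp (continuous_pi fun i => ?_)
    fin_cases i <;> simp [cross_apply] <;> fun_prop
  have hne : ‖(WithLp.toLp 2 (z.1.ofLp ⨯₃ z.2.ofLp) : R3)‖ ≠ 0 := by
    intro h0
    have := inner_crossUnit_self h.mem h.ne_zero
    rw [crossUnit, h0, inv_zero, zero_smul, inner_zero_left] at this
    norm_num at this
  exact (hc.norm.continuousAt.inv₀ hne).smul hc.continuousAt

lemma continuousAt_frameVert (h : IsTransversePoint Q z) : ContinuousAt (frameVert Q) z := by
  have h1 := h.continuousAt_crossUnit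
  have h2 := h.continuousAt_gradFibre
  have h3 : ContinuousAt (fun z : R3 × R3 => z.2) z := continuousAt_snd
  unfold frameVert
  exact continuousAt_const.prodMk
    (h1.sub (((h1.inner h2).div (h3.inner h2) h.inner_ne_zero).smul h3))

lemma continuousAt_frameHor (h : IsTransversePoint Q z) : ContinuousAt (frameHor Q) z := by
  have h1 := h.continuousAt_crossUnit
  have h2 := h.continuousAt_gradFibre
  have h3 : ContinuousAt (fun z : R3 × R3 => z.2) z := continuousAt_snd
  have h4 := h.continuousAt_gradBase
  unfold frameHor
  exact h1.prodMk (((h1.inner h4).div (h3.inner h2) h.inner_ne_zero).neg.smul h3)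

lemma frameHor_mem_surfTangent (h : IsTransversePoint Q z) : frameHor Q z ∈ surfTangent Q z :=
  mem_surfTangent.2 ⟨(frame_mem_tangent Q h.mem).2,
    (fderiv_frame h.differentiableAt h.inner_ne_zero).2⟩

end IsTransversePoint

section Flow

variable {Q : R3 × R3 → ℝ} {T : ℝ} {x : ℝ → R3 × R3}

/-- The coefficients of the variational equation along `x`. -/
def variation (Q : R3 × R3 → ℝ) (x : ℝ → R3 × R3) (t : ℝ) : R3 × R3 →L[ℝ] R3 × R3 :=
  fderiv ℝ (hamField Q) (x t)

lemma continuousOn_variation (hx : ContinuousOn x (Icc 0 T))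
    (hg : ∀ t ∈ Icc 0 T, IsTransversePoint Q (x t)) :
    ContinuousOn (variation Q x) (Icc 0 T) := fun t ht =>
  (hg t ht).continuousAt_fderiv_hamField.comp_continuousWithinAt (hx t ht)

lemma IsIntegralCurve.continuousOn {X : R3 × R3 → R3 × R3} (hx : IsIntegralCurve X T x) :
    ContinuousOn x (Icc 0 T) := fun t ht => (hx t ht).continuousWithinAt

lemma exists_isLinearizedFlow (hT : 0 ≤ T) (hx : ContinuousOn x (Icc 0 T))
    (hg : ∀ t ∈ Icc 0 T, IsTransversePoint Q (x t)) :
    ∃ A, IsLinearizedFlow (hamField Q) T x A := by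
  obtain ⟨A, hA0, hA⟩ := exists_isSolution hT
    (L := fun t => ContinuousLinearMap.compL ℝ (R3 × R3) (R3 × R3) (R3 × R3) (variation Q x t))
    ((ContinuousLinearMap.compL ℝ (R3 × R3) (R3 × R3) (R3 × R3)).continuous.comp_continuousOn
      (continuousOn_variation hx hg)) (ContinuousLinearMap.id ℝ (R3 × R3))
  exact ⟨A, hA0, hA⟩

lemma IsLinearizedFlow.isSolution {A : ℝ → (R3 × R3 →L[ℝ] R3 × R3)}
    (hA : IsLinearizedFlow (hamField Q) T x A) (w : R3 × R3) :
    IsSolution (variation Q x) 0 T fun t => A t w := fun t ht =>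
  ((hA.2 t ht).clm_apply (hasDerivWithinAt_const t (Icc 0 T) w)).congr_deriv (by
    simp [variation])

lemma isSolution_hamField (hx : IsIntegralCurve (hamField Q) T x)
    (hg : ∀ t ∈ Icc 0 T, IsTransversePoint Q (x t)) :
    IsSolution (variation Q x) 0 T fun t => hamField Q (x t) := fun t ht =>
  ((hg t ht).contDiffAt_hamField.differentiableAt (by simp)).hasFDerivAt.comp_hasDerivWithinAt t
    (hx t ht)

lemma IsSolution.sub_smul {E : Type*} [NormedAddCommGroup E] [NormedSpace ℝ E] {L : ℝ → E →L[ℝ] E}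
    {a b k : ℝ} {y z : ℝ → E} (hy : IsSolution L a b y) (hz : IsSolution L a b z) :
    IsSolution L a b fun t => y t - k • z t := fun t ht =>
  ((hy t ht).sub ((hz t ht).const_smul k)).congr_deriv (by simp)

/-- Solutions of the variational equation which are tangent to the surface at one time are tangent
to it at all times. -/
lemma mem_surfTangent_of_isSolution (hx : IsIntegralCurve (hamField Q) T x)
    (hg : ∀ t ∈ Icc 0 T, IsTransversePoint Q (x t)) {y : ℝ → R3 × R3}
    (hy : IsSolution (variation Q x) 0 T y) {s : ℝ} (hs : s ∈ Icc 0 T)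
    (h : y s ∈ surfTangent Q (x s)) {t : ℝ} (ht : t ∈ Icc 0 T) : y t ∈ surfTangent Q (x t) := by
  have hX : ∀ t ∈ Icc 0 T, DifferentiableAt ℝ (hamField Q) (x t) := fun t ht =>
    (hg t ht).contDiffAt_hamField.differentiableAt (by simp)
  have hF : ∀ t ∈ Icc 0 T, DifferentiableAt ℝ (gradFibre Q) (x t) := fun t ht =>
    (contDiffAt_gradFibre (m := 1) (hg t ht).contDiffAt (by norm_num)).differentiableAt (by simp)
  have hB : ∀ t ∈ Icc 0 T, DifferentiableAt ℝ (gradBase Q) (x t) := fun t ht =>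
    (contDiffAt_gradBase (m := 1) (hg t ht).contDiffAt (by norm_num)).differentiableAt (by simp)
  have hcx := hx.continuousOn
  obtain ⟨⟨h1, h2⟩, h3⟩ := h
  have hL0 : ContinuousOn (fun _ : ℝ => (0 : ℝ →L[ℝ] ℝ)) (Icc 0 T) := continuousOn_const
  -- Each of the three differentials, applied to y, solves a homogeneous scalar linear equation and
  -- vanishes at time s. For the second one the right side is a multiple of the first and is already
  -- known to vanish.
  have a1 : ∀ t ∈ Icc 0 T, fderiv ℝ baseNormSq (x t) (y t) = 0 := by
    have hα : ∀ t ∈ Icc 0 T, DifferentiableAt ℝ (fun z => 2 * ⟪z.1, gradFibre Q z⟫) (x t) :=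
      fun t ht => ((differentiableAt_fst.inner ℝ (hF t ht)).const_mul 2)
    have hsol : IsSolution (fun t => (-(2 * ⟪(x t).1, gradFibre Q (x t)⟫)) •
        ContinuousLinearMap.id ℝ ℝ) 0 T fun t => fderiv ℝ baseNormSq (x t) (y t) := by
      intro t ht
      refine (hasDerivWithinAt_fderiv_apply contDiff_baseNormSq.contDiffAt (hX t ht) (hx t ht)
        (hy t ht)).congr_deriv ?_
      simp only [fderiv_baseNormSq_hamField]
      rw [fderiv_mul_one_sub_baseNormSq (hα t ht) (hg t ht).mem]
      simp
    refine hsol.eqOn ?_ (isSolution_zero _ 0 T) hs h1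
    have hcα : ContinuousOn (fun t => -(2 * ⟪(x t).1, gradFibre Q (x t)⟫)) (Icc 0 T) := fun t ht =>
      ((hα t ht).continuousAt.comp_continuousWithinAt (hcx t ht)).neg
    exact hcα.smul (continuousOn_const (c := ContinuousLinearMap.id ℝ ℝ))
  have a2 : ∀ t ∈ Icc 0 T, fderiv ℝ basePairing (x t) (y t) = 0 := by
    have hβ : ∀ t ∈ Icc 0 T, DifferentiableAt ℝ
        (fun z => ⟪z.2, gradFibre Q z⟫ - ⟪z.1, gradBase Q z⟫) (x t) :=
      fun t ht => (differentiableAt_snd.inner ℝ (hF t ht)).sub (differentiableAt_fst.inner ℝ (hB t ht))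
    have hsol : IsSolution (fun _ => (0 : ℝ →L[ℝ] ℝ)) 0 T
        fun t => fderiv ℝ basePairing (x t) (y t) := by
      intro t ht
      refine (hasDerivWithinAt_fderiv_apply contDiff_basePairing.contDiffAt (hX t ht) (hx t ht)
        (hy t ht)).congr_deriv ?_
      simp only [fderiv_basePairing_hamField]
      rw [fderiv_mul_one_sub_baseNormSq (hβ t ht) (hg t ht).mem, a1 t ht]
      simp
    exact hsol.eqOn hL0 (isSolution_zero _ 0 T) hs h2
  have a3 : ∀ t ∈ Icc 0 T, fderiv ℝ Q (x t) (y t) = 0 := by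
    have hsol : IsSolution (fun _ => (0 : ℝ →L[ℝ] ℝ)) 0 T fun t => fderiv ℝ Q (x t) (y t) := by
      intro t ht
      refine (hasDerivWithinAt_fderiv_apply (hg t ht).contDiffAt (hX t ht) (hx t ht)
        (hy t ht)).congr_deriv ?_
      have h0 : (fun w => fderiv ℝ Q w (hamField Q w)) =ᶠ[𝓝 (x t)] fun _ => 0 := by
        filter_upwards [(hg t ht).contDiffAt.eventually (by simp)] with w hw
        exact fderiv_hamField_self (hw.differentiableAt (by simp))
      rw [h0.fderiv_eq]
      simp
    exact hsol.eqOn hL0 (isSolution_zero _ 0 T) hs h3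
  exact ⟨⟨a1 t ht, a2 t ht⟩, a3 t ht⟩

/-- The linearized flow is injective transversely to the flow direction. -/
lemma triv_eq_zero_of_isSolution (hx : IsIntegralCurve (hamField Q) T x)
    (hg : ∀ t ∈ Icc 0 T, IsTransversePoint Q (x t)) {y : ℝ → R3 × R3}
    (hy : IsSolution (variation Q x) 0 T y) {s : ℝ} (hs : s ∈ Icc 0 T)
    (h : y s ∈ surfTangent Q (x s)) (h0 : triv Q (x s) (y s) = 0) {t : ℝ} (ht : t ∈ Icc 0 T) :
    triv Q (x t) (y t) = 0 := by
  -- At time s the solution is a multiple of X_Q. Since X_Q along x also solves the variational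
  -- equation, y stays this multiple of it.
  obtain ⟨a, ha⟩ := exists_smul_hamField (hg s hs).differentiableAt (hg s hs).mem (hg s hs).ne_zero
    (hg s hs).inner_ne_zero h h0
  have hsol := IsSolution.sub_smul (k := a) hy (isSolution_hamField hx hg)
  have hz := hsol.eqOn (continuousOn_variation hx.continuousOn hg) (isSolution_zero _ 0 T) hs
    (sub_eq_zero.2 ha) ht
  rw [sub_eq_zero.1 hz, map_smul, triv_hamField (hg t ht).differentiableAt (hg t ht).mem
    (hg t ht).inner_ne_zero]
  simp

lemma continuousOn_triv (hx : ContinuousOn x (Icc 0 T))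
    (hg : ∀ t ∈ Icc 0 T, IsTransversePoint Q (x t)) {y : ℝ → R3 × R3}
    (hy : ContinuousOn y (Icc 0 T)) : ContinuousOn (fun t => triv Q (x t) (y t)) (Icc 0 T) := by
  have hV : ContinuousOn (fun t => frameVert Q (x t)) (Icc 0 T) := fun t ht =>
    (hg t ht).continuousAt_frameVert.comp_continuousWithinAt (hx t ht)
  have hH : ContinuousOn (fun t => frameHor Q (x t)) (Icc 0 T) := fun t ht =>
    (hg t ht).continuousAt_frameHor.comp_continuousWithinAt (hx t ht)
  simp only [triv_apply, cotForm_apply]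
  exact ((hy.fst.inner hV.snd).sub (hy.snd.inner hV.fst)).prodMk
    ((hH.fst.inner hy.snd).sub (hH.snd.inner hy.fst))

/-- V is spanned by (1, 0), which the inverse trivialization sends to X₂. -/
lemma map_transversePath (Q : R3 × R3 → ℝ) (x : ℝ → R3 × R3) (A : ℝ → (R3 × R3 →L[ℝ] R3 × R3))
    (t : ℝ) : planeV.map (transversePath Q x A t) =
      Submodule.span ℝ {triv Q (x t) (A t (frameHor Q (x 0)))} := by
  rw [planeV_eq_line, line, Submodule.map_span, image_singleton]
  simp [unitVec, transversePath, trivInv]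

/-- Solutions of the variational equation along the reflected chord. -/
lemma isSolution_reflect (hQ : ∀ z, Q (involution z) = Q z)
    (hg : ∀ t ∈ Icc 0 T, IsTransversePoint Q (x t)) {w : ℝ → R3 × R3}
    (hw : IsSolution (variation Q (reflectedChord T x)) 0 T w) :
    IsSolution (variation Q x) 0 T fun t => involution (w (T - t)) := by
  intro t ht
  have ht' : T - t ∈ Icc 0 T := ⟨by linarith [ht.2], by linarith [ht.1]⟩
  have hm : MapsTo (fun t => T - t) (Icc 0 T) (Icc 0 T) := fun t ht =>
    ⟨by linarith [ht.2], by linarith [ht.1]⟩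
  have h1 : HasDerivWithinAt (fun t : ℝ => T - t) (-1) (Icc 0 T) t :=
    ((hasDerivAt_id t).const_sub T).hasDerivWithinAt
  have h2 := (hw (T - t) ht').scomp t h1 hm
  have h3 := involutionL.hasFDerivAt.comp_hasDerivWithinAt t h2
  refine h3.congr_deriv ?_
  have hX : HasFDerivAt (hamField Q) (variation Q x t) (involutionL (involutionL (x t))) := by
    rw [involutionL_apply, involutionL_apply, involution_involution]
    exact ((hg t ht).contDiffAt_hamField.differentiableAt (by simp)).hasFDerivAt
  -- Differentiating X = -𝓡X𝓡 relates the variational equations along x and x_𝓡 up to a sign, which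
  -- cancels against the one from reversing time.
  have h4 := (involutionL.hasFDerivAt.comp (involution (x t))
    (hX.comp (involutionL (x t)) involutionL.hasFDerivAt)).neg
  have h5 : (-(⇑involutionL ∘ hamField Q ∘ ⇑involutionL)) = hamField Q := by
    funext z
    simp only [Pi.neg_apply, Function.comp_apply, involutionL_apply]
    rw [← hamField_involution hQ, involution_involution]
  rw [h5] at h4
  rw [variation, reflectedChord, sub_sub_cancel, h4.fderiv]
  simp [involutionL_apply, involution_involution]

lemma isIntegralCurve_reflectedChord (hQ : ∀ z, Q (involution z) = Q z)
    (hx : IsIntegralCurve (hamField Q) T x) :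
    IsIntegralCurve (hamField Q) T (reflectedChord T x) := by
  intro t ht
  have ht' : T - t ∈ Icc 0 T := ⟨by linarith [ht.2], by linarith [ht.1]⟩
  have hm : MapsTo (fun t => T - t) (Icc 0 T) (Icc 0 T) := fun t ht =>
    ⟨by linarith [ht.2], by linarith [ht.1]⟩
  have h1 : HasDerivWithinAt (fun t : ℝ => T - t) (-1) (Icc 0 T) t :=
    ((hasDerivAt_id t).const_sub T).hasDerivWithinAt
  have h3 := involutionL.hasFDerivAt.comp_hasDerivWithinAt t ((hx (T - t) ht').scomp t h1 hm)
  refine h3.congr_deriv ?_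
  rw [reflectedChord, hamField_involution hQ, neg_smul, one_smul, map_neg, involutionL_apply]

/-- The transverse linearized flows along a curve and along the reflected curve have the same
index. -/
theorem exists_index_reflectedChord (hT : 0 < T) (hQ : ∀ z, Q (involution z) = Q z)
    (hx : IsIntegralCurve (hamField Q) T x) (hg : ∀ t ∈ Icc 0 T, IsTransversePoint Q (x t))
    {A B : ℝ → (R3 × R3 →L[ℝ] R3 × R3)} (hA : IsLinearizedFlow (hamField Q) T x A)
    (hB : IsLinearizedFlow (hamField Q) T (reflectedChord T x) B) :
    ∃ m₀ : ℝ,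
      (∀ m, IsRobbinSalamonIndex planeForm T (fun t => planeV.map (transversePath Q x A t))
        planeV m ↔ m = m₀) ∧
      ∀ m, IsRobbinSalamonIndex planeForm T
        (fun t => planeV.map (transversePath Q (reflectedChord T x) B t)) planeV m ↔ m = m₀ := by
  have j0 : (0 : ℝ) ∈ Icc 0 T := left_mem_Icc.2 hT.le
  have j1 : T ∈ Icc 0 T := right_mem_Icc.2 hT.le
  have hcx := hx.continuousOn
  set y : ℝ → R3 × R3 := fun t => A t (frameHor Q (x 0)) with hy
  -- The solution along the reflected chord is transported back to x. It ends there in X₂, because 𝓡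
  -- preserves X₂.
  set w : ℝ → R3 × R3 := fun t =>
    involution (B (T - t) (frameHor Q (reflectedChord T x 0))) with hw
  have hys : IsSolution (variation Q x) 0 T y := hA.isSolution _
  have hws : IsSolution (variation Q x) 0 T w := isSolution_reflect hQ hg (hB.isSolution _)
  have hy0 : y 0 = frameHor Q (x 0) := by simp only [hy, hA.1, ContinuousLinearMap.id_apply]
  have hwT : w T = frameHor Q (x T) := by
    simp only [hw, sub_self, hB.1, ContinuousLinearMap.id_apply, reflectedChord, sub_zero]
    rw [frameHor_involution hQ, involution_involution]
  have hyt : ∀ t ∈ Icc 0 T, y t ∈ surfTangent Q (x t) := fun t ht =>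
    mem_surfTangent_of_isSolution hx hg hys j0 (hy0 ▸ (hg 0 j0).frameHor_mem_surfTangent) ht
  have hwt : ∀ t ∈ Icc 0 T, w t ∈ surfTangent Q (x t) := fun t ht =>
    mem_surfTangent_of_isSolution hx hg hws j1 (hwT ▸ (hg T j1).frameHor_mem_surfTangent) ht
  set u : ℝ → ℝ × ℝ := fun t => triv Q (x t) (y t) with hu
  set v : ℝ → ℝ × ℝ := fun t => triv Q (x t) (w t) with hv
  have hu0 : u 0 = (1, 0) := by
    simp only [hu, hy0]
    exact triv_frameHor Q (hg 0 j0).mem (hg 0 j0).ne_zero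
  have hvT : v T = (1, 0) := by
    simp only [hv, hwT]
    exact triv_frameHor Q (hg T j1).mem (hg T j1).ne_zero
  have hune : ∀ t ∈ Icc 0 T, u t ≠ 0 := by
    intro t ht h0
    have := triv_eq_zero_of_isSolution hx hg hys ht (hyt t ht) h0 j0
    have h1 : u 0 = 0 := this
    rw [hu0] at h1
    simp at h1
  have hvne : ∀ t ∈ Icc 0 T, v t ≠ 0 := by
    intro t ht h0
    have := triv_eq_zero_of_isSolution hx hg hws ht (hwt t ht) h0 j1
    have h1 : v T = 0 := this
    rw [hvT] at h1
    simp at h1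
  have hdet : (∀ t ∈ Icc 0 T, planeForm (u t) (v t) ≠ 0) ∨
      ∀ t ∈ Icc 0 T, planeForm (u t) (v t) = 0 := by
    by_cases hall : ∀ t ∈ Icc 0 T, planeForm (u t) (v t) ≠ 0
    · exact Or.inl hall
    push Not at hall
    obtain ⟨s, hs, hs0⟩ := hall
    -- If v = k u at one time, the solution w - k y lies along the flow there, hence at all times,
    -- and u and v remain parallel.
    obtain ⟨k, hk⟩ := Submodule.mem_span_singleton.1 (mem_span_of_planeForm_eq_zero (hune s hs) hs0)
    refine Or.inr fun t ht => ?_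
    have h1 := triv_eq_zero_of_isSolution hx hg (IsSolution.sub_smul (k := k) hws hys) hs
      (Submodule.sub_mem _ (hwt s hs) (Submodule.smul_mem _ _ (hyt s hs)))
      (by rw [map_sub, map_smul]; exact sub_eq_zero.2 hk.symm) ht
    rw [map_sub, map_smul, sub_eq_zero] at h1
    rw [← mem_span_singleton_iff_planeForm (hune t ht)]
    exact Submodule.mem_span_singleton.2 ⟨k, h1.symm⟩
  obtain ⟨m₀, h1, h2⟩ := exists_robbinSalamonIndex_eq hT
    (continuousOn_triv hcx hg hys.continuousOn) (continuousOn_triv hcx hg hws.continuousOn)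
    (mem_planeV.2 (congrArg Prod.snd hu0)) hune (mem_planeV.2 (congrArg Prod.snd hvT)) hvne hdet
  refine ⟨m₀, fun m => ?_, fun m => ?_⟩
  · simp only [map_transversePath]
    exact h1 m
  · have e : ∀ t, planeV.map (transversePath Q (reflectedChord T x) B t) =
        Submodule.span ℝ {((v (T - t)).1, -(v (T - t)).2)} := by
      intro t
      rw [map_transversePath, hv, hw]
      simp only [sub_sub_cancel]
      rw [← triv_involution hQ, involution_involution]
      rfl
    simp only [e]
    exact h2 m

end Flow

/-! ### Application to chords. -/

lemma isTransversePoint_of_mem_regSurface {μ c : ℝ} (hμ0 : 0 < μ) (hμ1 : μ < 1)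
    (hc : IsBelowFirstCriticalValue μ c) {P : Primary} {z : R3 × R3} (hz : z ∈ regSurface μ c P) :
    IsTransversePoint (regHamiltonian μ c P) z :=
  ⟨contDiffAt_regHamiltonian (regular_of_mem_regSurface hz), hz.1,
    snd_ne_zero_of_mem_regSurface hμ0 hμ1 hz, (inner_gradFibre_pos hμ0 hμ1 hc hz).ne'⟩

lemma isChord_reflectedChord {μ c : ℝ} {P : Primary} {T : ℝ} {x : ℝ → R3 × R3}
    (hx : IsChord μ c P T x) : IsChord μ c P T (reflectedChord T x) := by
  obtain ⟨h1, h2, h3, h4⟩ := hx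
  refine ⟨fun t ht => involution_mem_regSurface (h1 _ ⟨by linarith [ht.2], by linarith [ht.1]⟩),
    isIntegralCurve_reflectedChord (regHamiltonian_involution μ c P) h2, ?_, ?_⟩
  · rw [reflectedChord, sub_zero, h4.2]
    exact h4
  · rw [reflectedChord, sub_self, h3.2]
    exact h3

/-- The index of a chord and of the reflected chord are given by the same number. -/
theorem exists_isChordIndex_iff {μ c : ℝ} (hμ0 : 0 < μ) (hμ1 : μ < 1)
    (hc : IsBelowFirstCriticalValue μ c) {P : Primary} {T : ℝ} (hT : 0 < T) {x : ℝ → R3 × R3}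
    (hx : IsChord μ c P T x) : ∃ m₀ : ℝ, (∀ m, IsChordIndex μ c P T x m ↔ m = m₀) ∧
      ∀ m, IsChordIndex μ c P T (reflectedChord T x) m ↔ m = m₀ := by
  have hg : ∀ t ∈ Icc 0 T, IsTransversePoint (regHamiltonian μ c P) (x t) := fun t ht =>
    isTransversePoint_of_mem_regSurface hμ0 hμ1 hc (hx.1 t ht)
  have hxR := isChord_reflectedChord hx
  have hgR : ∀ t ∈ Icc 0 T, IsTransversePoint (regHamiltonian μ c P) (reflectedChord T x t) :=
    fun t ht => isTransversePoint_of_mem_regSurface hμ0 hμ1 hc (hxR.1 t ht)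
  obtain ⟨A, hA⟩ := exists_isLinearizedFlow hT.le hx.2.1.continuousOn hg
  obtain ⟨B, hB⟩ := exists_isLinearizedFlow hT.le hxR.2.1.continuousOn hgR
  have key := fun {A B} hA hB => exists_index_reflectedChord (A := A) (B := B) hT
    (regHamiltonian_involution μ c P) hx.2.1 hg hA hB
  obtain ⟨m₀, h1, h2⟩ := key hA hB
  refine ⟨m₀, fun m => ⟨?_, fun h => ⟨A, hA, (h1 m).2 h⟩⟩, fun m => ⟨?_, fun h => ⟨B, hB, (h2 m).2 h⟩⟩⟩
  -- Uniqueness of the linearized flow is bypassed: A and A' are both compared with the same flow B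
  -- of the reflected chord.
  · rintro ⟨A', hA', hm⟩
    obtain ⟨m₁, h1', h2'⟩ := key hA' hB
    rw [(h1' m).1 hm]
    exact (h2 m₁).1 ((h2' m₁).2 rfl)
  · rintro ⟨B', hB', hm⟩
    obtain ⟨m₁, h1', h2'⟩ := key hA hB'
    rw [(h2' m).1 hm]
    exact (h1 m₁).1 ((h1' m₁).2 rfl)

end ThreeBody

end

/-- For every chord `(x, T)` of the regularized restricted three-body problem below the first
critical energy, the reflected chord `(x_𝓡, T)` is a chord, the Robbin-Salamon indices of both are
well defined, and they agree. -/
theorem mainTheorem6 (μ c : ℝ) (hμ0 : 0 < μ) (hμ1 : μ < 1)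
    (hc : ThreeBody.IsBelowFirstCriticalValue μ c) (P : ThreeBody.Primary)
    (T : ℝ) (hT : 0 < T) (x : ℝ → ThreeBody.R3 × ThreeBody.R3)
    (hx : ThreeBody.IsChord μ c P T x) :
    ThreeBody.IsChord μ c P T (ThreeBody.reflectedChord T x) ∧
    (∃! m : ℝ, ThreeBody.IsChordIndex μ c P T x m) ∧
    (∃! m : ℝ, ThreeBody.IsChordIndex μ c P T (ThreeBody.reflectedChord T x) m) ∧
    ThreeBody.robbinSalamonIndex μ c P T x =
      ThreeBody.robbinSalamonIndex μ c P T (ThreeBody.reflectedChord T x) := by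
  obtain ⟨m₀, h1, h2⟩ := ThreeBody.exists_isChordIndex_iff hμ0 hμ1 hc hT hx
  -- The two predicates are equal, so `Classical.epsilon` picks the same number for both.
  have h : ThreeBody.IsChordIndex μ c P T x =
      ThreeBody.IsChordIndex μ c P T (ThreeBody.reflectedChord T x) := by
    funext m
    exact propext ((h1 m).trans (h2 m).symm)
  exact ⟨ThreeBody.isChord_reflectedChord hx, ⟨m₀, (h1 m₀).2 rfl, fun m hm => (h1 m).1 hm⟩,
    ⟨m₀, (h2 m₀).2 rfl, fun m hm => (h2 m).1 hm⟩,
    by rw [ThreeBody.robbinSalamonIndex, ThreeBody.robbinSalamonIndex, h]⟩
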